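/- **Setting.** Let $\mathsf G$ be a connected semisimple real Lie group with Lie algebra $\mathfrak g$, Cartan involution $\theta$, maximal abelian $\mathfrak a$ in the $-1$-eigenspace of $\theta$, a system of simple restricted roots, and a standard parabolic subgroup $\mathsf P=\mathsf M_{\mathsf P}\mathsf A_{\mathsf P}\mathsf N_{\mathsf P}$ given by a subset $I$ of the simple roots (the simple roots of the Levi factor). Put $\mathrm{ht}_{\mathsf P}(\sum_\alpha a_\alpha\alpha)=\sum_{\alpha\notin I}a_\alpha$, let $\mathfrak g=\bigoplus_{j=-k}^k\mathfrak g_j$ be the grading of $\mathfrak g$ by the height of the restricted roots, and $H_{\mathsf P}\in\mathfrak a_{\mathsf P}=\bigcap_{\alpha\in I}\ker\alpha$ the grading element. Here $\mathsf A_{\mathsf P}=\exp\mathfrak a_{\mathsf P}$, $\mathrm{rk}(\mathsf A_{\mathsf P})=\dim\mathfrak a_{\mathsf P}$, $\mathsf N_{\mathsf P}=\exp\bigoplus_{j>0}\mathfrak g_j$, and $\overline{\mathsf N}_{\mathsf P}=\exp\overline{\mathfrak n}_{\mathsf P}$ with $\overline{\mathfrak n}_{\mathsf P}=\bigoplus_{j>0}\mathfrak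 g_{-j}$. The dilation $\delta_r$, $r>0$, acts on $\mathfrak g_{-j}$ by $r^j$. For a continuous homomorphism $\chi:\mathsf A_{\mathsf P}\to\mathbb C^\times$ put $\mathrm{ht}_{\mathsf P}(\chi)=d\chi(H_{\mathsf P})$, and let $\mathbb C_\chi$ be $\mathbb C$ with $\mathsf A_{\mathsf P}$ acting through $\chi$. For $m\in\mathbb C$ let $\mathcal P^m$ be the space of polynomial densities $p$ on $\overline{\mathsf N}_{\mathsf P}$ with $(\delta_r)_*p=r^mp$ for $r>0$. Let $\Sigma^m_H\overline{\mathsf N}_{\mathsf P}\subseteq\mathcal D'(\overline{\mathsf N}_{\mathsf P})/\mathcal P^m$ be the space of classes of distributions $k_m+p_m\log|\cdot|_H$, where $k_m$ is smooth away from the origin with $(\delta_r)_*k_m-r^mk_m\in\mathcal P^m$ for all $r>0$, $p_m\in\mathcal P^m$, and $|\cdot|_H$ is a homogeneous gauge, smooth away from the origin. Let $\mathcal U_m(\overline{\mathfrak n}_{\mathsf P})$ be the weight $m$ part of the complexified universal enveloping algebra, viewed as distributions supported at the origin. Let $V_1,V_2$ be finite-dimensional continuous complex $\mathsf M_{\mathsf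 P}\mathsf A_{\mathsf P}$-representations graded by subrepresentations, $V_i=\bigoplus_{\nu\in\mathbb R}V_i[\nu]$, extended trivially on $\mathsf N_{\mathsf P}$, and let $E_i=\mathsf G\times_{\mathsf P}V_i$ be the graded homogeneous bundles over $\mathfrak X=\mathsf G/\mathsf P$. Let $\Sigma^m_H(\mathfrak X;E_1,E_2)$ be the space of smooth sections (represented by smooth families of distributions, jointly smooth off the zero section) of $\mathsf G\times_{\mathsf P}(\Sigma^m_H\overline{\mathsf N}_{\mathsf P}\otimes\mathrm{Hom}(V_1,V_2))$, where $\mathsf M_{\mathsf P}\mathsf A_{\mathsf P}$ acts on $\overline{\mathsf N}_{\mathsf P}$ by conjugation and $\mathsf N_{\mathsf P}$ acts trivially. The graded symbol space $\Sigma^m_{H,\mathrm{gr}}(\mathfrak X;E_1,E_2)$ consists of the matrices $(a_{\mu\nu})$ with $a_{\mu\nu}\in\Sigma^{m+\mu-\nu}_H(\mathfrak X;E_1[\nu],E_2[\mu])$. **Statement.** Let $m\in\mathbb C$. 1. If $\mathrm{rk}(\mathsf A_{\mathsf P})>1$, then every $\mathsf G$-invariant $a\in\Sigma^m_H(\mathfrak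 X;E_1,E_2)^{\mathsf G}$ is the symbol of a differential operator, i.e. it is represented by a smooth family of elements of $\mathcal U_m(\overline{\mathfrak n}_{\mathsf P})\otimes\mathrm{Hom}(V_1,V_2)$ (so $a=0$ if $m\notin\mathbb N$). Likewise all the entries of every element of $\Sigma^m_{H,\mathrm{gr}}(\mathfrak X;E_1,E_2)^{\mathsf G}$ are symbols of differential operators. 2. If $\mathrm{rk}(\mathsf A_{\mathsf P})=1$, then for every $z\in\mathbb C$ there is exactly one quasicharacter $\chi=\mathrm{ht}_{\mathsf P}^{-1}(z)$ of $\mathsf A_{\mathsf P}$ of height $z$. With $\chi=\mathrm{ht}_{\mathsf P}^{-1}(m)$ and $V_1^{(m)}=V_1\otimes\mathbb C_\chi$, evaluation at the base point is a linear isomorphism $$\Sigma^m_H(\mathfrak X;E_1,E_2)^{\mathsf G}\;\cong\;\bigl(\Sigma^m_H\overline{\mathsf N}_{\mathsf P}\otimes\mathrm{Hom}_{\mathsf A_{\mathsf P}}(V_1^{(m)},V_2)\bigr)^{\mathsf M_{\mathsf P}}.$$ Likewise, evaluation at the base point is a linear isomorphism from $\Sigma^m_{H,\mathrm{gr}}(\mathfrak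 X;E_1,E_2)^{\mathsf G}$ onto the space of matrices $(c_{\mu\nu})$ with $c_{\mu\nu}\in\bigl(\Sigma^{m+\mu-\nu}_H\overline{\mathsf N}_{\mathsf P}\otimes\mathrm{Hom}_{\mathsf A_{\mathsf P}}(V_1[\nu]^{(m+\mu-\nu)},V_2[\mu])\bigr)^{\mathsf M_{\mathsf P}}$. -/

import Mathlib

open MeasureTheory Module
open scoped Distributions ContDiff Manifold

noncomputable section

namespace FlatParabolic

section Distributions

variable {N : Type*} [NormedAddCommGroup N] [NormedSpace ℝ N]

/-- The space `𝓓(N)` of real test functions on a real vector space `N`. -/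
abbrev Test (N : Type*) [NormedAddCommGroup N] [NormedSpace ℝ N] : Type _ :=
  𝓓((⊤ : TopologicalSpace.Opens N), ℝ)

/-- The space `𝓓'(N; W)` of `W`-valued distributions on a real vector space `N`. -/
abbrev Dist (N : Type*) [NormedAddCommGroup N] [NormedSpace ℝ N]
    (W : Type*) [NormedAddCommGroup W] [NormedSpace ℂ W] : Type _ :=
  𝓓'((⊤ : TopologicalSpace.Opens N), W)

/-- The pullback `f ↦ f ∘ T` of test functions along a linear isomorphism. -/
def pullback (T : N ≃L[ℝ] N) : Test N →L[ℝ] Test N :=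
  TestFunction.limitCLM ℝ
    (fun f => ⟨f ∘ T, f.contDiff.comp T.contDiff,
      f.hasCompactSupport.comp_homeomorph T.toHomeomorph, fun _ _ => trivial⟩)
    (fun K _ =>
      (TestFunction.ofSupportedInCLM ℝ (Ω := (⊤ : TopologicalSpace.Opens N))
        (K := ⟨T ⁻¹' K, T.toHomeomorph.isCompact_preimage.2 K.isCompact⟩) (fun _ _ => trivial)) ∘L
      ContDiffMapSupportedIn.mkCLM ℝ (fun f => f ∘ T) (fun _ _ _ => rfl) (fun _ _ _ => rfl)
        (fun f => f.contDiff.comp T.contDiff)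
        (fun f x hx => f.zero_on_compl (x := T x) hx)
        (fun i hi => ⟨{i}, ‖(T : N →L[ℝ] N)‖ ^ i, by positivity, fun f x _ => by
          have h := (T : N →L[ℝ] N).iteratedFDeriv_comp_right (f := f) f.contDiff x
            (i := i) (by exact_mod_cast le_top)
          have h2 := ContDiffMapSupportedIn.norm_iteratedFDeriv_apply_le_seminorm_top
            (𝕜 := ℝ) (f := f) (x := T x) (i := i)
          change ‖iteratedFDeriv ℝ i (f ∘ (T : N →L[ℝ] N)) x‖ ≤ _
          rw [h]
          refine (ContinuousMultilinearMap.norm_compContinuousLinearMap_le _ _).trans ?_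
          simp only [Finset.prod_const, Finset.card_univ, Fintype.card_fin, Finset.sup_singleton]
          rw [mul_comm]
          gcongr
          exact h2⟩))
    (fun _ _ _ => rfl)

@[simp] theorem pullback_apply (T : N ≃L[ℝ] N) (f : Test N) (X : N) :
    pullback T f X = f (T X) := rfl

variable {W : Type*} [NormedAddCommGroup W] [NormedSpace ℂ W]
  {W' : Type*} [NormedAddCommGroup W'] [NormedSpace ℂ W']

/-- The pushforward of distributions `(T_* k)(f) = k (f ∘ T)` along a linear isomorphism. -/
def pushforward (T : N ≃L[ℝ] N) : Dist N W →ₗ[ℂ] Dist N W where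
  toFun k := (pullback T).precompCompactConvergenceCLM W k
  map_add' _ _ := rfl
  map_smul' _ _ := rfl

@[simp] theorem pushforward_apply (T : N ≃L[ℝ] N) (k : Dist N W) (f : Test N) :
    pushforward T k f = k (pullback T f) := rfl

/-- Applying a linear map of the target to a vector valued distribution. -/
def mapTarget (L : W →L[ℂ] W') : Dist N W →ₗ[ℂ] Dist N W' where
  toFun k := Distribution.mapCLM (L.restrictScalars ℝ) k
  map_add' _ _ := by ext; simp
  map_smul' _ _ := by ext; simp

@[simp] theorem mapTarget_apply (L : W →L[ℂ] W') (k : Dist N W) (f : Test N) :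
    mapTarget L k f = L (k f) := rfl

/-- The elementary tensor `k ⊗ w`, i.e. the distribution `f ↦ k(f) w`. -/
def tmul (k : Dist N ℂ) (w : W) : Dist N W :=
  mapTarget (ContinuousLinearMap.toSpanSingleton ℂ w) k

/-- For a space `S` of scalar distributions and a subspace `H` of the finite-dimensional space `W`,
the tensor product `S ⊗ H` as a space of `W`-valued distributions. -/
def tensor (S : Submodule ℂ (Dist N ℂ)) (H : Submodule ℂ W) : Submodule ℂ (Dist N W) :=
  Submodule.span ℂ {u | ∃ k ∈ S, ∃ w ∈ H, u = tmul k w}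

end Distributions


section LieTheory

variable (E : Type*) [NormedAddCommGroup E] [NormedSpace ℝ E]
  (G : Type*) [TopologicalSpace G] [ChartedSpace E G] [Group G]

/-- The Lie algebra `𝔤` of `G`, with the bracket of left invariant vector fields. -/
abbrev LieAlg : Type _ := GroupLieAlgebra 𝓘(ℝ, E) G

variable {E G}

/-- The adjoint action `Ad g : 𝔤 → 𝔤`, the differential at `1` of `x ↦ g x g⁻¹`. -/
def Ad (g : G) : LieAlg E G →L[ℝ] LieAlg E G :=
  (mfderiv 𝓘(ℝ, E) 𝓘(ℝ, E) (fun x : G => g * x * g⁻¹) 1 : E →L[ℝ] E)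

/-- `γ` is the one-parameter subgroup `t ↦ exp (t X)`. -/
def IsOneParam (γ : ℝ → G) (X : LieAlg E G) : Prop :=
  (∀ s t, γ (s + t) = γ s * γ t) ∧
    HasMFDerivAt 𝓘(ℝ, ℝ) 𝓘(ℝ, E) γ 0 (ContinuousLinearMap.toSpanSingleton ℝ (X : E))

/-- `g = exp X`. -/
def IsExp (X : LieAlg E G) (g : G) : Prop :=
  ∃ γ : ℝ → G, IsOneParam γ X ∧ g = γ 1

/-- The connected (analytic) subgroup of `G` generated by `exp 𝔰`. -/
def analyticSubgroup (𝔰 : Set (LieAlg E G)) : Subgroup G :=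
  Subgroup.closure {g | ∃ X ∈ 𝔰, IsExp X g}


variable [FiniteDimensional ℝ E]

instance instFiniteDimensionalLieAlg : FiniteDimensional ℝ (LieAlg E G) :=
  inferInstanceAs (FiniteDimensional ℝ E)

instance instCompleteSpaceModel : CompleteSpace E := FiniteDimensional.complete ℝ E

variable [LieGroup 𝓘(ℝ, E) ∞ G]

instance instLieGroupMinSmoothness : LieGroup 𝓘(ℝ, E) (minSmoothness ℝ 3) G := by
  simpa using (inferInstance : LieGroup 𝓘(ℝ, E) 3 G)

variable (E G) in
/-- The data defining a standard parabolic subgroup of a real semisimple Lie group `G`: a Cartan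
involution `θ`, a maximal abelian subspace `𝔞` of the `-1`-eigenspace of `θ`, a system of simple
restricted roots `α₀, …, α_{r-1}` (a basis of `𝔞*` made of roots, such that every root is an
integral combination of them with all coefficients `≥ 0` or all coefficients `≤ 0`), and the set
`Levi` of (indices of) those simple roots which are roots of the Levi factor. -/
structure StandardParabolic where
  θ : LieAlg E G ≃ₗ⁅ℝ⁆ LieAlg E G
  involutive : ∀ X, θ (θ X) = X
  cartan : ∀ X, X ≠ 0 → killingForm ℝ (LieAlg E G) X (θ X) < 0
  𝔞 : Submodule ℝ (LieAlg E G)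
  neg_of_mem : ∀ H ∈ 𝔞, θ H = -H
  abelian : ∀ H ∈ 𝔞, ∀ H' ∈ 𝔞, ⁅H, H'⁆ = 0
  maximal : ∀ X, θ X = -X → (∀ H ∈ 𝔞, ⁅H, X⁆ = 0) → X ∈ 𝔞
  simple : Basis (Fin (finrank ℝ 𝔞)) ℝ (Dual ℝ 𝔞)
  simple_isRoot : ∀ i, ∃ X : LieAlg E G, X ≠ 0 ∧ ∀ H : 𝔞, ⁅(H : LieAlg E G), X⁆ = simple i H • X
  root_nonneg_or_nonpos : ∀ lam : Dual ℝ 𝔞,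
    (∃ X : LieAlg E G, X ≠ 0 ∧ ∀ H : 𝔞, ⁅(H : LieAlg E G), X⁆ = lam H • X) →
      (∀ i, ∃ n : ℕ, simple.repr lam i = n) ∨ (∀ i, ∃ n : ℕ, simple.repr lam i = -n)
  Levi : Finset (Fin (finrank ℝ 𝔞))

namespace StandardParabolic

variable (D : StandardParabolic E G)

/-- The restricted root space `𝔤_λ` (for `λ = 0`, the centralizer of `𝔞`). -/
def rootSpace (lam : Dual ℝ D.𝔞) : Submodule ℝ (LieAlg E G) where
  carrier := {X | ∀ H : D.𝔞, ⁅(H : LieAlg E G), X⁆ = lam H • X}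
  add_mem' hX hY H := by rw [lie_add, hX H, hY H, smul_add]
  zero_mem' H := by simp
  smul_mem' c X hX H := by rw [lie_smul, hX H, smul_comm]

/-- The height `ht_P (∑ a_α α) = ∑_{α ∉ Levi} a_α`. -/
def ht : Dual ℝ (Dual ℝ D.𝔞) := ∑ i ∈ D.Leviᶜ, D.simple.coord i

/-- The grading `𝔤_j = ⨁_{ht_P λ = j} 𝔤_λ` of `𝔤`. -/
def gr (j : ℤ) : Submodule ℝ (LieAlg E G) :=
  ⨆ (lam : Dual ℝ D.𝔞) (_ : D.ht lam = j), D.rootSpace lam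

/-- The number `k` such that `𝔤 = 𝔤_{-k} ⊕ ⋯ ⊕ 𝔤_k` is `|k|`-graded. -/
def depth : ℕ := sSup {j : ℕ | D.gr j ≠ ⊥}

/-- `𝔞_P`, the common kernel in `𝔞` of the simple roots of the Levi factor. -/
def 𝔞P : Submodule ℝ D.𝔞 := ⨅ i ∈ D.Levi, LinearMap.ker (D.simple i)

/-- The real rank of `A_P`. -/
def rank : ℕ := finrank ℝ D.𝔞P

/-- The subgroup `A_P = exp 𝔞_P`. -/
def A : Subgroup G := analyticSubgroup {X | ∃ H ∈ D.𝔞P, X = (H : LieAlg E G)}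

/-- The subgroup `N_P = exp (𝔤_1 ⊕ ⋯ ⊕ 𝔤_k)`. -/
def N : Subgroup G :=
  analyticSubgroup {X | X ∈ (⨆ (j : ℤ) (_ : 0 < j), D.gr j : Submodule ℝ (LieAlg E G))}

/-- The subgroup `K`, the analytic subgroup of the fixed point algebra of `θ`. -/
def K : Subgroup G := analyticSubgroup {X | D.θ X = X}

/-- The Lie algebra `𝔪_P`, the orthogonal complement of `𝔞_P` in the centralizer of `𝔞_P`. -/
def 𝔪P : Set (LieAlg E G) :=
  {X | ∀ H ∈ D.𝔞P, ⁅(H : LieAlg E G), X⁆ = 0 ∧ killingForm ℝ (LieAlg E G) H X = 0}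

/-- The subgroup `M_P = Z_K(𝔞_P) exp(𝔪_P)` of the Langlands decomposition `P = M_P A_P N_P`. -/
def M : Subgroup G :=
  Subgroup.closure {g | g ∈ D.K ∧ ∀ H ∈ D.𝔞P, Ad (E := E) g H = (H : LieAlg E G)} ⊔
    analyticSubgroup D.𝔪P

/-- The group `M_P A_P`. -/
def MA : Subgroup G := D.M ⊔ D.A

/-- The inclusion of `A_P` in `M_P A_P`. -/
def ofA (a : D.A) : D.MA := ⟨a, (le_sup_right : D.A ≤ D.MA) a.2⟩

/-- The grading element `H_P`, the element of `𝔞` with `λ(H_P) = ht_P(λ)` for all `λ ∈ 𝔞*`. -/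
def gradingElement : D.𝔞 := (evalEquiv ℝ D.𝔞).symm D.ht

theorem apply_gradingElement (lam : Dual ℝ D.𝔞) : lam D.gradingElement = D.ht lam :=
  LinearMap.congr_fun ((evalEquiv ℝ D.𝔞).apply_symm_apply D.ht) lam

theorem gradingElement_mem : D.gradingElement ∈ D.𝔞P := by
  classical
  simp only [𝔞P, Submodule.mem_iInf, LinearMap.mem_ker, apply_gradingElement, ht]
  intro i hi
  rw [LinearMap.sum_apply]
  refine Finset.sum_eq_zero fun j hj => ?_
  have : i ≠ j := fun h => (Finset.mem_compl.1 hj) (h ▸ hi)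
  simp [Basis.coord_apply, Basis.repr_self, this]

/-- `χ` is a quasicharacter `A_P → ℂˣ` of height `z`: a continuous homomorphism whose logarithm
`φ ∈ (𝔞_P)*_ℂ` satisfies `ht_P(φ) = φ(H_P) = z`. -/
def HasHeight (χ : D.A →* ℂˣ) (z : ℂ) : Prop :=
  Continuous χ ∧ ∃ φ : D.𝔞P →ₗ[ℝ] ℂ,
    (∀ (H : D.𝔞P) (a : D.A), IsExp ((H : D.𝔞) : LieAlg E G) (a : G) →
      (χ a : ℂ) = Complex.exp (φ H)) ∧
    φ ⟨D.gradingElement, D.gradingElement_mem⟩ = z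

/-- The subspace `𝔤_{-(j+1)}`, as a subspace of the normed space `E` underlying `𝔤`. -/
def negPart (j : Fin D.depth) : Submodule ℝ E := D.gr (-((j : ℤ) + 1))

/-- The nilpotent Lie algebra `𝔫̄ = 𝔤_{-k} ⊕ ⋯ ⊕ 𝔤_{-1}` as a graded vector space; the summand of
index `j : Fin k` is `𝔤_{-(j+1)}`. The exponential map identifies it with the group `N̄_P`. -/
abbrev Nbar : Type _ := (j : Fin D.depth) → D.negPart j

instance instMeasurableSpaceNbar : MeasurableSpace D.Nbar := borel _

instance instBorelSpaceNbar : BorelSpace D.Nbar := ⟨rfl⟩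

/-- The dilation `δ_r`, acting on `𝔤_{-j}` as multiplication by `r ^ j`. -/
def dilation (r : ℝˣ) : D.Nbar ≃L[ℝ] D.Nbar :=
  ContinuousLinearEquiv.piCongrRight fun j : Fin D.depth =>
    ContinuousLinearEquiv.smulLeft (r ^ ((j : ℕ) + 1))

theorem dilation_apply (r : ℝˣ) (X : D.Nbar) (j : Fin D.depth) :
    D.dilation r X j = (r : ℝ) ^ ((j : ℕ) + 1) • X j := by
  rw [← Units.val_pow_eq_pow_val]
  rfl

/-- The homogeneous dimension `∑_j j dim 𝔤_{-j}`. -/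
def hdim : ℕ := ∑ j : Fin D.depth, ((j : ℕ) + 1) * finrank ℝ (D.negPart j)

open Classical in
/-- The automorphism `Ad(l)` of `𝔫̄`. (Every `l ∈ M_P A_P` preserves the grading of `𝔤`, so that the
first alternative applies to all `l` for which this definition is used.) -/
def adNbar (l : G) : D.Nbar ≃L[ℝ] D.Nbar :=
  if h : ∃ T : D.Nbar ≃L[ℝ] D.Nbar, ∀ X j, (T X j : E) = Ad (E := E) l (X j : E) then
    h.choose
  else ContinuousLinearEquiv.refl ℝ D.Nbar


section SymbolAlgebra

/-- The scalar distributions on `𝔫̄` (equivalently on `N̄_P`). -/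
abbrev ScalarDist : Type _ := Dist D.Nbar ℂ

variable {D}

/-- On test functions whose support avoids the closed set `S`, the distribution `k` is given by the
density `h(X) dX`. -/
def IsDensityOff {W : Type*} [NormedAddCommGroup W] [NormedSpace ℂ W]
    (S : Set D.Nbar) (k : Dist D.Nbar W) (h : D.Nbar → W) : Prop :=
  ∀ f : Test D.Nbar, Disjoint (tsupport f) S →
    Integrable (fun X => f X • h X) Measure.addHaar ∧ k f = ∫ X, f X • h X ∂Measure.addHaar

variable (D)

/-- The polynomial functions `p : 𝔫̄ → ℂ` for which the density `p(X) dX` is homogeneous of degree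
`m`, i.e. `p(δ_r X) = r ^ (-m - dim_h) p(X)`. -/
def polyFun (m : ℂ) : Submodule ℂ (D.Nbar → ℂ) :=
  Subalgebra.toSubmodule
      (Algebra.adjoin ℂ {p : D.Nbar → ℂ | ∃ φ : D.Nbar →ₗ[ℝ] ℂ, p = fun X => φ X}) ⊓
    { carrier := {p | ∀ r : ℝˣ, 0 < (r : ℝ) → ∀ X,
        p (D.dilation r X) = ((r : ℝ) : ℂ) ^ (-m - D.hdim) * p X}
      add_mem' := fun hp hq r hr X => by simp [hp r hr X, hq r hr X, mul_add]
      zero_mem' := fun r hr X => by simp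
      smul_mem' := fun c p hp r hr X => by simp [hp r hr X, mul_left_comm] }

/-- The space `𝒫^m` of polynomial densities on `𝔫̄` of degree `m`. -/
def polyDist (m : ℂ) : Submodule ℂ D.ScalarDist where
  carrier := {k | ∃ p ∈ D.polyFun m, IsDensityOff ∅ k p}
  add_mem' := by
    rintro k l ⟨p, hp, hk⟩ ⟨q, hq, hl⟩
    refine ⟨p + q, add_mem hp hq, fun f hf => ?_⟩
    simp only [Pi.add_apply, smul_add]
    refine ⟨(hk f hf).1.add (hl f hf).1, ?_⟩
    rw [integral_add (hk f hf).1 (hl f hf).1, ← (hk f hf).2, ← (hl f hf).2]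
    rfl
  zero_mem' := ⟨0, zero_mem _, fun f _ => by simp⟩
  smul_mem' := by
    rintro c k ⟨p, hp, hk⟩
    refine ⟨c • p, Submodule.smul_mem _ _ hp, fun f hf => ?_⟩
    simp only [Pi.smul_apply, smul_comm _ c]
    refine ⟨(hk f hf).1.smul c, ?_⟩
    rw [integral_smul, ← (hk f hf).2]
    rfl

/-- The distributions on `𝔫̄`, smooth away from the origin, which are homogeneous of degree `m`
modulo `𝒫^m`, i.e. `(δ_r)_* k - r ^ m k ∈ 𝒫^m` for all `r > 0`. -/
def homogDist (m : ℂ) : Submodule ℂ D.ScalarDist where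
  carrier := {k |
    (∀ r : ℝˣ, 0 < (r : ℝ) →
      pushforward (D.dilation r) k - ((r : ℝ) : ℂ) ^ m • k ∈ D.polyDist m) ∧
    ∃ h : D.Nbar → ℂ, ContDiffOn ℝ ∞ h {0}ᶜ ∧ IsDensityOff {0} k h}
  add_mem' := by
    rintro k l ⟨hk, h, hh, hkh⟩ ⟨hl, g, hg, hlg⟩
    refine ⟨fun r hr => ?_, h + g, hh.add hg, fun f hf => ?_⟩
    · convert add_mem (hk r hr) (hl r hr) using 1
      rw [map_add, smul_add]; abel
    simp only [Pi.add_apply, smul_add]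
    refine ⟨(hkh f hf).1.add (hlg f hf).1, ?_⟩
    rw [integral_add (hkh f hf).1 (hlg f hf).1, ← (hkh f hf).2, ← (hlg f hf).2]
    rfl
  zero_mem' := ⟨fun r hr => by simp, 0, contDiffOn_const, fun f _ => by simp⟩
  smul_mem' := by
    rintro c k ⟨hk, h, hh, hkh⟩
    refine ⟨fun r hr => ?_, c • h, hh.const_smul c, fun f hf => ?_⟩
    · convert Submodule.smul_mem _ c (hk r hr) using 1
      rw [map_smul, smul_sub, smul_comm]
    simp only [Pi.smul_apply, smul_comm _ c]
    refine ⟨(hkh f hf).1.smul c, ?_⟩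
    rw [integral_smul, ← (hkh f hf).2]
    rfl

/-- A gauge `|·|_H` on `𝔫̄`: a continuous function, positive and smooth away from the origin, with
`|δ_r X|_H = r |X|_H`. -/
structure IsGauge (ν : D.Nbar → ℝ) : Prop where
  continuous : Continuous ν
  pos : ∀ X, X ≠ 0 → 0 < ν X
  smooth : ContDiffOn ℝ ∞ ν {0}ᶜ
  homogeneous : ∀ r : ℝˣ, 0 < (r : ℝ) → ∀ X, ν (D.dilation r X) = r * ν X

/-- The space of all distributions `k_m + p_m log |·|_H` with `k_m` homogeneous of degree `m` modulo
`𝒫^m` and smooth away from the origin, `p_m ∈ 𝒫^m`, and `|·|_H` a gauge. The symbol space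
`Σ^m_H N̄_P ⊆ 𝒟'(N̄_P) / 𝒫^m` is the image of this space. -/
def symDist (m : ℂ) : Submodule ℂ D.ScalarDist :=
  D.homogDist m ⊔ Submodule.span ℂ {k | ∃ ν, D.IsGauge ν ∧ ∃ p ∈ D.polyFun m,
    IsDensityOff ∅ k (fun X => p X * Real.log (ν X))}

/-- The space `𝒰_m(𝔫̄)` of elements of weight `m` in the complexified universal enveloping algebra,
as distributions supported at the origin: in exponential coordinates, the symmetrization of
`X₁ ⋯ X_l` with `X_i ∈ 𝔤_{-d_i}` and `d_1 + ⋯ + d_l = m` acts as the directional derivative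
`f ↦ (∂_{X₁} ⋯ ∂_{X_l} f)(0)`. Convolutions with these distributions are the translation invariant
differential operators on `N̄_P` which are homogeneous of degree `m`. -/
def envDist (m : ℂ) : Submodule ℂ D.ScalarDist :=
  Submodule.span ℂ {k | ∃ (l : ℕ) (d : Fin l → Fin D.depth) (X : (i : Fin l) → D.negPart (d i)),
    ((∑ i, ((d i : ℕ) + 1) : ℕ) : ℂ) = m ∧
    ∀ f : Test D.Nbar,
      k f = (iteratedFDeriv ℝ l f 0 (fun i => Pi.single (d i) (X i)) : ℝ)}

end SymbolAlgebra

section HomogeneousBundles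

/-- A finite-dimensional continuous representation of `M_P A_P` on `V` with a grading
`V = ⨁_{ν ∈ ℝ} V[ν]` by subrepresentations. -/
structure GradedRep (V : Type*) [NormedAddCommGroup V] [NormedSpace ℂ V] where
  ρ : D.MA →* (V →L[ℂ] V)
  continuous : Continuous ρ
  piece : ℝ → Submodule ℂ V
  isInternal : DirectSum.IsInternal piece
  stable : ∀ l ν, ∀ v ∈ piece ν, ρ l v ∈ piece ν

variable {V₁ V₂ : Type*} [NormedAddCommGroup V₁] [NormedSpace ℂ V₁]
  [NormedAddCommGroup V₂] [NormedSpace ℂ V₂]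

variable {D}

/-- The representation of `M_P A_P` on `V[ν]`. -/
def GradedRep.pieceRep (R : D.GradedRep V₁) (ν : ℝ) :
    D.MA →* (R.piece ν →L[ℂ] R.piece ν) where
  toFun l := ((R.ρ l).comp (R.piece ν).subtypeL).codRestrict (R.piece ν)
    fun v => R.stable l ν v v.2
  map_one' := by ext; simp
  map_mul' l l' := by ext; simp; rfl

variable (D V₁ V₂) in
/-- The fibre `𝒟'(𝔫̄; Hom(V₁, V₂)) / (𝒫^m ⊗ Hom(V₁, V₂))`. -/
abbrev Fibre (m : ℂ) : Type _ :=
  Dist D.Nbar (V₁ →L[ℂ] V₂) ⧸ tensor (D.polyDist m) (⊤ : Submodule ℂ (V₁ →L[ℂ] V₂))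

/-- The class of a distribution in the fibre. -/
abbrev toFibre (m : ℂ) : Dist D.Nbar (V₁ →L[ℂ] V₂) →ₗ[ℂ] D.Fibre V₁ V₂ m := Submodule.mkQ _

variable (D V₁ V₂) in
/-- The subspace `Σ^m_H N̄_P ⊗ S` of the fibre, for a subspace `S` of `Hom(V₁, V₂)`. -/
def symFibre (m : ℂ) (S : Submodule ℂ (V₁ →L[ℂ] V₂)) : Submodule ℂ (D.Fibre V₁ V₂ m) :=
  (tensor (D.symDist m) S).map (toFibre m)

variable (ρ₁ : D.MA →* (V₁ →L[ℂ] V₁)) (ρ₂ : D.MA →* (V₂ →L[ℂ] V₂))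

/-- The action of `l ∈ M_P A_P` on `Hom(V₁, V₂)`-valued distributions on `𝔫̄`,
`l · k = ρ₂(l) ∘ (Ad(l)_* k) ∘ ρ₁(l)⁻¹`. -/
def act (l : D.MA) : Dist D.Nbar (V₁ →L[ℂ] V₂) →ₗ[ℂ] Dist D.Nbar (V₁ →L[ℂ] V₂) :=
  mapTarget (((ContinuousLinearMap.compL ℂ V₁ V₂ V₂ (ρ₂ l))).comp
      ((ContinuousLinearMap.compL ℂ V₁ V₁ V₂).flip (ρ₁ l⁻¹))) ∘ₗ
    pushforward (D.adNbar (l : G))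

theorem act_apply (l : D.MA) (k : Dist D.Nbar (V₁ →L[ℂ] V₂)) (f : Test D.Nbar) :
    act ρ₁ ρ₂ l k f = (ρ₂ l).comp ((k (pullback (D.adNbar (l : G)) f)).comp (ρ₁ l⁻¹)) := rfl

/-- The relation `l · c = c'` between elements `c, c'` of the fibre, where `l · [k] = [l · k]`. -/
def ActsTo (m : ℂ) (l : D.MA) (c c' : D.Fibre V₁ V₂ m) : Prop :=
  ∃ k, toFibre m k = c ∧ toFibre m (act ρ₁ ρ₂ l k) = c'

variable {ρ₁ ρ₂} in
theorem ActsTo.zero {m : ℂ} {l : D.MA} : ActsTo ρ₁ ρ₂ m l (0 : D.Fibre V₁ V₂ m) 0 :=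
  ⟨0, by simp, by simp⟩

variable {ρ₁ ρ₂} in
theorem ActsTo.add {m : ℂ} {l : D.MA} {c c' b b' : D.Fibre V₁ V₂ m}
    (hc : ActsTo ρ₁ ρ₂ m l c c') (hb : ActsTo ρ₁ ρ₂ m l b b') :
    ActsTo ρ₁ ρ₂ m l (c + b) (c' + b') := by
  obtain ⟨k, rfl, rfl⟩ := hc
  obtain ⟨k', rfl, rfl⟩ := hb
  exact ⟨k + k', by simp, by simp⟩

variable {ρ₁ ρ₂} in
theorem ActsTo.smul {m : ℂ} {l : D.MA} {c c' : D.Fibre V₁ V₂ m} (a : ℂ)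
    (hc : ActsTo ρ₁ ρ₂ m l c c') : ActsTo ρ₁ ρ₂ m l (a • c) (a • c') := by
  obtain ⟨k, rfl, rfl⟩ := hc
  exact ⟨a • k, by simp, by simp⟩

/-- A smooth family of distributions on `𝔫̄` parametrized by `G`, which is moreover given by a
jointly smooth density away from the origin of `𝔫̄`. -/
def IsSmoothFamily {W : Type*} [NormedAddCommGroup W] [NormedSpace ℂ W]
    (k : G → Dist D.Nbar W) : Prop :=
  (∀ f : Test D.Nbar, ContMDiff 𝓘(ℝ, E) 𝓘(ℝ, W) ∞ (fun g => k g f)) ∧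
  ∃ h : G × D.Nbar → W,
    ContMDiffOn (𝓘(ℝ, E).prod 𝓘(ℝ, D.Nbar)) 𝓘(ℝ, W) ∞ h {x | x.2 ≠ 0} ∧
    ∀ g, IsDensityOff {0} (k g) (fun X => h (g, X))

theorem IsSmoothFamily.zero {W : Type*} [NormedAddCommGroup W] [NormedSpace ℂ W] :
    IsSmoothFamily (0 : G → Dist D.Nbar W) :=
  ⟨fun _ => contMDiff_const, 0, contMDiffOn_const, fun g f _ => by simp⟩

theorem IsSmoothFamily.add {W : Type*} [NormedAddCommGroup W] [NormedSpace ℂ W]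
    {k l : G → Dist D.Nbar W} (hk : IsSmoothFamily k) (hl : IsSmoothFamily l) :
    IsSmoothFamily (k + l) := by
  obtain ⟨hk, h, hh, hkh⟩ := hk
  obtain ⟨hl, h', hh', hlh⟩ := hl
  refine ⟨fun f => (hk f).add (hl f), h + h', hh.add hh', fun g f hf => ?_⟩
  simp only [Pi.add_apply, smul_add]
  refine ⟨(hkh g f hf).1.add (hlh g f hf).1, ?_⟩
  rw [integral_add (hkh g f hf).1 (hlh g f hf).1, ← (hkh g f hf).2, ← (hlh g f hf).2]
  rfl

theorem IsSmoothFamily.smul {W : Type*} [NormedAddCommGroup W] [NormedSpace ℂ W]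
    {k : G → Dist D.Nbar W} (c : ℂ) (hk : IsSmoothFamily k) : IsSmoothFamily (c • k) := by
  obtain ⟨hk, h, hh, hkh⟩ := hk
  have hc : ContDiff ℝ ∞ (fun w : W => c • w) := contDiff_const_smul c
  refine ⟨fun f => hc.contMDiff.comp (hk f), c • h, hc.contMDiff.comp_contMDiffOn hh,
    fun g f hf => ?_⟩
  simp only [Pi.smul_apply, smul_comm _ c]
  refine ⟨(hkh g f hf).1.smul c, ?_⟩
  rw [integral_smul, ← (hkh g f hf).2]
  rfl

/-- The symbol space `Σ^m_H(G/P; E₁, E₂)` for the homogeneous bundles `E_i = G ×_P V_i`, where `P`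
acts through `P → P / N_P ≅ M_P A_P`. The osculating groupoid of `G/P` is the bundle of graded
nilpotent groups `G ×_P N̄_P`, so a symbol is a smooth section of the homogeneous bundle over `G/P`
with fibre `Σ^m_H N̄_P ⊗ Hom(V₁, V₂)`. Sections of a homogeneous bundle are functions `a` on `G` with
`a(g p) = p⁻¹ · a(g)` for all `p = l n`, `l ∈ M_P A_P`, `n ∈ N_P`. -/
def symbolSpace (m : ℂ) : Submodule ℂ (G → D.Fibre V₁ V₂ m) where
  carrier := {a | (∀ g, a g ∈ D.symFibre V₁ V₂ m ⊤) ∧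
    (∀ (g : G) (l : D.MA) (n : D.N), ActsTo ρ₁ ρ₂ m l (a (g * ((l : G) * (n : G)))) (a g)) ∧
    ∃ k : G → Dist D.Nbar (V₁ →L[ℂ] V₂), IsSmoothFamily k ∧ ∀ g, a g = toFibre m (k g)}
  add_mem' := by
    rintro a b ⟨ha, ha', k, hk, hak⟩ ⟨hb, hb', l, hl, hbl⟩
    exact ⟨fun g => add_mem (ha g) (hb g), fun g l n => (ha' g l n).add (hb' g l n),
      k + l, hk.add hl, fun g => by simp [hak, hbl]⟩
  zero_mem' := ⟨fun g => zero_mem _, fun g l n => ActsTo.zero, 0, .zero, fun g => by simp⟩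
  smul_mem' := by
    rintro c a ⟨ha, ha', k, hk, hak⟩
    exact ⟨fun g => Submodule.smul_mem _ c (ha g), fun g l n => (ha' g l n).smul c,
      c • k, hk.smul c, fun g => by simp [hak]⟩

/-- The `G`-invariant symbols `Σ^m_H(G/P; E₁, E₂)^G`, where `(h · a)(g) = a(h⁻¹ g)`. -/
def invariantSymbols (m : ℂ) : Submodule ℂ (G → D.Fibre V₁ V₂ m) :=
  symbolSpace ρ₁ ρ₂ m ⊓
    { carrier := {a | ∀ h g, a (h⁻¹ * g) = a g}
      add_mem' := fun ha hb h g => by simp [ha h g, hb h g]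
      zero_mem' := fun _ _ => rfl
      smul_mem' := fun c a ha h g => by simp [ha h g] }

/-- The symbol `a` is the symbol of a differential operator: it is represented by a smooth family of
elements of `𝒰_m(𝔫̄) ⊗ Hom(V₁, V₂)`. -/
def IsDifferentialSymbol (m : ℂ) (a : G → D.Fibre V₁ V₂ m) : Prop :=
  ∃ u : G → Dist D.Nbar (V₁ →L[ℂ] V₂), IsSmoothFamily u ∧
    ∀ g, u g ∈ tensor (D.envDist m) ⊤ ∧ a g = toFibre m (u g)

/-- The space `Hom_{A_P}(V₁ ⊗ ℂ_χ, V₂)` for a quasicharacter `χ` of `A_P`. -/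
def twistedHom (χ : D.A →* ℂˣ) : Submodule ℂ (V₁ →L[ℂ] V₂) where
  carrier := {T | ∀ (a : D.A) (v : V₁), T ((χ a : ℂ) • ρ₁ (D.ofA a) v) = ρ₂ (D.ofA a) (T v)}
  add_mem' := fun hS hT a v => by
    rw [add_apply, hS a v, hT a v, add_apply, map_add]
  zero_mem' := fun a v => by simp
  smul_mem' := fun c T hT a v => by
    rw [smul_apply, hT a v, smul_apply, map_smul]

/-- The space `(Σ^m_H N̄_P ⊗ Hom_{A_P}(V₁ ⊗ ℂ_χ, V₂))^{M_P}`. -/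
def invariantFibre (m : ℂ) (χ : D.A →* ℂˣ) : Submodule ℂ (D.Fibre V₁ V₂ m) :=
  D.symFibre V₁ V₂ m (twistedHom ρ₁ ρ₂ χ) ⊓
    { carrier := {c | ∀ l : D.MA, (l : G) ∈ D.M → ActsTo ρ₁ ρ₂ m l c c}
      add_mem' := fun hc hb l hl => (hc l hl).add (hb l hl)
      zero_mem' := fun _ _ => ActsTo.zero
      smul_mem' := fun a _ hc l hl => (hc l hl).smul a }

end HomogeneousBundles

section Graded

variable {V₁ V₂ : Type*} [NormedAddCommGroup V₁] [NormedSpace ℂ V₁]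
  [NormedAddCommGroup V₂] [NormedSpace ℂ V₂] {D}
  (R₁ : D.GradedRep V₁) (R₂ : D.GradedRep V₂) (m : ℂ)

/-- The `G`-invariant elements of the graded symbol space `Σ^m_{H,gr}(G/P; E₁, E₂)`, which consists
of the matrices `(a_{μν})` with `a_{μν} ∈ Σ^{m + μ - ν}_H(G/P; E₁[ν], E₂[μ])`. -/
def gradedInvariantSymbols :
    Submodule ℂ ((μ ν : ℝ) → G → D.Fibre (R₁.piece ν) (R₂.piece μ) (m + μ - ν)) :=
  Submodule.pi Set.univ fun μ => Submodule.pi Set.univ fun ν =>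
    invariantSymbols (R₁.pieceRep ν) (R₂.pieceRep μ) (m + μ - ν)

/-- The space of matrices `(c_{μν})` with
`c_{μν} ∈ (Σ^{m + μ - ν}_H N̄_P ⊗ Hom_{A_P}(V₁[ν] ⊗ ℂ_{χ(m + μ - ν)}, V₂[μ]))^{M_P}`. -/
def gradedInvariantFibre (χ : ℂ → D.A →* ℂˣ) :
    Submodule ℂ ((μ ν : ℝ) → D.Fibre (R₁.piece ν) (R₂.piece μ) (m + μ - ν)) :=
  Submodule.pi Set.univ fun μ => Submodule.pi Set.univ fun ν =>
    invariantFibre (R₁.pieceRep ν) (R₂.pieceRep μ) (m + μ - ν) (χ (m + μ - ν))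

end Graded

end StandardParabolic
end LieTheory
end FlatParabolic
end

open FlatParabolic FlatParabolic.StandardParabolic

/-!
A `G`-invariant symbol is a constant function on `G`, and is the same thing as a class of
distributions on `𝔫̄` with values in `Hom(V₁, V₂)` which is fixed by `M_P A_P` modulo the homogeneous
polynomial densities `𝒫^m` (`mem_invariantSymbols_iff`). The logarithmic terms need no separate
treatment: `p log|·|` is itself homogeneous modulo `𝒫^m` (`symDist_eq_homogDist`). The theorem
depends on how much of this invariance comes from `A_P`, which acts on `𝔫̄` through the roots. This
action is found by differentiating `Ad` along one-parameter groups (`hasDerivAt_Ad`), and it is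
diagonal because the restricted root spaces span the Lie algebra (`iSup_rootSpace`).

In rank one, `𝔞_P` is the line through the grading element, and `A_P` acts on `𝔫̄` by dilations. A
quasicharacter of `A_P` is a complex power of the dilation factor, which gives the one of height `z`
(`existsUnique_hasHeight`). As symbols of degree `m` are homogeneous modulo `𝒫^m`, the action of
`A_P` on a symbol amounts to an action on the coefficients in `Hom(V₁, V₂)`, and the symbol is fixed
by `A_P` if and only if it has a representative with coefficients in the twisted intertwiners
(`exists_mem_tensor_of_forall_sub_mem`, `mem_invariantSymbols_iff_of_rank_eq_one`). What remains is
invariance under `M_P`.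

In higher rank, the grading element is the sum of two elements of `𝔞_P` on which the roots of `𝔫̄`
take nonpositive integral values. They generate elements `a₁`, `a₂` of `A_P` each of which fixes a
direction that the other one contracts, and no direction is fixed by both
(`exists_coweight_pair`). Let `h` be the density of an invariant symbol off the origin. It satisfies
`h ∘ T = M ∘ h + q` for both actions `T`, with a linear map `M` and a polynomial `q`. A high
derivative of `h` along a direction contracted by `T` satisfies a homogeneous equation of this kind
with a large factor on the right, while its values stay bounded along an orbit of `T` which
converges to a point other than the origin; so it vanishes (`exists_dirDeriv_iterate_eq_zero`).
Applied to all directions, this shows that `h` is a polynomial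
(`exists_mem_polySpan_of_isCovariant`). Because dilations act semisimply on polynomials, `h` lies in
`𝒫^m` (`mem_polyFun_of_sub_mem`), and subtracting the density `h` from the symbol leaves a
homogeneous distribution supported at the origin. By homogeneity such a distribution depends on a
finite jet of the test function only, so it is an element of `𝒰_m`
(`exists_forall_jet_eq_zero`, `mem_envDist_of_homogeneous`).
-/

noncomputable section

namespace FlatParabolic

section

/-! ### The adjoint action and one-parameter subgroups -/

open Filter Topology

/-- The mixed second derivative of a conjugation map `f` at the identity, in terms of those of the
multiplication map `m`. Here `m` and `f` stand for the multiplication and the map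
`(u, v) ↦ u v u⁻¹` in a chart around the identity `e`, and the two are linked by
`f(u, v) · u = u · v`. Differentiating this relation shows that the derivative of `Ad` is the
commutator of left invariant vector fields. -/
theorem fderiv_fderiv_of_conj {E : Type*} [NormedAddCommGroup E] [NormedSpace ℝ E]
    {m f : E × E → E} {e : E} (hm : ContDiffAt ℝ 3 m (e, e)) (hf : ContDiffAt ℝ 3 f (e, e))
    (hfe : ∀ᶠ u in 𝓝 e, f (u, e) = e) (hef : ∀ᶠ v in 𝓝 e, f (e, v) = v)
    (hme : ∀ᶠ u in 𝓝 e, m (u, e) = u)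
    (hmf : ∀ᶠ p in 𝓝 (e, e), m (f p, p.1) = m p) (X Y : E) :
    HasFDerivAt (fun u => fderiv ℝ f (u, e) (0, Y))
      ((fderiv ℝ (fderiv ℝ f) (e, e)).flip (0, Y) ∘L ContinuousLinearMap.inl ℝ E E) e ∧
    fderiv ℝ (fderiv ℝ f) (e, e) (X, 0) (0, Y) =
      fderiv ℝ (fun u => fderiv ℝ m (u, e) (0, Y)) e X -
        fderiv ℝ (fun u => fderiv ℝ m (u, e) (0, X)) e Y := by
  have hid : HasFDerivAt (fun u : E => (u, e)) (ContinuousLinearMap.inl ℝ E E) e := by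
    simpa using hasFDerivAt_prodMk_left (𝕜 := ℝ) e e
  have hid2 : HasFDerivAt (fun u : E => (e, u)) (ContinuousLinearMap.inr ℝ E E) e := by
    simpa using hasFDerivAt_prodMk_right (𝕜 := ℝ) e e
  have key : ∀ g : E × E → E, ContDiffAt ℝ 3 g (e, e) → ∀ Y,
      HasFDerivAt (fun u => fderiv ℝ g (u, e) (0, Y))
        ((fderiv ℝ (fderiv ℝ g) (e, e)).flip (0, Y) ∘L ContinuousLinearMap.inl ℝ E E) e := by
    intro g hg Y
    have h1 : HasFDerivAt (fderiv ℝ g) (fderiv ℝ (fderiv ℝ g) (e, e)) (e, e) :=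
      ((hg.fderiv_right (m := 1) (by norm_num)).differentiableAt (by norm_num)).hasFDerivAt
    have h2 : HasFDerivAt (fun u => fderiv ℝ g (u, e)) _ e :=
      h1.comp (f := fun u : E => (u, e)) e hid
    refine (h2.clm_apply (hasFDerivAt_const (0, Y) e)).congr_fderiv ?_
    ext w
    simp
  refine ⟨key f hf Y, ?_⟩
  have hfee : f (e, e) = e := hfe.self_of_nhds
  have hsymm : fderiv ℝ (fderiv ℝ m) (e, e) (0, X) (Y, 0) =
      fderiv ℝ (fderiv ℝ m) (e, e) (Y, 0) (0, X) :=
    (hm.isSymmSndFDerivAt (by simp; norm_num)) (0, X) (Y, 0)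
  rw [(key m hm Y).fderiv, (key m hm X).fderiv]
  -- first derivative of the relation, in the direction `(0, Y)` at the points `(u, e)`
  have hpt : Tendsto (fun u : E => (u, e)) (𝓝 e) (𝓝 (e, e)) := hid.continuousAt
  have hmd : ∀ᶠ p in 𝓝 (e, e), DifferentiableAt ℝ m p :=
    (hm.eventually (by simp)).mono fun p hp => hp.differentiableAt (by norm_num)
  have hfd : ∀ᶠ p in 𝓝 (e, e), DifferentiableAt ℝ f p :=
    (hf.eventually (by simp)).mono fun p hp => hp.differentiableAt (by norm_num)
  have hpt2 : Tendsto (fun u : E => (e, u)) (𝓝 e) (𝓝 (e, e)) := hid2.continuousAt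
  have rel : ∀ᶠ u in 𝓝 e, fderiv ℝ m (e, u) (fderiv ℝ f (u, e) (0, Y), 0) =
      fderiv ℝ m (u, e) (0, Y) := by
    filter_upwards [hpt.eventually hmf.eventually_nhds, hpt2.eventually hmd, hpt.eventually hfd,
      hfe] with u h1 h2 h3 h4
    have h5 : HasFDerivAt (fun p => m (f p, p.1)) _ (u, e) :=
      HasFDerivAt.comp (g := m) (f := fun p : E × E => (f p, p.1)) (u, e)
        (by simpa [h4] using h2.hasFDerivAt) (h3.hasFDerivAt.prodMk hasFDerivAt_fst)
    have h6 := (h5.congr_of_eventuallyEq (h1.mono fun p hp => hp.symm)).fderiv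
    rw [h6]
    simp
  -- both sides of `rel` are differentiated at `u = e` in the direction `X`
  have h1 : HasFDerivAt (fderiv ℝ m) (fderiv ℝ (fderiv ℝ m) (e, e)) (e, e) :=
    ((hm.fderiv_right (m := 1) (by norm_num)).differentiableAt (by norm_num)).hasFDerivAt
  have h2 : HasFDerivAt (fun u => fderiv ℝ m (e, u)) _ e :=
    h1.comp (f := fun u : E => (e, u)) e hid2
  have h3 := h2.clm_apply ((key f hf Y).prodMk (hasFDerivAt_const (0 : E) e))
  have h4 := (h3.congr_of_eventuallyEq (rel.mono fun u hu => hu.symm)).unique (key m hm Y)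
  have h5 := DFunLike.congr_fun h4 X
  have hM : ∀ w, fderiv ℝ m (e, e) (w, 0) = w := fun w => by
    have a1 : HasFDerivAt (fun u : E => m (u, e)) _ e :=
      (hmd.self_of_nhds.hasFDerivAt).comp (f := fun u : E => (u, e)) e hid
    have a2 := (a1.congr_of_eventuallyEq (hme.mono fun u hu => hu.symm)).unique (hasFDerivAt_id e)
    simpa using DFunLike.congr_fun a2 w
  have hF : fderiv ℝ f (e, e) (0, Y) = Y := by
    have a1 : HasFDerivAt (fun u : E => f (e, u)) _ e :=
      (hfd.self_of_nhds.hasFDerivAt).comp (f := fun u : E => (e, u)) e hid2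
    have a2 := (a1.congr_of_eventuallyEq (hef.mono fun u hu => hu.symm)).unique (hasFDerivAt_id e)
    simpa using DFunLike.congr_fun a2 Y
  simp [hM, hF] at h5
  simp [← h5, hsymm]

section LieGroup

variable {E : Type*} [NormedAddCommGroup E] [NormedSpace ℝ E]
  {G : Type*} [TopologicalSpace G] [ChartedSpace E G] [Group G]

theorem IsOneParam.map_zero {γ : ℝ → G} {X : LieAlg E G} (h : IsOneParam γ X) : γ 0 = 1 := by
  simpa using h.1 0 0

@[simp] theorem Ad_one : (Ad (1 : G) : LieAlg E G →L[ℝ] LieAlg E G) = .id ℝ _ := by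
  have h : (fun x : G => 1 * x * 1⁻¹) = id := by ext; simp
  have h2 : (mfderiv 𝓘(ℝ, E) 𝓘(ℝ, E) (id : G → G) 1 : E →L[ℝ] E) = .id ℝ E := mfderiv_id
  refine ContinuousLinearMap.ext fun Y => ?_
  exact (congrArg (fun f : G → G => (mfderiv 𝓘(ℝ, E) 𝓘(ℝ, E) f 1 : E →L[ℝ] E) (Y : E)) h).trans
    (DFunLike.congr_fun h2 (Y : E))

/-- A map `G × G → G` read in the chart at `1`. -/
def inChart (F : G × G → G) (p : E × E) : E :=
  extChartAt 𝓘(ℝ, E) (1 : G)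
    (F ((extChartAt 𝓘(ℝ, E) (1 : G)).symm p.1, (extChartAt 𝓘(ℝ, E) (1 : G)).symm p.2))

variable [LieGroup 𝓘(ℝ, E) ∞ G]

theorem contDiffAt_inChart {F : G × G → G}
    (hF : ContMDiff (𝓘(ℝ, E).prod 𝓘(ℝ, E)) 𝓘(ℝ, E) 3 F) {u : E}
    (hu : u ∈ (extChartAt 𝓘(ℝ, E) (1 : G)).target)
    (h1 : F ((extChartAt 𝓘(ℝ, E) (1 : G)).symm u, 1) ∈ (extChartAt 𝓘(ℝ, E) (1 : G)).source) :
    ContDiffAt ℝ 3 (inChart F) (u, extChartAt 𝓘(ℝ, E) (1 : G) 1) := by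
  have : LieGroup 𝓘(ℝ, E) 3 G := inferInstance
  have : IsManifold 𝓘(ℝ, E) 3 G := inferInstance
  set φ := extChartAt 𝓘(ℝ, E) (1 : G) with hφ
  have hs : ∀ v ∈ φ.target, ContMDiffAt 𝓘(ℝ, E) 𝓘(ℝ, E) 3 φ.symm v := fun v hv =>
    (contMDiffOn_extChartAt_symm (1 : G)).contMDiffAt
      ((isOpen_extChartAt_target (1 : G)).mem_nhds hv)
  have h1t : φ 1 ∈ φ.target := mem_extChartAt_target (1 : G)
  have h11 : φ.symm (φ 1) = 1 := extChartAt_to_inv (1 : G)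
  rw [← contMDiffAt_iff_contDiffAt]
  have hφs : ContMDiffAt 𝓘(ℝ, E) 𝓘(ℝ, E) 3 φ (F (φ.symm u, φ.symm (φ 1))) :=
    contMDiffAt_extChartAt' (by rw [h11]; simpa [hφ] using h1)
  have e1 : ContMDiffAt 𝓘(ℝ, E × E) 𝓘(ℝ, E) 3 (fun p : E × E => φ.symm p.1) (u, φ 1) :=
    (hs u hu).comp (u, φ 1) contDiffAt_fst.contMDiffAt
  have e2 : ContMDiffAt 𝓘(ℝ, E × E) 𝓘(ℝ, E) 3 (fun p : E × E => φ.symm p.2) (u, φ 1) :=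
    (hs _ h1t).comp (u, φ 1) contDiffAt_snd.contMDiffAt
  exact hφs.comp (u, φ 1) ((hF (φ.symm u, φ.symm (φ 1))).comp (u, φ 1) (e1.prodMk e2))

/-- The derivative of a partial map `F(g, ·)` followed by the chart at `1`. -/
theorem mfderiv_chart_comp {F : G × G → G}
    (hF : ContMDiff (𝓘(ℝ, E).prod 𝓘(ℝ, E)) 𝓘(ℝ, E) 3 F) {g : G}
    (hg : g ∈ (extChartAt 𝓘(ℝ, E) (1 : G)).source)
    (h1 : F (g, 1) ∈ (extChartAt 𝓘(ℝ, E) (1 : G)).source) (Y : E) :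
    (mfderiv 𝓘(ℝ, E) 𝓘(ℝ, E) (fun x => extChartAt 𝓘(ℝ, E) (1 : G) (F (g, x))) 1 : E →L[ℝ] E) Y =
      fderiv ℝ (inChart F) (extChartAt 𝓘(ℝ, E) (1 : G) g, extChartAt 𝓘(ℝ, E) (1 : G) 1) (0, Y) := by
  have : LieGroup 𝓘(ℝ, E) 3 G := inferInstance
  have : IsManifold 𝓘(ℝ, E) 3 G := inferInstance
  have hd : MDifferentiableAt 𝓘(ℝ, E) 𝓘(ℝ, E)
      (fun x => extChartAt 𝓘(ℝ, E) (1 : G) (F (g, x))) 1 := by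
    have a1 : ContMDiffAt 𝓘(ℝ, E) 𝓘(ℝ, E) 3 (extChartAt 𝓘(ℝ, E) (1 : G)) (F (g, 1)) :=
      contMDiffAt_extChartAt' (by simpa using h1)
    have a2 : ContMDiffAt 𝓘(ℝ, E) 𝓘(ℝ, E) 3 (fun x => F (g, x)) 1 :=
      (hF (g, 1)).comp 1 (contMDiffAt_const.prodMk contMDiffAt_id)
    exact (a1.comp 1 a2).mdifferentiableAt (by norm_num)
  rw [hd.mfderiv]
  have hc := (contDiffAt_inChart hF ((extChartAt 𝓘(ℝ, E) (1 : G)).map_source hg)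
    (by rwa [(extChartAt 𝓘(ℝ, E) (1 : G)).left_inv hg])).differentiableAt (by norm_num)
  have := hc.hasFDerivAt.comp (f := fun v : E => (extChartAt 𝓘(ℝ, E) (1 : G) g, v))
    (extChartAt 𝓘(ℝ, E) (1 : G) 1) (hasFDerivAt_prodMk_right _ _)
  have h2 : writtenInExtChartAt 𝓘(ℝ, E) 𝓘(ℝ, E) 1
      (fun x => extChartAt 𝓘(ℝ, E) (1 : G) (F (g, x))) =
      inChart F ∘ (fun v : E => (extChartAt 𝓘(ℝ, E) (1 : G) g, v)) := by
    ext v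
    simp only [writtenInExtChartAt, inChart, Function.comp,
      (extChartAt 𝓘(ℝ, E) (1 : G)).left_inv hg, extChartAt_model_space_eq_id,
      PartialEquiv.refl_coe, id]
  rw [h2]
  simp only [modelWithCornersSelf_coe, Set.range_id, fderivWithin_univ]
  rw [this.fderiv]
  rfl

theorem contMDiff_conj_three :
    ContMDiff (𝓘(ℝ, E).prod 𝓘(ℝ, E)) 𝓘(ℝ, E) 3 (fun p : G × G => p.1 * p.2 * p.1⁻¹) :=
  have : LieGroup 𝓘(ℝ, E) 3 G := inferInstance
  (contMDiff_fst.mul contMDiff_snd).mul contMDiff_fst.inv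

/-- Near the identity, `Ad g Y` is a partial derivative of the conjugation map in the chart at
`1`. -/
theorem Ad_apply_eq_fderiv {g : G} (hg : g ∈ (extChartAt 𝓘(ℝ, E) (1 : G)).source) (Y : E) :
    (Ad g : LieAlg E G →L[ℝ] LieAlg E G) Y =
      fderiv ℝ (inChart fun p : G × G => p.1 * p.2 * p.1⁻¹)
        (extChartAt 𝓘(ℝ, E) (1 : G) g, extChartAt 𝓘(ℝ, E) (1 : G) 1) (0, Y) := by
  rw [← mfderiv_chart_comp contMDiff_conj_three hg (by simp)]
  have hd : MDifferentiableAt 𝓘(ℝ, E) 𝓘(ℝ, E) (fun x : G => g * x * g⁻¹) 1 :=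
    ((contMDiff_conj_three (g, 1)).comp 1
      (contMDiffAt_const.prodMk contMDiffAt_id)).mdifferentiableAt (by norm_num)
  have : LieGroup 𝓘(ℝ, E) 3 G := inferInstance
  have : IsManifold 𝓘(ℝ, E) 3 G := inferInstance
  have hd' : MDifferentiableAt 𝓘(ℝ, E) 𝓘(ℝ, E)
      (fun x => extChartAt 𝓘(ℝ, E) (1 : G) (g * x * g⁻¹)) 1 := by
    have a1 : ContMDiffAt 𝓘(ℝ, E) 𝓘(ℝ, E) 3 (extChartAt 𝓘(ℝ, E) (1 : G)) (g * 1 * g⁻¹) :=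
      contMDiffAt_extChartAt' (by simp)
    exact (a1.comp 1 ((contMDiff_conj_three (g, 1)).comp 1
      (contMDiffAt_const.prodMk contMDiffAt_id))).mdifferentiableAt (by norm_num)
  rw [hd'.mfderiv, Ad, hd.mfderiv]
  congr 2
  ext v
  simp only [writtenInExtChartAt, Function.comp, mul_one, mul_inv_cancel,
    extChartAt_model_space_eq_id, PartialEquiv.refl_coe, id]

/-- The Lie bracket, defined by left invariant vector fields, in terms of the multiplication in the
chart at `1`. -/
theorem bracket_eq_fderiv [CompleteSpace E] (X Y : LieAlg E G) :
    ⁅X, Y⁆ =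
      (fderiv ℝ (fun u => fderiv ℝ (inChart fun p : G × G => p.1 * p.2)
        (u, extChartAt 𝓘(ℝ, E) (1 : G) 1) (0, Y)) (extChartAt 𝓘(ℝ, E) (1 : G) 1) X -
      fderiv ℝ (fun u => fderiv ℝ (inChart fun p : G × G => p.1 * p.2)
        (u, extChartAt 𝓘(ℝ, E) (1 : G) 1) (0, X)) (extChartAt 𝓘(ℝ, E) (1 : G) 1) Y : E) := by
  have : LieGroup 𝓘(ℝ, E) 3 G := inferInstance
  have : IsManifold 𝓘(ℝ, E) 3 G := inferInstance
  have hI : IsManifold 𝓘(ℝ, E) 1 G := .of_le (n := 3) (by norm_num)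
  set φ := extChartAt 𝓘(ℝ, E) (1 : G) with hφ
  have hmul : ContMDiff (𝓘(ℝ, E).prod 𝓘(ℝ, E)) 𝓘(ℝ, E) 3 (fun p : G × G => p.1 * p.2) :=
    contMDiff_mul 𝓘(ℝ, E) 3
  -- a left invariant vector field, read in the chart, is a partial derivative of the multiplication
  have hfield : ∀ (Z : E), ∀ u ∈ φ.target,
      (VectorField.mpullbackWithin 𝓘(ℝ, E) 𝓘(ℝ, E) φ.symm
        (mulInvariantVectorField (I := 𝓘(ℝ, E)) (G := G) Z) (Set.range 𝓘(ℝ, E)) u : E) =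
      fderiv ℝ (inChart fun p : G × G => p.1 * p.2) (u, φ 1) (0, Z) := by
    intro Z u hu
    have hg : φ.symm u ∈ φ.source := φ.map_target hu
    have h2 := mfderiv_chart_comp (E := E) hmul (g := φ.symm u) hg (by rw [mul_one]; exact hg) Z
    rw [← hφ, φ.right_inv hu] at h2
    rw [← h2]
    have hd1 : MDifferentiableAt 𝓘(ℝ, E) 𝓘(ℝ, E) (fun x : G => φ.symm u * x) 1 :=
      ((hmul (φ.symm u, 1)).comp 1
        (contMDiffAt_const.prodMk contMDiffAt_id)).mdifferentiableAt (by norm_num)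
    have hd2 : MDifferentiableAt 𝓘(ℝ, E) 𝓘(ℝ, E) φ (φ.symm u * 1) := by
      rw [mul_one]
      exact (contMDiffAt_extChartAt' (n := 3) (x := (1 : G)) (by
        rw [← extChartAt_source 𝓘(ℝ, E)]; exact hg)).mdifferentiableAt (by norm_num)
    have h3 : mfderiv 𝓘(ℝ, E) 𝓘(ℝ, E) (fun x : G => φ (φ.symm u * x)) 1 = _ :=
      mfderiv_comp (I' := 𝓘(ℝ, E)) 1 hd2 hd1
    rw [h3]
    simp only [VectorField.mpullbackWithin_apply, mulInvariantVectorField]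
    have hinv : (mfderiv[Set.range 𝓘(ℝ, E)] φ.symm u).inverse =
        mfderiv 𝓘(ℝ, E) 𝓘(ℝ, E) φ (φ.symm u) :=
      ContinuousLinearMap.inverse_eq
        (mfderivWithin_extChartAt_symm_comp_mfderiv_extChartAt hu)
        (mfderiv_extChartAt_comp_mfderivWithin_extChartAt_symm hu)
    rw [hinv]
    exact congrArg (fun g' : G => (mfderiv 𝓘(ℝ, E) 𝓘(ℝ, E) φ g' : E →L[ℝ] E)
      ((mfderiv 𝓘(ℝ, E) 𝓘(ℝ, E) (fun x : G => φ.symm u * x) 1 : E →L[ℝ] E) Z)) (mul_one _).symm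
  have he : φ.target ∈ 𝓝 (φ 1) := extChartAt_target_mem_nhds (1 : G)
  have hid : ∀ Z : E, fderiv ℝ (inChart fun p : G × G => p.1 * p.2) (φ 1, φ 1) (0, Z) = Z := by
    intro Z
    have h := mfderiv_chart_comp (E := E) hmul (g := 1) (mem_extChartAt_source (1 : G))
      (by simp) Z
    rw [← h]
    have h1 : (fun x : G => φ (1 * x)) = φ := by ext; rw [one_mul]
    refine (congrArg (fun f : G → E => (mfderiv 𝓘(ℝ, E) 𝓘(ℝ, E) f 1 : E →L[ℝ] E) Z) h1).trans ?_
    exact DFunLike.congr_fun (mfderiv_extChartAt_self (I := 𝓘(ℝ, E)) (x := (1 : G))) Z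
  rw [GroupLieAlgebra.bracket_def, ← VectorField.mlieBracketWithin_univ,
    VectorField.mlieBracketWithin_apply]
  have hA : (mfderiv 𝓘(ℝ, E) 𝓘(ℝ, E) φ 1 : E →L[ℝ] E) = ContinuousLinearMap.id ℝ E :=
    mfderiv_extChartAt_self (I := 𝓘(ℝ, E)) (x := (1 : G))
  have hB : ∀ w : E, (ContinuousLinearMap.inverse (M := E) (M₂ := E)
      (mfderiv 𝓘(ℝ, E) 𝓘(ℝ, E) φ 1 : E →L[ℝ] E) : E →L[ℝ] E) w = w := fun w => by
    have h : (ContinuousLinearMap.id ℝ E).inverse = ContinuousLinearMap.id ℝ E := by simp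
    exact ((congrArg ContinuousLinearMap.inverse hA).trans h) ▸ rfl
  refine (hB _).trans ?_
  have hset : φ.symm ⁻¹' Set.univ ∩ Set.range 𝓘(ℝ, E) = Set.univ := by simp
  rw [← hφ, hset]
  have h1 : ∀ Z : E, (VectorField.mpullbackWithin 𝓘(ℝ, E) 𝓘(ℝ, E) φ.symm
        (mulInvariantVectorField (I := 𝓘(ℝ, E)) (G := G) Z) (Set.range 𝓘(ℝ, E)) : E → E) =ᶠ[𝓝 (φ 1)]
      fun u => fderiv ℝ (inChart fun p : G × G => p.1 * p.2) (u, φ 1) (0, Z) := fun Z =>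
    Filter.eventuallyEq_of_mem he (hfield Z)
  have h2 := Filter.EventuallyEq.lieBracket_vectorField_eq (𝕜 := ℝ) (h1 X) (h1 Y)
  refine (congrFun VectorField.lieBracketWithin_univ _).trans (h2.trans ?_)
  exact congrArg₂ (fun a b : E => a - b) (congrArg _ (hid X)) (congrArg _ (hid Y))

/-- The adjoint action along a curve through `1` has the bracket as its derivative. -/
theorem hasDerivAt_Ad [CompleteSpace E] {γ : ℝ → G} (h0 : γ 0 = 1) {X : LieAlg E G}
    (hγ : HasMFDerivAt 𝓘(ℝ, ℝ) 𝓘(ℝ, E) γ 0 (ContinuousLinearMap.toSpanSingleton ℝ (X : E)))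
    (Y : LieAlg E G) :
    HasDerivAt (fun t => ((Ad (γ t) : LieAlg E G →L[ℝ] LieAlg E G) Y : E))
      (⁅X, Y⁆ : LieAlg E G) 0 := by
  have : LieGroup 𝓘(ℝ, E) 3 G := inferInstance
  have : IsManifold 𝓘(ℝ, E) 3 G := inferInstance
  set φ := extChartAt 𝓘(ℝ, E) (1 : G) with hφ
  have h11 : φ.symm (φ 1) = 1 := extChartAt_to_inv (1 : G)
  have h1t : φ 1 ∈ φ.target := mem_extChartAt_target (1 : G)
  have he : φ.target ∈ 𝓝 (φ 1) := extChartAt_target_mem_nhds (1 : G)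
  have hmul : ContMDiff (𝓘(ℝ, E).prod 𝓘(ℝ, E)) 𝓘(ℝ, E) 3 (fun p : G × G => p.1 * p.2) :=
    contMDiff_mul 𝓘(ℝ, E) 3
  have hcsymm : ContinuousAt φ.symm (φ 1) := continuousAt_extChartAt_symm (1 : G)
  obtain ⟨hd, hD⟩ := fderiv_fderiv_of_conj (e := φ 1)
    (m := inChart fun p : G × G => p.1 * p.2)
    (f := inChart fun p : G × G => p.1 * p.2 * p.1⁻¹)
    (contDiffAt_inChart hmul h1t (by rw [← hφ, h11]; simp [hφ]))
    (contDiffAt_inChart contMDiff_conj_three h1t (by rw [← hφ, h11]; simp [hφ]))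
    (Filter.Eventually.of_forall fun u => by
      simp only [inChart, ← hφ, h11, mul_one, mul_inv_cancel])
    (Filter.mem_of_superset he fun v hv => by
      simp only [Set.mem_ofPred, inChart, ← hφ, h11, one_mul, inv_one, mul_one, φ.right_inv hv])
    (Filter.mem_of_superset he fun v hv => by
      simp only [Set.mem_ofPred, inChart, ← hφ, h11, mul_one, φ.right_inv hv])
    (by
      have hc : ContinuousAt (fun p : E × E => φ.symm p.1 * φ.symm p.2 * (φ.symm p.1)⁻¹)
          (φ 1, φ 1) := by
        have : IsTopologicalGroup G := topologicalGroup_of_lieGroup 𝓘(ℝ, E) 3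
        have c1 : ContinuousAt (fun p : E × E => φ.symm p.1) (φ 1, φ 1) :=
          ContinuousAt.comp (g := φ.symm) hcsymm continuousAt_fst
        have c2 : ContinuousAt (fun p : E × E => φ.symm p.2) (φ 1, φ 1) :=
          ContinuousAt.comp (g := φ.symm) hcsymm continuousAt_snd
        exact (c1.mul c2).mul c1.inv
      have hs : φ.source ∈ 𝓝 (φ.symm (φ 1) * φ.symm (φ 1) * (φ.symm (φ 1))⁻¹) := by
        rw [h11]; simpa [hφ] using extChartAt_source_mem_nhds (I := 𝓘(ℝ, E)) (1 : G)
      filter_upwards [hc hs] with p hp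
      simp only [inChart, ← hφ]
      rw [φ.left_inv hp]
      simp)
    (X : E) (Y : E)
  have hγc : ContinuousAt γ 0 := hγ.continuousAt
  have hφγ : HasDerivAt (fun t => φ (γ t)) (X : E) 0 := by
    have h2 := hγ.2
    simp only [mfld_simps, chartAt_self_eq] at h2
    rw [h0] at h2
    exact HasFDerivWithinAt.hasFDerivAt (F := E) h2 Filter.univ_mem
  have hev : (fun t => ((Ad (γ t) : LieAlg E G →L[ℝ] LieAlg E G) Y : E)) =ᶠ[𝓝 0] fun t =>
      fderiv ℝ (inChart fun p : G × G => p.1 * p.2 * p.1⁻¹) (φ (γ t), φ 1) (0, Y) := by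
    have hs : φ.source ∈ 𝓝 (γ 0) := by
      rw [h0]; exact extChartAt_source_mem_nhds (I := 𝓘(ℝ, E)) (1 : G)
    filter_upwards [hγc hs] with t ht
    exact Ad_apply_eq_fderiv ht Y
  rw [show (⁅X, Y⁆ : LieAlg E G) = (fderiv ℝ (fderiv ℝ (inChart fun p : G × G =>
    p.1 * p.2 * p.1⁻¹)) (φ 1, φ 1) ((X : E), 0) (0, (Y : E)) : E) from
      (bracket_eq_fderiv X Y).trans hD.symm]
  have aux : ∀ x : E, HasDerivAt (fun t => φ (γ t)) x 0 →
      HasDerivAt (fun t => fderiv ℝ (inChart fun p : G × G => p.1 * p.2 * p.1⁻¹)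
        (φ (γ t), φ 1) (0, (Y : E)))
        (fderiv ℝ (fderiv ℝ (inChart fun p : G × G => p.1 * p.2 * p.1⁻¹)) (φ 1, φ 1)
          (x, 0) (0, (Y : E))) 0 := fun x hx => by
    simpa [Function.comp_def] using HasFDerivAt.comp_hasDerivAt_of_eq (0 : ℝ) hd hx (by rw [h0])
  exact (aux X hφγ).congr_of_eventuallyEq hev

theorem Ad_mul (g h : G) (Y : LieAlg E G) :
    (Ad (g * h) : LieAlg E G →L[ℝ] LieAlg E G) Y =
      Ad g ((Ad h : LieAlg E G →L[ℝ] LieAlg E G) Y) := by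
  have hd : ∀ g x : G, MDifferentiableAt 𝓘(ℝ, E) 𝓘(ℝ, E) (fun x : G => g * x * g⁻¹) x :=
    fun g x => ((contMDiff_conj_three (g, x)).comp x
      (contMDiffAt_const.prodMk contMDiffAt_id)).mdifferentiableAt (by norm_num)
  have h1 : (fun x : G => g * h * x * (g * h)⁻¹) =
      (fun x => g * x * g⁻¹) ∘ fun x => h * x * h⁻¹ := by
    ext x; simp [mul_assoc]
  have h2 := mfderiv_comp (I' := 𝓘(ℝ, E)) (1 : G) (hd g (h * 1 * h⁻¹)) (hd h 1)
  have h3 : h * 1 * h⁻¹ = 1 := by simp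
  refine (congrArg (fun f : G → G => (mfderiv 𝓘(ℝ, E) 𝓘(ℝ, E) f 1 : E →L[ℝ] E) Y) h1).trans ?_
  refine (DFunLike.congr_fun h2 Y).trans ?_
  exact congrArg (fun x : G => (mfderiv 𝓘(ℝ, E) 𝓘(ℝ, E) (fun x : G => g * x * g⁻¹) x : E →L[ℝ] E)
    ((mfderiv 𝓘(ℝ, E) 𝓘(ℝ, E) (fun x : G => h * x * h⁻¹) 1 : E →L[ℝ] E) Y)) h3

theorem Ad_inv_apply_Ad (g : G) (Y : LieAlg E G) :
    (Ad g⁻¹ : LieAlg E G →L[ℝ] LieAlg E G) (Ad g Y) = Y := by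
  rw [← Ad_mul]; simp

theorem Ad_apply_Ad_inv (g : G) (Y : LieAlg E G) :
    (Ad g : LieAlg E G →L[ℝ] LieAlg E G) (Ad g⁻¹ Y) = Y := by
  rw [← Ad_mul]; simp

theorem continuous_Ad_apply (Y : LieAlg E G) :
    Continuous fun g : G => ((Ad g : LieAlg E G →L[ℝ] LieAlg E G) Y : E) := by
  have : LieGroup 𝓘(ℝ, E) 3 G := inferInstance
  have : IsTopologicalGroup G := topologicalGroup_of_lieGroup 𝓘(ℝ, E) 3
  have h1 : ContinuousAt (fun g : G => ((Ad g : LieAlg E G →L[ℝ] LieAlg E G) Y : E)) 1 := by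
    have hc := contDiffAt_inChart (E := E) contMDiff_conj_three
      (mem_extChartAt_target (I := 𝓘(ℝ, E)) (1 : G)) (by rw [extChartAt_to_inv]; simp)
    have hd : ContinuousAt (fderiv ℝ (inChart (E := E) fun p : G × G => p.1 * p.2 * p.1⁻¹))
        (extChartAt 𝓘(ℝ, E) (1 : G) 1, extChartAt 𝓘(ℝ, E) (1 : G) 1) :=
      (hc.fderiv_right (m := 0) (by norm_num)).continuousAt
    have h2 : ContinuousAt (fun g : G => (extChartAt 𝓘(ℝ, E) (1 : G) g,
        extChartAt 𝓘(ℝ, E) (1 : G) 1)) 1 :=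
      (continuousAt_extChartAt (1 : G)).prodMk continuousAt_const
    have h3 := (ContinuousAt.comp (g := fderiv ℝ (inChart (E := E)
      fun p : G × G => p.1 * p.2 * p.1⁻¹)) (x := (1 : G)) hd h2).clm_apply
        (continuousAt_const (y := ((0 : E), (Y : E))))
    refine h3.congr ?_
    filter_upwards [extChartAt_source_mem_nhds (I := 𝓘(ℝ, E)) (1 : G)] with g hg
    exact (Ad_apply_eq_fderiv hg Y).symm
  rw [continuous_iff_continuousAt]
  intro g₀
  have h2 : ContinuousAt (fun g : G => g₀⁻¹ * g) g₀ := by fun_prop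
  have h3 := ((Ad g₀ : E →L[ℝ] E).continuous.continuousAt).comp
    (h1.comp_of_eq h2 (by simp))
  refine h3.congr (Filter.Eventually.of_forall fun g => ?_)
  refine (Ad_mul g₀ (g₀⁻¹ * g) Y).symm.trans ?_
  simp

/-- A vector whose orbit under a one-parameter group of operators has initial velocity a multiple
of itself is an eigenvector of all these operators. -/
theorem apply_eq_exp_smul_of_hasDerivAt {E : Type*} [NormedAddCommGroup E] [NormedSpace ℝ E]
    {A : ℝ → E →L[ℝ] E} (hA : ∀ s t Z, A (s + t) Z = A s (A t Z)) (h0 : ∀ Z, A 0 Z = Z)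
    {Y : E} {c : ℝ} (hY : HasDerivAt (fun t => A t Y) (c • Y) 0) (t : ℝ) :
    A t Y = Real.exp (c * t) • Y := by
  have hd : ∀ t, HasDerivAt (fun t => A t Y) (c • A t Y) t := by
    intro t
    have h1 : HasDerivAt (fun s => A t (A s Y)) (c • A t Y) 0 := by
      simpa [Function.comp_def] using ((A t).hasFDerivAt).comp_hasDerivAt (0 : ℝ) hY
    have h2 := HasDerivAt.comp_sub_const (x := t) (a := t) (by simpa using h1)
    refine h2.congr_of_eventuallyEq (Filter.Eventually.of_forall fun s => ?_)
    simp [← hA]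
  have hd2 : ∀ t, HasDerivAt (fun t => Real.exp (-(c * t)) • A t Y) 0 t := by
    intro t
    have h1 : HasDerivAt (fun t => Real.exp (-(c * t))) (Real.exp (-(c * t)) * -(c * 1)) t :=
      (((hasDerivAt_id t).const_mul c).neg).exp
    refine (h1.smul (hd t)).congr_deriv ?_
    module
  have hconst := is_const_of_deriv_eq_zero (fun t => (hd2 t).differentiableAt)
    (fun t => (hd2 t).deriv) t 0
  simp only [h0, mul_zero, neg_zero, Real.exp_zero, one_smul] at hconst
  nth_rw 2 [← hconst]
  rw [smul_smul, ← Real.exp_add]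
  simp

/-- An eigenvector of `ad X` is an eigenvector of `Ad (exp (t X))`. -/
theorem IsOneParam.Ad_apply [CompleteSpace E] {γ : ℝ → G} {X Y : LieAlg E G} (h : IsOneParam γ X)
    {c : ℝ} (hY : ⁅X, Y⁆ = c • Y) (t : ℝ) :
    (Ad (γ t) : LieAlg E G →L[ℝ] LieAlg E G) Y = Real.exp (c * t) • Y := by
  refine apply_eq_exp_smul_of_hasDerivAt (E := E)
    (A := fun t => (Ad (γ t) : LieAlg E G →L[ℝ] LieAlg E G))
    (fun s t Z => ?_) (fun Z => ?_) ?_ t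
  · exact (congrArg (fun g : G => (Ad g : LieAlg E G →L[ℝ] LieAlg E G) Z) (h.1 s t)).trans
      (Ad_mul (γ s) (γ t) Z)
  · exact (congrArg (fun g : G => (Ad g : LieAlg E G →L[ℝ] LieAlg E G) Z) h.map_zero).trans
      (by rw [Ad_one]; rfl)
  · have h0 := hasDerivAt_Ad h.map_zero h.2 Y
    rw [hY] at h0
    exact h0

/-- If `Ad l` fixes `H`, it commutes with `ad H`. -/
theorem Ad_lie_of_fixed [CompleteSpace E] {l : G} {γ : ℝ → G} {H : LieAlg E G}
    (hγ : IsOneParam γ H) (hl : (Ad l : LieAlg E G →L[ℝ] LieAlg E G) H = H) (Y : LieAlg E G) :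
    (Ad l : LieAlg E G →L[ℝ] LieAlg E G) ⁅H, Y⁆ = ⁅H, Ad l Y⁆ := by
  -- compare the derivatives of `Ad (l γ(t) l⁻¹) (Ad l Y) = Ad l (Ad (γ(t)) Y)` at `t = 0`
  have h1 := hasDerivAt_Ad hγ.map_zero hγ.2 Y
  have h2 : HasDerivAt (F := E) (fun t => (Ad l : LieAlg E G →L[ℝ] LieAlg E G) (Ad (γ t) Y))
      ((Ad l : LieAlg E G →L[ℝ] LieAlg E G) ⁅H, Y⁆) 0 :=
    HasFDerivAt.comp_hasDerivAt (E := E) (F := E) (0 : ℝ) ((Ad l : E →L[ℝ] E).hasFDerivAt) h1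
  have h3 : HasMFDerivAt 𝓘(ℝ, ℝ) 𝓘(ℝ, E) (fun t => l * γ t * l⁻¹) 0
      (ContinuousLinearMap.toSpanSingleton ℝ (H : E)) := by
    have hd : HasMFDerivAt 𝓘(ℝ, E) 𝓘(ℝ, E) (fun x : G => l * x * l⁻¹) (γ 0) (Ad l : E →L[ℝ] E) := by
      rw [hγ.map_zero]
      exact (((contMDiff_conj_three (l, 1)).comp 1
        (contMDiffAt_const.prodMk contMDiffAt_id)).mdifferentiableAt (by norm_num)).hasMFDerivAt
    have h4 := hd.comp (0 : ℝ) hγ.2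
    have h5 : (Ad l : E →L[ℝ] E) ∘L ContinuousLinearMap.toSpanSingleton ℝ (H : E) =
        ContinuousLinearMap.toSpanSingleton ℝ (H : E) := by
      ext
      simpa using hl
    exact (show _ from h5) ▸ h4
  have h6 := hasDerivAt_Ad (γ := fun t => l * γ t * l⁻¹) (by simp [hγ.map_zero]) h3
    ((Ad l : LieAlg E G →L[ℝ] LieAlg E G) Y)
  refine HasDerivAt.unique (F := E) h2 (HasDerivAt.congr_of_eventuallyEq (F := E) h6
    (Filter.Eventually.of_forall fun t => ?_))
  refine Eq.symm ?_
  have := Ad_mul (l * γ t) l⁻¹ ((Ad l : LieAlg E G →L[ℝ] LieAlg E G) Y)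
  rw [Ad_inv_apply_Ad] at this
  exact this.trans (Ad_mul l (γ t) Y)

theorem mfderiv_mul_left_mulInvariantVectorField (X : LieAlg E G) (g h : G) :
    (mfderiv 𝓘(ℝ, E) 𝓘(ℝ, E) (fun x : G => g * x) h : E →L[ℝ] E)
      (mulInvariantVectorField (I := 𝓘(ℝ, E)) X h) =
      mulInvariantVectorField (I := 𝓘(ℝ, E)) X (g * h) := by
  have : LieGroup 𝓘(ℝ, E) 3 G := inferInstance
  have hd : ∀ g x : G, MDifferentiableAt 𝓘(ℝ, E) 𝓘(ℝ, E) (fun x : G => g * x) x := fun g x =>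
    (contMDiff_mul_left (I := 𝓘(ℝ, E)) (n := 3)).contMDiffAt.mdifferentiableAt (by norm_num)
  have h1 : (fun x : G => g * h * x) = (fun x => g * x) ∘ fun x => h * x := by
    ext x; simp [mul_assoc]
  have h2 := mfderiv_comp (I' := 𝓘(ℝ, E)) (1 : G) (hd g (h * 1)) (hd h 1)
  refine Eq.symm ?_
  refine (congrArg (fun f : G → G => (mfderiv 𝓘(ℝ, E) 𝓘(ℝ, E) f 1 : E →L[ℝ] E) (X : E)) h1).trans ?_
  refine (DFunLike.congr_fun h2 X).trans ?_
  exact congrArg (fun x : G => (mfderiv 𝓘(ℝ, E) 𝓘(ℝ, E) (fun x : G => g * x) x : E →L[ℝ] E)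
    ((mfderiv 𝓘(ℝ, E) 𝓘(ℝ, E) (fun x : G => h * x) 1 : E →L[ℝ] E) (X : E))) (mul_one h)

theorem IsMIntegralCurveOn.const_mul {X : LieAlg E G} {γ : ℝ → G} {s : Set ℝ}
    (hγ : IsMIntegralCurveOn (I := 𝓘(ℝ, E)) γ (mulInvariantVectorField X) s) (g : G) :
    IsMIntegralCurveOn (I := 𝓘(ℝ, E)) (fun t => g * γ t) (mulInvariantVectorField X) s := by
  intro t ht
  have : LieGroup 𝓘(ℝ, E) 3 G := inferInstance
  have hd : HasMFDerivAt 𝓘(ℝ, E) 𝓘(ℝ, E) (fun x : G => g * x) (γ t) _ :=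
    ((contMDiff_mul_left (I := 𝓘(ℝ, E)) (n := 3)).contMDiffAt.mdifferentiableAt
      (by norm_num)).hasMFDerivAt
  have h1 := hd.comp_hasMFDerivWithinAt t (hγ t ht)
  have h2 : (mfderiv 𝓘(ℝ, E) 𝓘(ℝ, E) (fun x : G => g * x) (γ t) : E →L[ℝ] E) ∘L
      ((1 : ℝ →L[ℝ] ℝ).smulRight (mulInvariantVectorField (I := 𝓘(ℝ, E)) X (γ t) : E)) =
      (1 : ℝ →L[ℝ] ℝ).smulRight (mulInvariantVectorField (I := 𝓘(ℝ, E)) X (g * γ t) : E) := by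
    rw [← mfderiv_mul_left_mulInvariantVectorField]
    ext
    simp
  exact h2 ▸ h1

/-- Every element of the Lie algebra generates a one-parameter subgroup: by left translation all
integral curves of a left invariant vector field exist for a uniform time. -/
theorem exists_isOneParam [CompleteSpace E] (X : LieAlg E G) : ∃ γ : ℝ → G, IsOneParam γ X := by
  have : LieGroup 𝓘(ℝ, E) 3 G := inferInstance
  have : IsManifold 𝓘(ℝ, E) 3 G := inferInstance
  have : IsManifold 𝓘(ℝ, E) 1 G := .of_le (n := 3) (by norm_num)
  have : IsTopologicalGroup G := topologicalGroup_of_lieGroup 𝓘(ℝ, E) 3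
  have : T1Space G := ChartedSpace.t1Space E G
  have hv : ContMDiff 𝓘(ℝ, E) 𝓘(ℝ, E).tangent 1 (fun g : G =>
      (mulInvariantVectorField (I := 𝓘(ℝ, E)) X g : TangentBundle 𝓘(ℝ, E) G)) :=
    (contMDiff_mulInvariantVectorField (I := 𝓘(ℝ, E)) X).of_le (by simp)
  obtain ⟨γ₀, h0, hγ₀⟩ := exists_isMIntegralCurveAt_of_contMDiffAt_boundaryless
    (I := 𝓘(ℝ, E)) (x₀ := (1 : G)) 0 hv.contMDiffAt
  obtain ⟨ε, hε, hγ₀⟩ := isMIntegralCurveAt_iff'.1 hγ₀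
  rw [Real.ball_eq_Ioo, zero_sub, zero_add] at hγ₀
  obtain ⟨γ, hγ0, hγ⟩ := exists_isMIntegralCurve_of_isMIntegralCurveOn hv hε
    (fun g => ⟨fun t => g * γ₀ t, by simp [h0], IsMIntegralCurveOn.const_mul hγ₀ g⟩) 1
  refine ⟨γ, fun s t => ?_, ?_⟩
  · have h1 : IsMIntegralCurve (I := 𝓘(ℝ, E)) (γ ∘ (· + s)) (mulInvariantVectorField X) :=
      hγ.comp_add s
    have h2 : IsMIntegralCurve (I := 𝓘(ℝ, E)) (fun t => γ s * γ t) (mulInvariantVectorField X) := by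
      rw [isMIntegralCurve_iff_isMIntegralCurveOn] at hγ ⊢
      exact IsMIntegralCurveOn.const_mul hγ (γ s)
    have h3 := isMIntegralCurve_Ioo_eq_of_contMDiff_boundaryless (t₀ := 0) hv h1 h2 (by simp [hγ0])
    have h4 := congrFun h3 t
    simpa [add_comm] using h4
  · have h1 := hγ 0
    have h2 : (mulInvariantVectorField (I := 𝓘(ℝ, E)) X (γ 0) : E) = X := by
      rw [hγ0]
      have h3 : (fun x : G => 1 * x) = id := by ext; simp
      have h4 : (mfderiv 𝓘(ℝ, E) 𝓘(ℝ, E) (id : G → G) 1 : E →L[ℝ] E) = .id ℝ E := mfderiv_id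
      exact (congrArg (fun f : G → G => (mfderiv 𝓘(ℝ, E) 𝓘(ℝ, E) f 1 : E →L[ℝ] E) (X : E)) h3).trans
        (DFunLike.congr_fun h4 X)
    have h3 : (1 : ℝ →L[ℝ] ℝ).smulRight (mulInvariantVectorField (I := 𝓘(ℝ, E)) X (γ 0) : E) =
        ContinuousLinearMap.toSpanSingleton ℝ (X : E) := by
      rw [h2]; exact ContinuousLinearMap.smulRight_one_eq_toSpanSingleton ℝ (X : E)
    exact h3 ▸ h1

end LieGroup

end

section

/-! ### Restricted root spaces, the grading and the adjoint action on `𝔫̄` -/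

/-- A commuting family of endomorphisms of a finite-dimensional real vector space which are
symmetric for a positive definite form is simultaneously diagonalizable. -/
theorem iSup_iInf_eigenspace_eq_top_of_posDef {V ι : Type*} [AddCommGroup V] [Module ℝ V]
    [FiniteDimensional ℝ V] (B : V →ₗ[ℝ] V →ₗ[ℝ] ℝ) (hsymm : ∀ x y, B x y = B y x)
    (hpos : ∀ x, x ≠ 0 → 0 < B x x) (T : ι → Module.End ℝ V)
    (hT : ∀ i x y, B (T i x) y = B x (T i y)) (hcomm : ∀ i j x, T i (T j x) = T j (T i x)) :
    ⨆ χ : ι → ℝ, ⨅ i, End.eigenspace (T i) (χ i) = ⊤ := by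
  let c : InnerProductSpace.Core ℝ V :=
    { inner := fun x y => B x y
      conj_inner_symm := fun x y => by simpa using hsymm y x
      re_inner_nonneg := fun x => by
        by_cases hx : x = 0
        · simp [hx]
        · simpa using (hpos x hx).le
      add_left := fun x y z => by simp
      smul_left := fun x y r => by simp
      definite := fun x hx => by
        by_contra h
        exact (hpos x h).ne' hx }
  let _ : NormedAddCommGroup V := c.toNormedAddCommGroup
  let _ : InnerProductSpace ℝ V := InnerProductSpace.ofCore c.toCore
  refine LinearMap.IsSymmetric.iSup_iInf_eq_top_of_commute (𝕜 := ℝ) (fun i x y => hT i x y)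
    fun i j _ => ?_
  ext x
  exact hcomm i j x

/-- Two families `p ≤ q` of elements of a modular lattice agree, if `q` is independent and `p`
spans. -/
theorem eq_of_le_of_iSupIndep {ι α : Type*} [CompleteLattice α] [IsModularLattice α] {p q : ι → α}
    (hq : iSupIndep q) (hpq : ∀ i, p i ≤ q i) (hp : ⨆ i, p i = ⊤) (i : ι) : p i = q i := by
  refine le_antisymm (hpq i) ?_
  have h1 : p i ⊔ ⨆ (j) (_ : j ≠ i), p j = ⊤ := by
    rw [eq_top_iff, ← hp]
    refine iSup_le fun j => ?_
    by_cases hj : j = i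
    · subst hj; exact le_sup_left
    · exact le_sup_of_le_right (le_iSup₂_of_le j hj le_rfl)
  have h2 : q i ⊓ ⨆ (j) (_ : j ≠ i), p j = ⊥ :=
    (disjoint_iff.1 ((hq i).mono_right (iSup₂_mono fun j _ => hpq j)))
  calc q i = (p i ⊔ ⨆ (j) (_ : j ≠ i), p j) ⊓ q i := by rw [h1, top_inf_eq]
    _ = p i ⊔ (⨆ (j) (_ : j ≠ i), p j) ⊓ q i := sup_inf_assoc_of_le _ (hpq i)
    _ ≤ p i := by rw [inf_comm, h2]; simp

variable {E : Type*} [NormedAddCommGroup E] [NormedSpace ℝ E]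
  {G : Type*} [TopologicalSpace G] [ChartedSpace E G] [Group G]
  [FiniteDimensional ℝ E] [LieGroup 𝓘(ℝ, E) ∞ G]

namespace StandardParabolic

variable (D : StandardParabolic E G)

/-- The Lie algebra is the sum of the restricted root spaces: by the Cartan involution, the
operators `ad H` with `H ∈ 𝔞` are symmetric for the positive definite form `-κ(X, θ Y)`. -/
theorem iSup_rootSpace : ⨆ lam, D.rootSpace lam = ⊤ := by
  have hκ : ∀ X Y, killingForm ℝ (LieAlg E G) (D.θ X) (D.θ Y) = killingForm ℝ (LieAlg E G) X Y :=
    fun X Y => LieAlgebra.killingForm_of_equiv_apply D.θ X Y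
  have hcomm : ∀ X Y, killingForm ℝ (LieAlg E G) X Y = killingForm ℝ (LieAlg E G) Y X :=
    fun X Y => LieModule.traceForm_comm ℝ _ _ X Y
  have h := iSup_iInf_eigenspace_eq_top_of_posDef
    (-((killingForm ℝ (LieAlg E G)).compl₂ D.θ.toLinearEquiv.toLinearMap))
    (fun X Y => by
      have := hκ X (D.θ Y)
      rw [D.involutive] at this
      simpa [hcomm Y] using this.symm)
    (fun X hX => by simpa using D.cartan X hX)
    (fun H : D.𝔞 => LieAlgebra.ad ℝ (LieAlg E G) (H : LieAlg E G))
    (fun H X Y => by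
      have h1 : D.θ ⁅(H : LieAlg E G), Y⁆ = -⁅(H : LieAlg E G), D.θ Y⁆ := by
        rw [LieEquiv.map_lie, D.neg_of_mem _ H.2, neg_lie]
      have h2 := LieModule.traceForm_apply_lie_apply ℝ (LieAlg E G) (LieAlg E G)
        X (H : LieAlg E G) (D.θ Y)
      rw [← lie_skew, map_neg, LinearMap.neg_apply] at h2
      simp only [LinearMap.neg_apply, LinearMap.compl₂_apply, LieAlgebra.ad_apply]
      simp only [LinearEquiv.coe_coe, LieEquiv.coe_toLinearEquiv, h1, map_neg]
      rw [neg_neg]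
      exact h2)
    (fun H H' X => by
      simp only [LieAlgebra.ad_apply]
      rw [leibniz_lie, D.abelian _ H.2 _ H'.2, zero_lie, zero_add])
  rw [eq_top_iff, ← h]
  refine iSup_le fun χ => ?_
  by_cases hχ :
      (⨅ H : D.𝔞, End.eigenspace (LieAlgebra.ad ℝ (LieAlg E G) (H : LieAlg E G)) (χ H)) = ⊥
  · rw [hχ]; exact bot_le
  obtain ⟨X, hX, hX0⟩ := Submodule.exists_mem_ne_zero_of_ne_bot hχ
  simp only [Submodule.mem_iInf, End.mem_eigenspace_iff, LieAlgebra.ad_apply] at hX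
  let lam : Dual ℝ D.𝔞 :=
    { toFun := χ
      map_add' := fun H H' => by
        have := hX (H + H')
        rw [Submodule.coe_add, add_lie, hX, hX, ← add_smul] at this
        exact (smul_left_injective ℝ hX0 this).symm
      map_smul' := fun c H => by
        have := hX (c • H)
        rw [Submodule.coe_smul, smul_lie, hX, smul_smul] at this
        exact (smul_left_injective ℝ hX0 this).symm }
  refine le_iSup_of_le lam fun Y hY H => ?_
  simp only [Submodule.mem_iInf, End.mem_eigenspace_iff, LieAlgebra.ad_apply] at hY
  exact hY H

/-- The grading of the Lie algebra by heights is the eigenspace decomposition of the adjoint action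
of the grading element. -/
theorem gr_eq_eigenspace (j : ℤ) :
    D.gr j =
      End.eigenspace (LieAlgebra.ad ℝ (LieAlg E G) (D.gradingElement : LieAlg E G)) (j : ℝ) := by
  refine eq_of_le_of_iSupIndep
    (p := fun c : ℝ => ⨆ (lam : Dual ℝ D.𝔞) (_ : D.ht lam = c), D.rootSpace lam)
    (End.eigenspaces_iSupIndep (LieAlgebra.ad ℝ (LieAlg E G) (D.gradingElement : LieAlg E G)))
    (fun c => ?_) ?_ (j : ℝ)
  · refine iSup₂_le fun lam hlam X hX => ?_
    rw [End.mem_eigenspace_iff, LieAlgebra.ad_apply, hX, D.apply_gradingElement, hlam]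
  · rw [eq_top_iff, ← D.iSup_rootSpace]
    exact iSup_le fun lam => le_iSup_of_le (D.ht lam) (le_iSup₂_of_le lam rfl le_rfl)

theorem mem_gr_iff {j : ℤ} {X : LieAlg E G} :
    X ∈ D.gr j ↔ ⁅(D.gradingElement : LieAlg E G), X⁆ = (j : ℝ) • X := by
  rw [gr_eq_eigenspace, End.mem_eigenspace_iff, LieAlgebra.ad_apply]

/-- The set of degrees whose supremum is the depth is bounded, because `ad` of the grading element
has finitely many eigenvalues. -/
theorem le_depth {j : ℕ} (hj : D.gr j ≠ ⊥) : j ≤ D.depth := by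
  refine le_csSup (Set.Finite.bddAbove ?_) hj
  refine Set.Finite.subset (Set.Finite.preimage (f := fun j : ℕ => (j : ℝ)) Nat.cast_injective.injOn
    (End.finite_hasEigenvalue
      (LieAlgebra.ad ℝ (LieAlg E G) (D.gradingElement : LieAlg E G)))) fun i hi => ?_
  have : D.gr (i : ℤ) ≠ ⊥ := hi
  rw [gr_eq_eigenspace] at this
  simpa [End.hasEigenvalue_iff] using this

/-- The group `M_P A_P` centralizes `𝔞_P`. -/
theorem Ad_apply_of_mem_MA {l : G} (hl : l ∈ D.MA) {H : D.𝔞} (hH : H ∈ D.𝔞P) :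
    (Ad l : LieAlg E G →L[ℝ] LieAlg E G) H = (H : LieAlg E G) := by
  let S : Subgroup G :=
    { carrier := {g | (Ad g : LieAlg E G →L[ℝ] LieAlg E G) H = (H : LieAlg E G)}
      mul_mem' := fun {g h} hg hh => by
        simp only [Set.mem_ofPred] at hg hh ⊢
        rw [Ad_mul, hh, hg]
      one_mem' := by simp
      inv_mem' := fun {g} hg => by
        simp only [Set.mem_ofPred] at hg ⊢
        nth_rw 1 [← hg]
        exact Ad_inv_apply_Ad g _ }
  have key : ∀ 𝔰 : Set (LieAlg E G), (∀ X ∈ 𝔰, ⁅X, (H : LieAlg E G)⁆ = 0) →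
      analyticSubgroup 𝔰 ≤ S := by
    intro 𝔰 h𝔰
    refine (Subgroup.closure_le S).2 ?_
    rintro g ⟨X, hX, γ, hγ, rfl⟩
    have := hγ.Ad_apply (c := 0) (Y := ((H : D.𝔞) : LieAlg E G)) (by rw [h𝔰 X hX, zero_smul]) 1
    rw [zero_mul, Real.exp_zero, one_smul] at this
    exact this
  have hMA : D.MA ≤ S := by
    refine sup_le (sup_le ((Subgroup.closure_le S).2 fun g hg => hg.2 H hH) (key _ ?_)) (key _ ?_)
    · intro X hX
      rw [← lie_skew, (hX H hH).1, neg_zero]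
    · rintro X ⟨H', hH', rfl⟩
      exact D.abelian _ H'.2 _ H.2
  exact hMA hl

/-- The group `M_P A_P` preserves the grading, because it fixes the grading element. -/
theorem Ad_mem_gr {l : G} (hl : l ∈ D.MA) {j : ℤ} {X : LieAlg E G} (hX : X ∈ D.gr j) :
    (Ad l : LieAlg E G →L[ℝ] LieAlg E G) X ∈ D.gr j := by
  rw [mem_gr_iff] at hX ⊢
  obtain ⟨γ, hγ⟩ := exists_isOneParam (D.gradingElement : LieAlg E G)
  rw [← Ad_lie_of_fixed hγ (D.Ad_apply_of_mem_MA hl D.gradingElement_mem), hX, map_smul]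

theorem exists_adNbar {l : G} (hl : l ∈ D.MA) :
    ∃ T : D.Nbar ≃L[ℝ] D.Nbar, ∀ X j, (T X j : E) = Ad (E := E) l (X j : E) := by
  let T : (j : Fin D.depth) → D.negPart j ≃ₗ[ℝ] D.negPart j := fun j =>
    LinearEquiv.ofLinearMap
      ((Ad l : E →L[ℝ] E).toLinearMap.restrict fun X hX => D.Ad_mem_gr hl hX)
      ((Ad l⁻¹ : E →L[ℝ] E).toLinearMap.restrict fun X hX => D.Ad_mem_gr (inv_mem hl) hX)
      (by ext X; exact Ad_apply_Ad_inv l (X : E))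
      (by ext X; exact Ad_inv_apply_Ad l (X : E))
  exact ⟨ContinuousLinearEquiv.piCongrRight fun j => (T j).toContinuousLinearEquiv,
    fun X j => rfl⟩

theorem adNbar_apply {l : G} (hl : l ∈ D.MA) (X : D.Nbar) (j : Fin D.depth) :
    (D.adNbar l X j : E) = Ad (E := E) l (X j : E) := by
  have h := D.exists_adNbar hl
  rw [adNbar, dif_pos h]
  exact h.choose_spec X j

theorem adNbar_mul {l l' : G} (hl : l ∈ D.MA) (hl' : l' ∈ D.MA) (X : D.Nbar) :
    D.adNbar (l * l') X = D.adNbar l (D.adNbar l' X) := by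
  ext j
  rw [adNbar_apply D (mul_mem hl hl'), adNbar_apply D hl, adNbar_apply D hl']
  exact Ad_mul l l' _

theorem adNbar_one (X : D.Nbar) : D.adNbar 1 X = X := by
  ext j
  rw [adNbar_apply D (one_mem _)]
  exact DFunLike.congr_fun Ad_one (X j : E)

theorem adNbar_dilation {l : G} (hl : l ∈ D.MA) (r : ℝˣ) (X : D.Nbar) :
    D.adNbar l (D.dilation r X) = D.dilation r (D.adNbar l X) := by
  ext j
  rw [adNbar_apply D hl, dilation_apply, dilation_apply, Submodule.coe_smul, Submodule.coe_smul,
    adNbar_apply D hl]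
  exact map_smul (Ad l : E →L[ℝ] E) _ _

theorem repr_simple_ht (lam : Dual ℝ D.𝔞) : D.ht lam = ∑ i ∈ D.Leviᶜ, D.simple.repr lam i := by
  simp [ht, LinearMap.sum_apply]

/-- The fundamental coweight: the element of `𝔞` dual to the simple root of index `i`. -/
def coweight (i : Fin (finrank ℝ D.𝔞)) : D.𝔞 := (evalEquiv ℝ D.𝔞).symm (D.simple.coord i)

theorem apply_coweight (lam : Dual ℝ D.𝔞) (i : Fin (finrank ℝ D.𝔞)) :
    lam (D.coweight i) = D.simple.repr lam i :=
  LinearMap.congr_fun ((evalEquiv ℝ D.𝔞).apply_symm_apply (D.simple.coord i)) lam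

theorem coweight_mem {i : Fin (finrank ℝ D.𝔞)} (hi : i ∉ D.Levi) : D.coweight i ∈ D.𝔞P := by
  simp only [𝔞P, Submodule.mem_iInf, LinearMap.mem_ker, apply_coweight]
  intro j hj
  have : j ≠ i := fun h => hi (h ▸ hj)
  simp [this]

/-- The rank of `A_P` is at most the number of simple roots outside the Levi factor. This is an
equality, of which only this half is needed. -/
theorem rank_le : D.rank ≤ D.Leviᶜ.card := by
  let f : D.𝔞P →ₗ[ℝ] (↥(D.Leviᶜ) → ℝ) := LinearMap.pi fun i => D.simple i ∘ₗ D.𝔞P.subtype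
  have hf : Function.Injective f := by
    rw [← LinearMap.ker_eq_bot, LinearMap.ker_eq_bot']
    intro H hH
    have h1 : ∀ i, D.simple i (H : D.𝔞) = 0 := by
      intro i
      by_cases hi : i ∈ D.Levi
      · have := H.2
        simp only [𝔞P, Submodule.mem_iInf, LinearMap.mem_ker] at this
        exact this i hi
      · exact congrFun hH ⟨i, Finset.mem_compl.2 hi⟩
    have h2 : evalEquiv ℝ D.𝔞 (H : D.𝔞) = 0 := D.simple.ext fun i => by simpa using h1 i
    exact Subtype.ext ((evalEquiv ℝ D.𝔞).map_eq_zero_iff.1 h2)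
  have := LinearMap.finrank_le_finrank_of_injective hf
  rw [finrank_fintype_fun_eq_card, Fintype.card_coe] at this
  exact this

theorem exists_mem_rootSpace_simple (i : Fin (finrank ℝ D.𝔞)) :
    ∃ X ∈ D.rootSpace (D.simple i), X ≠ 0 := by
  obtain ⟨X, h0, hX⟩ := D.simple_isRoot i
  exact ⟨X, hX, h0⟩

theorem exists_mem_rootSpace_neg_simple (i : Fin (finrank ℝ D.𝔞)) :
    ∃ X ∈ D.rootSpace (-D.simple i), X ≠ 0 := by
  obtain ⟨X, h0, hX⟩ := D.simple_isRoot i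
  refine ⟨D.θ X, fun H => ?_, by simpa using h0⟩
  have h1 : D.θ ⁅(H : LieAlg E G), X⁆ = -⁅(H : LieAlg E G), D.θ X⁆ := by
    rw [LieEquiv.map_lie, D.neg_of_mem _ H.2, neg_lie]
  rw [hX, map_smul] at h1
  rw [LinearMap.neg_apply, neg_smul, h1, neg_neg]

theorem ht_simple {i : Fin (finrank ℝ D.𝔞)} (hi : i ∉ D.Levi) : D.ht (D.simple i) = 1 := by
  rw [repr_simple_ht]
  simp [Finsupp.single_apply, hi]

theorem rootSpace_le_gr {lam : Dual ℝ D.𝔞} {j : ℤ} (h : D.ht lam = j) : D.rootSpace lam ≤ D.gr j :=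
  le_iSup₂_of_le lam h le_rfl

theorem gr_one_ne_bot {i : Fin (finrank ℝ D.𝔞)} (hi : i ∉ D.Levi) : D.gr 1 ≠ ⊥ := by
  obtain ⟨X, hX, h0⟩ := D.exists_mem_rootSpace_simple i
  intro h
  exact h0 ((Submodule.mem_bot ℝ).1 (h ▸ D.rootSpace_le_gr (by simp [ht_simple D hi]) hX))

theorem one_le_depth {i : Fin (finrank ℝ D.𝔞)} (hi : i ∉ D.Levi) : 1 ≤ D.depth :=
  D.le_depth (j := 1) (by exact_mod_cast D.gr_one_ne_bot hi)

end StandardParabolic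

end

section

/-! ### Quasicharacters and the action of `A_P` -/

theorem ofReal_exp_cpow (t : ℝ) (z : ℂ) : ((Real.exp t : ℝ) : ℂ) ^ z = Complex.exp (t * z) := by
  rw [Complex.cpow_def_of_ne_zero (by exact_mod_cast (Real.exp_pos t).ne'), ← Complex.ofReal_log
    (Real.exp_pos t).le, Real.log_exp]

theorem ofReal_inv_cpow {r : ℝ} (hr : 0 < r) (z : ℂ) : ((r⁻¹ : ℝ) : ℂ) ^ z = ((r : ℂ) ^ z)⁻¹ := by
  rw [Complex.ofReal_inv, Complex.inv_cpow _ _ (by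
    rw [Complex.arg_ofReal_of_nonneg hr.le]; exact Real.pi_pos.ne)]

variable {E : Type*} [NormedAddCommGroup E] [NormedSpace ℝ E]
  {G : Type*} [TopologicalSpace G] [ChartedSpace E G] [Group G]
  [FiniteDimensional ℝ E] [LieGroup 𝓘(ℝ, E) ∞ G]

namespace StandardParabolic

variable (D : StandardParabolic E G)

theorem mem_MA_of_mem_A {a : G} (ha : a ∈ D.A) : a ∈ D.MA := (le_sup_right : D.A ≤ D.MA) ha

theorem Ad_apply_of_mem_rootSpace {γ : ℝ → G} {H : D.𝔞} (hγ : IsOneParam γ (H : LieAlg E G))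
    {lam : Dual ℝ D.𝔞} {X : LieAlg E G} (hX : X ∈ D.rootSpace lam) (t : ℝ) :
    (Ad (γ t) : LieAlg E G →L[ℝ] LieAlg E G) X = Real.exp (lam H * t) • X :=
  hγ.Ad_apply (hX H) t

theorem exists_notMem_Levi (h : D.rank = 1) : ∃ i, i ∉ D.Levi := by
  have h1 := D.rank_le
  have h2 : 0 < D.Leviᶜ.card := by omega
  obtain ⟨i, hi⟩ := Finset.card_pos.1 h2
  exact ⟨i, Finset.mem_compl.1 hi⟩

theorem simple_gradingElement {i : Fin (finrank ℝ D.𝔞)} (hi : i ∉ D.Levi) :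
    D.simple i D.gradingElement = 1 := by
  rw [apply_gradingElement, ht_simple D hi]

/-- In rank one, `𝔞_P` is the line through the grading element. -/
theorem eq_smul_gradingElement (h : D.rank = 1) {i : Fin (finrank ℝ D.𝔞)} (hi : i ∉ D.Levi)
    {H : D.𝔞} (hH : H ∈ D.𝔞P) : H = D.simple i H • D.gradingElement := by
  have h0 : (⟨D.gradingElement, D.gradingElement_mem⟩ : D.𝔞P) ≠ 0 := by
    intro h0
    have h1 := D.simple_gradingElement hi
    rw [show D.gradingElement = 0 from congrArg Subtype.val h0, map_zero] at h1
    exact zero_ne_one h1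
  obtain ⟨c, hc⟩ := (finrank_eq_one_iff_of_nonzero' _ h0).1 h ⟨H, hH⟩
  have hc' : c • D.gradingElement = H := congrArg Subtype.val hc
  rw [← hc', map_smul, simple_gradingElement D hi]
  simp

/-- When `A_P` has rank one, each of its elements acts on `𝔫̄` through a dilation, and the factor
of this dilation determines the values of all quasicharacters. -/
theorem exists_dilation_of_mem_A (h : D.rank = 1) {a : G} (ha : a ∈ D.A) :
    ∃ r : ℝ, 0 < r ∧ (∀ (j : ℤ), ∀ X ∈ D.gr j,
      (Ad a : LieAlg E G →L[ℝ] LieAlg E G) X = r ^ j • X) ∧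
      ∀ (χ : D.A →* ℂˣ) (z : ℂ), D.HasHeight χ z →
        ∀ ha : a ∈ D.A, (χ ⟨a, ha⟩ : ℂ) = (r : ℂ) ^ z := by
  obtain ⟨i, hi⟩ := D.exists_notMem_Levi h
  unfold A analyticSubgroup at ha
  induction ha using Subgroup.closure_induction with
  | mem a hg =>
    obtain ⟨X, ⟨H, hH, rfl⟩, γ, hγ, rfl⟩ := hg
    have hH' := D.eq_smul_gradingElement h hi hH
    set t := D.simple i H
    refine ⟨Real.exp t, Real.exp_pos _, fun j X hX => ?_, ?_⟩
    · rw [hγ.Ad_apply (c := t * j) (Y := X), mul_one, ← Real.rpow_intCast, Real.exp_mul]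
      rw [hH', Submodule.coe_smul, smul_lie, (D.mem_gr_iff).1 hX, smul_smul]
    · rintro χ z ⟨-, φ, hφ, rfl⟩ ha
      rw [hφ ⟨H, hH⟩ ⟨_, ha⟩ ⟨γ, hγ, rfl⟩]
      have h1 : (⟨H, hH⟩ : D.𝔞P) = t • ⟨D.gradingElement, D.gradingElement_mem⟩ :=
        Subtype.ext hH'
      rw [h1, map_smul, ofReal_exp_cpow]
      rfl
  | one => exact ⟨1, one_pos, fun j X _ => by simp, fun χ z _ h1 => by
      rw [show (⟨1, h1⟩ : D.A) = 1 from rfl]; simp⟩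
  | mul a b ha hb iha ihb =>
    obtain ⟨r, hr, h1, h2⟩ := iha
    obtain ⟨s, hs, h3, h4⟩ := ihb
    refine ⟨r * s, mul_pos hr hs, fun j X hX => ?_, fun χ z hχ hab => ?_⟩
    · rw [Ad_mul, h3 j X hX, map_smul, h1 j X hX, smul_smul, mul_zpow, mul_comm]
    · rw [show (⟨a * b, hab⟩ : D.A) = ⟨a, ha⟩ * ⟨b, hb⟩ from rfl, map_mul, Units.val_mul,
        h2 χ z hχ ha, h4 χ z hχ hb, Complex.ofReal_mul, Complex.mul_cpow_ofReal_nonneg hr.le hs.le]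
  | inv a ha iha =>
    obtain ⟨r, hr, h1, h2⟩ := iha
    refine ⟨r⁻¹, inv_pos.2 hr, fun j X hX => ?_, fun χ z hχ hab => ?_⟩
    · have h3 := Ad_inv_apply_Ad a X
      rw [h1 j X hX, map_smul] at h3
      nth_rw 2 [← h3]
      rw [smul_smul, inv_zpow, inv_mul_cancel₀ (zpow_ne_zero _ hr.ne'), one_smul]
    · rw [show (⟨a⁻¹, hab⟩ : D.A) = ⟨a, ha⟩⁻¹ from rfl, map_inv, Units.val_inv_eq_inv_val,
        h2 χ z hχ ha, ofReal_inv_cpow hr]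

/-- In rank one, `A_P` acts on `𝔫̄` by dilations. The exponent is inverted, since `Ad` scales
`𝔤_{-j}` by the power `-j`. -/
theorem exists_adNbar_eq_dilation (h : D.rank = 1) (a : D.A) :
    ∃ r : ℝˣ, 0 < (r : ℝ) ∧ (∀ X, D.adNbar (a : G) X = D.dilation r X) ∧
      ∀ (χ : D.A →* ℂˣ) (z : ℂ), D.HasHeight χ z → (χ a : ℂ) = (((r : ℝ) : ℂ) ^ z)⁻¹ := by
  obtain ⟨s, hs, h1, h2⟩ := D.exists_dilation_of_mem_A h a.2
  refine ⟨Units.mk0 s⁻¹ (inv_pos.2 hs).ne', inv_pos.2 hs, fun X => ?_, fun χ z hχ => ?_⟩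
  · ext j
    rw [adNbar_apply D (D.mem_MA_of_mem_A a.2), dilation_apply]
    refine (h1 _ ((X j : E) : LieAlg E G) (X j).2).trans ?_
    rw [zpow_neg, Units.val_mk0, inv_pow]
    norm_cast
  · rw [h2 χ z hχ a.2, Units.val_mk0, ofReal_inv_cpow hs, inv_inv]

/-- In rank one, the quasicharacters of `A_P` are the complex powers of the positive character by
which `A_P` acts on `𝔤₁`. -/
theorem existsUnique_hasHeight (h : D.rank = 1) (z : ℂ) : ∃! χ : D.A →* ℂˣ, D.HasHeight χ z := by
  obtain ⟨i, hi⟩ := D.exists_notMem_Levi h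
  obtain ⟨X, hX, hX0⟩ := Submodule.exists_mem_ne_zero_of_ne_bot (D.gr_one_ne_bot hi)
  obtain ⟨f, hf⟩ := Projective.exists_dual_eq_one ℝ (V := E) (x := (X : E)) hX0
  -- the eigenvalue of `Ad a` on the line through `X` is a positive real character of `A_P`
  let τ : D.A → ℝ := fun a => f (Ad (E := E) (a : G) (X : E))
  have hτ : ∀ a : D.A, 0 < τ a ∧ Ad (E := E) (a : G) (X : E) = τ a • (X : E) := by
    intro a
    obtain ⟨r, hr, h1, -⟩ := D.exists_dilation_of_mem_A h a.2
    have h2 : Ad (E := E) (a : G) (X : E) = r • (X : E) := by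
      have := h1 1 X hX
      rw [zpow_one] at this
      exact this
    have h3 : τ a = r := by
      change f (Ad (E := E) (a : G) (X : E)) = r
      rw [h2]
      exact (f.map_smul r (X : E)).trans (by rw [hf, smul_eq_mul, mul_one])
    rw [h3]
    exact ⟨hr, h2⟩
  have hτc : Continuous τ :=
    (LinearMap.continuous_of_finiteDimensional f).comp
      ((continuous_Ad_apply (X : LieAlg E G)).comp continuous_subtype_val)
  have hinj : ∀ {r s : ℝ}, r • (X : E) = s • (X : E) → r = s := fun hrs =>
    smul_left_injective ℝ (M := E) hX0 hrs
  have hmul : ∀ a b, τ (a * b) = τ a * τ b := fun a b => hinj <| by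
    have h1 := (hτ (a * b)).2
    rw [← h1, Subgroup.coe_mul]
    refine (Ad_mul (a : G) (b : G) X).trans ?_
    refine (congrArg (Ad (E := E) (a : G)) (hτ b).2).trans ?_
    refine (map_smul (Ad (E := E) (a : G)) (τ b) X).trans ?_
    rw [mul_comm, mul_smul]
    exact congrArg (τ b • ·) (hτ a).2
  have hone : τ 1 = 1 := hinj <| by
    rw [← (hτ 1).2, Subgroup.coe_one, Ad_one, one_smul]; rfl
  let χ₀ : D.A →* ℂ :=
    { toFun := fun a => (τ a : ℂ) ^ z
      map_one' := by simp [hone]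
      map_mul' := fun a b => by
        rw [hmul, Complex.ofReal_mul, Complex.mul_cpow_ofReal_nonneg (hτ a).1.le (hτ b).1.le] }
  refine ⟨χ₀.toHomUnits, ⟨?_, ?_⟩, fun χ hχ => ?_⟩
  · refine Units.isEmbedding_val₀.continuous_iff.2 ?_
    change Continuous fun a => (τ a : ℂ) ^ z
    refine continuous_iff_continuousAt.2 fun a => ?_
    exact (Complex.continuous_ofReal.comp hτc).continuousAt.cpow continuousAt_const
      (Or.inl (by simpa using (hτ a).1))
  · refine ⟨(LinearMap.toSpanSingleton ℝ ℂ z) ∘ₗ D.simple i ∘ₗ D.𝔞P.subtype, ?_, ?_⟩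
    · rintro H a ⟨γ, hγ, ha⟩
      have h1 : τ a = Real.exp (D.simple i H) := hinj <| by
        rw [← (hτ a).2, ha]
        refine (hγ.Ad_apply (c := D.simple i H) (Y := X) ?_ 1).trans (by rw [mul_one])
        rw [D.eq_smul_gradingElement h hi H.2, Submodule.coe_smul, smul_lie, D.mem_gr_iff.1 hX,
          map_smul, simple_gradingElement D hi]
        simp
      change (τ a : ℂ) ^ z = _
      rw [h1, ofReal_exp_cpow]
      simp
    · simp [simple_gradingElement D hi]
  · obtain ⟨-, φ, hφ⟩ := id hχ
    ext a
    change (χ a : ℂ) = (τ a : ℂ) ^ z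
    obtain ⟨r, hr, h1, h2⟩ := D.exists_dilation_of_mem_A h a.2
    rw [h2 χ z hχ a.2]
    congr 2
    refine hinj ?_
    rw [← (hτ a).2]
    have := h1 1 X hX
    rw [zpow_one] at this
    exact this.symm

theorem dilation_single (r : ℝˣ) (j : Fin D.depth) (X : D.negPart j) :
    D.dilation r (Pi.single j X) =
      (r : ℝ) ^ ((j : ℕ) + 1) • (Pi.single j X : D.Nbar) := by
  ext i
  rw [dilation_apply, Pi.smul_apply]
  by_cases hi : i = j
  · subst hi; rfl
  · rw [Pi.single_eq_of_ne hi, smul_zero, smul_zero]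

/-- If a one-parameter group in `A_P` is generated by `H`, its action on the root space `𝔤_λ`
in `𝔫̄` is the character `exp λ(H)`. -/
theorem adNbar_single {γ : ℝ → G} {H : D.𝔞} (hH : H ∈ D.𝔞P)
    (hγ : IsOneParam γ (H : LieAlg E G)) {lam : Dual ℝ D.𝔞} {j : Fin D.depth}
    (X : D.negPart j) (hX : (X : E) ∈ (D.rootSpace lam : Set (LieAlg E G))) :
    D.adNbar (γ 1) (Pi.single j X) =
      Real.exp (lam H) • Pi.single (M := fun j => D.negPart j) j X := by
  ext i
  have hm : γ 1 ∈ D.MA :=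
    D.mem_MA_of_mem_A (Subgroup.subset_closure ⟨(H : LieAlg E G), ⟨H, hH, rfl⟩, γ, hγ, rfl⟩)
  rw [adNbar_apply D hm, Pi.smul_apply]
  by_cases hi : i = j
  · subst hi
    rw [Pi.single_eq_same, Submodule.coe_smul]
    refine (D.Ad_apply_of_mem_rootSpace hγ hX 1).trans ?_
    rw [mul_one]
    rfl
  · rw [Pi.single_eq_of_ne hi, smul_zero]
    exact map_zero (Ad (E := E) (γ 1))

/-- If the rank of `A_P` exceeds one, the grading element is the sum of a fundamental coweight and
of another element of `𝔞_P`. These generate two elements `a₁`, `a₂` of `A_P` which act on `𝔫̄` in a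
common eigenbasis with eigenvalues `exp (-p s)`, `exp (-q s)`, where `p` and `q` are natural numbers
because a root is a combination of the simple roots with coefficients of a single sign. No direction
is fixed by both of them, and each of them fixes a direction. -/
theorem exists_coweight_pair (h : 1 < D.rank) : ∃ (a₁ a₂ : D.A) (n : ℕ)
    (b : Basis (Fin n) ℝ D.Nbar) (p q : Fin n → ℕ),
    (∀ s, D.adNbar (a₁ : G) (b s) = Real.exp (-p s) • b s) ∧
    (∀ s, D.adNbar (a₂ : G) (b s) = Real.exp (-q s) • b s) ∧
    (∀ s (r : ℝˣ), D.dilation r (b s) = (r : ℝ) ^ (p s + q s) • b s) ∧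
    (∀ s, 1 ≤ p s + q s) ∧ (∃ s, 0 < p s ∧ q s = 0) ∧ ∃ s, p s = 0 ∧ 0 < q s := by
  classical
  obtain ⟨i₁, hi₁, i₂, hi₂, hne⟩ := Finset.one_lt_card.1 (h.trans_le D.rank_le)
  rw [Finset.mem_compl] at hi₁ hi₂
  let H₁ := D.coweight i₁
  let H₂ := D.gradingElement - D.coweight i₁
  have hH₁ : H₁ ∈ D.𝔞P := D.coweight_mem hi₁
  have hH₂ : H₂ ∈ D.𝔞P := sub_mem D.gradingElement_mem hH₁
  obtain ⟨γ₁, hγ₁⟩ := exists_isOneParam (H₁ : LieAlg E G)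
  obtain ⟨γ₂, hγ₂⟩ := exists_isOneParam (H₂ : LieAlg E G)
  -- root vectors are joint eigenvectors of the required type, and they span `𝔫̄`
  let S : Set D.Nbar := {X | ∃ p q : ℕ, D.adNbar (γ₁ 1) X = Real.exp (-p) • X ∧
    D.adNbar (γ₂ 1) X = Real.exp (-q) • X ∧ (∀ r : ℝˣ, D.dilation r X = (r : ℝ) ^ (p + q) • X) ∧
    1 ≤ p + q}
  have hS : ∀ (j : Fin D.depth) (lam : Dual ℝ D.𝔞) (hlam : D.ht lam = (-((j : ℤ) + 1) : ℤ))
      (X : D.negPart j) (hX : (X : E) ∈ (D.rootSpace lam : Set (LieAlg E G))),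
      Pi.single (M := fun j => D.negPart j) j X ∈ S := by
    intro j lam hlam X hX
    by_cases hX0 : X = 0
    · subst hX0
      exact ⟨1, 0, by simp, by simp, by simp, le_rfl⟩
    have hroot := D.root_nonneg_or_nonpos lam
      ⟨((X : E) : LieAlg E G), fun h0 => hX0 (Subtype.ext h0), hX⟩
    have hht := D.repr_simple_ht lam
    rw [hlam] at hht
    have hneg : ∀ i, ∃ n : ℕ, D.simple.repr lam i = -n := by
      refine hroot.resolve_left fun hpos => ?_
      have : 0 ≤ ∑ i ∈ D.Leviᶜ, D.simple.repr lam i := Finset.sum_nonneg fun i _ => by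
        obtain ⟨n, hn⟩ := hpos i
        rw [hn]; positivity
      rw [← hht] at this
      push_cast at this
      linarith [(Nat.cast_nonneg (j : ℕ) : (0 : ℝ) ≤ ((j : ℕ) : ℝ))]
    choose n hn using hneg
    have hsum : n i₁ + ∑ i ∈ D.Leviᶜ.erase i₁, n i = (j : ℕ) + 1 := by
      rw [Finset.add_sum_erase _ _ (Finset.mem_compl.2 hi₁)]
      simp only [hn, Finset.sum_neg_distrib] at hht
      push_cast at hht
      have h2 := neg_injective hht
      exact_mod_cast h2.symm
    have h1 : lam H₁ = -(n i₁ : ℝ) := by rw [apply_coweight, hn]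
    have h2 : lam H₂ = -((∑ i ∈ D.Leviᶜ.erase i₁, n i : ℕ) : ℝ) := by
      rw [map_sub, apply_gradingElement, h1, hlam]
      have : ((n i₁ + ∑ i ∈ D.Leviᶜ.erase i₁, n i : ℕ) : ℝ) = (j : ℕ) + 1 := by
        rw [hsum]; push_cast; rfl
      push_cast at this ⊢
      linarith
    refine ⟨n i₁, ∑ i ∈ D.Leviᶜ.erase i₁, n i, ?_, ?_, ?_, by omega⟩
    · rw [← h1]; exact D.adNbar_single hH₁ hγ₁ X hX
    · rw [← h2]; exact D.adNbar_single hH₂ hγ₂ X hX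
    · rw [hsum]; exact fun r => D.dilation_single r j X
  have hspan : ⊤ ≤ Submodule.span ℝ S := by
    have hj : ∀ (j : Fin D.depth) (X : D.negPart j),
        Pi.single (M := fun j => D.negPart j) j X ∈ Submodule.span ℝ S := by
      intro j X
      let U : Submodule ℝ E := ((Submodule.span ℝ S).comap
        (LinearMap.single ℝ (fun j => D.negPart j) j)).map (D.negPart j).subtype
      have hU : D.negPart j ≤ U := by
        refine iSup₂_le fun lam hlam Y hY => ?_
        have hY' : (Y : E) ∈ D.negPart j := D.rootSpace_le_gr hlam hY
        exact ⟨⟨Y, hY'⟩, Submodule.subset_span (hS j lam hlam ⟨Y, hY'⟩ hY), rfl⟩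
      obtain ⟨Y, hY, hYX⟩ := hU X.2
      rw [← (Subtype.ext hYX : Y = X)]
      exact hY
    intro X _
    rw [← Finset.univ_sum_single X]
    exact Submodule.sum_mem _ fun j _ => hj j _
  let b₀ := Basis.ofSpan hspan
  have : Fintype _ := FiniteDimensional.fintypeBasisIndex b₀
  let b := b₀.reindex (Fintype.equivFin _)
  have hb : ∀ s, b s ∈ S := fun s => by
    rw [Basis.reindex_apply]
    exact Basis.ofSpan_subset hspan ⟨_, rfl⟩
  choose p q h1 h2 h3 h4 using hb
  -- a root vector of a simple root outside the Levi factor has a nonzero coordinate along some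
  -- basis vector, which is then a joint eigenvector of the same type
  have hex : ∀ i, i ∉ D.Levi → ∀ P Q : ℝ, -D.simple i H₁ = P → -D.simple i H₂ = Q →
      ∃ s, -(p s : ℝ) = P ∧ -(q s : ℝ) = Q := by
    intro i hi P Q hP hQ
    obtain ⟨X, hX, hX0⟩ := D.exists_mem_rootSpace_neg_simple i
    have hht : D.ht (-D.simple i) = (-1 : ℤ) := by rw [map_neg, ht_simple D hi]; simp
    let j : Fin D.depth := ⟨0, D.one_le_depth hi⟩
    have hXj : (X : E) ∈ D.negPart j := D.rootSpace_le_gr (by simpa [j] using hht) hX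
    let v : D.Nbar := Pi.single j ⟨X, hXj⟩
    have hv1 : D.adNbar (γ₁ 1) v = Real.exp P • v := by
      rw [← hP]; exact D.adNbar_single hH₁ hγ₁ ⟨X, hXj⟩ hX
    have hv2 : D.adNbar (γ₂ 1) v = Real.exp Q • v := by
      rw [← hQ]; exact D.adNbar_single hH₂ hγ₂ ⟨X, hXj⟩ hX
    have hv0 : v ≠ 0 := by
      intro h0
      have := congrFun h0 j
      rw [show v j = ⟨X, hXj⟩ from Pi.single_eq_same j _] at this
      exact hX0 (congrArg Subtype.val this)
    obtain ⟨s, hs⟩ : ∃ s, b.repr v s ≠ 0 := by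
      by_contra! hc
      exact hv0 (b.repr.map_eq_zero_iff.1 (Finsupp.ext hc))
    have key : ∀ (T : D.Nbar ≃L[ℝ] D.Nbar) (c : Fin _ → ℝ) (d : ℝ), (∀ s, T (b s) = c s • b s) →
        T v = d • v → c s = d := by
      intro T c d hT hd
      have e1 : b.repr (T v) s = c s * b.repr v s := by
        have e2 : b.coord s ∘ₗ T.toLinearEquiv.toLinearMap = c s • b.coord s := b.ext fun s' => by
          by_cases hss : s' = s
          · subst hss; simp [hT]
          · simp [hT, hss]
        exact LinearMap.congr_fun e2 v
      rw [hd] at e1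
      simpa [hs] using e1.symm
    exact ⟨s, Real.exp_injective (key _ (fun s => Real.exp (-p s)) _ h1 hv1),
      Real.exp_injective (key _ (fun s => Real.exp (-q s)) _ h2 hv2)⟩
  refine ⟨⟨γ₁ 1, Subgroup.subset_closure ⟨_, ⟨H₁, hH₁, rfl⟩, γ₁, hγ₁, rfl⟩⟩,
    ⟨γ₂ 1, Subgroup.subset_closure ⟨_, ⟨H₂, hH₂, rfl⟩, γ₂, hγ₂, rfl⟩⟩, _, b, p, q, h1, h2, h3, h4,
    ?_, ?_⟩
  · obtain ⟨s, hs, hs'⟩ := hex i₁ hi₁ (-1) 0 (by simp [H₁, apply_coweight])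
      (by simp [H₂, apply_coweight, simple_gradingElement D hi₁])
    have : p s = 1 := by exact_mod_cast neg_injective hs
    exact ⟨s, by omega, by simpa using hs'⟩
  · obtain ⟨s, hs, hs'⟩ := hex i₂ hi₂ 0 (-1) (by simp [H₁, apply_coweight, hne.symm])
      (by simp [H₂, apply_coweight, simple_gradingElement D hi₂, hne.symm])
    have : q s = 1 := by exact_mod_cast neg_injective hs'
    exact ⟨s, by simpa using hs, by omega⟩

end StandardParabolic

end

section

/-! ### Polynomiality of covariant functions -/

/-- The algebra of polynomial functions `N → ℂ`, generated by the real linear functions. -/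
def polyAlg (N : Type*) [AddCommGroup N] [Module ℝ N] : Subalgebra ℂ (N → ℂ) :=
  Algebra.adjoin ℂ {p : N → ℂ | ∃ φ : N →ₗ[ℝ] ℂ, p = fun X => φ X}

/-- The space of polynomial functions with values in `W`, spanned by the products of scalar
polynomials and constant vectors. -/
def polySpan (N W : Type*) [AddCommGroup N] [Module ℝ N] [AddCommGroup W] [Module ℂ W] :
    Submodule ℂ (N → W) :=
  Submodule.span ℂ {F | ∃ p ∈ polyAlg N, ∃ w : W, F = fun X => p X • w}

section Algebraic

variable {N W : Type*} [AddCommGroup N] [Module ℝ N] [AddCommGroup W] [Module ℂ W]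

theorem linear_mem_polyAlg (φ : N →ₗ[ℝ] ℂ) : (fun X => φ X) ∈ polyAlg N :=
  Algebra.subset_adjoin ⟨φ, rfl⟩

theorem const_mem_polySpan (w : W) : (fun _ => w) ∈ polySpan N W :=
  Submodule.subset_span ⟨1, one_mem _, w, by simp⟩

theorem smul_mem_polySpan {p : N → ℂ} (hp : p ∈ polyAlg N) {F : N → W} (hF : F ∈ polySpan N W) :
    (fun X => p X • F X) ∈ polySpan N W := by
  induction hF using Submodule.span_induction with
  | mem F h =>
    obtain ⟨q, hq, w, rfl⟩ := h
    exact Submodule.subset_span ⟨p * q, mul_mem hp hq, w, by ext X; simp [mul_smul]⟩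
  | zero =>
    convert zero_mem (polySpan N W) using 1
    ext X
    simp
  | add F F' _ _ h h' =>
    convert add_mem h h' using 1
    ext X
    simp
  | smul c F _ h =>
    have := Submodule.smul_mem _ c h
    convert this using 1
    ext X
    simp [smul_comm c]

theorem apply_mem_polyAlg (ℓ : W →ₗ[ℂ] ℂ) {F : N → W} (hF : F ∈ polySpan N W) :
    (fun X => ℓ (F X)) ∈ polyAlg N := by
  induction hF using Submodule.span_induction with
  | mem F h =>
    obtain ⟨q, hq, w, rfl⟩ := h
    have := (polyAlg N).smul_mem hq (ℓ w)
    convert this using 1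
    ext X
    simp [mul_comm]
  | zero =>
    convert zero_mem (polyAlg N) using 1
    ext X
    simp
  | add F F' _ _ h h' =>
    convert add_mem h h' using 1
    ext X
    simp
  | smul c F _ h =>
    convert (polyAlg N).smul_mem h c using 1
    ext X
    simp

end Algebraic

/-- If `g` grows by a factor at least `1 / c` along a convergent orbit, it vanishes at its start. -/
theorem eq_zero_of_contraction {N W : Type*} [TopologicalSpace N] [NormedAddCommGroup W]
    {g : N → W} {T : N → N} {X X' : N} {c : ℝ} (hc0 : 0 ≤ c) (hc : c < 1)
    (hg : ∀ k : ℕ, ‖g (T^[k] X)‖ ≤ c * ‖g (T^[k + 1] X)‖)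
    (hT : Filter.Tendsto (fun k => T^[k] X) Filter.atTop (nhds X')) (hX' : ContinuousAt g X') :
    g X = 0 := by
  have h1 : ∀ k, ‖g X‖ ≤ c ^ k * ‖g (T^[k] X)‖ := by
    intro k
    induction k with
    | zero => simp
    | succ k ih =>
      refine ih.trans ?_
      rw [pow_succ, mul_assoc]
      exact mul_le_mul_of_nonneg_left (hg k) (pow_nonneg hc0 k)
  have h2 : Filter.Tendsto (fun k => c ^ k * ‖g (T^[k] X)‖) Filter.atTop (nhds (0 * ‖g X'‖)) :=
    (tendsto_pow_atTop_nhds_zero_of_lt_one hc0 hc).mul (hX'.tendsto.comp hT).norm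
  rw [zero_mul] at h2
  exact norm_le_zero_iff.1 (ge_of_tendsto' h2 h1)

variable {N : Type*} [NormedAddCommGroup N] [NormedSpace ℝ N]
  {W : Type*} [NormedAddCommGroup W] [NormedSpace ℂ W]

theorem contDiff_of_mem_polyAlg [FiniteDimensional ℝ N] {p : N → ℂ} (hp : p ∈ polyAlg N) :
    ContDiff ℝ ∞ p := by
  induction hp using Algebra.adjoin_induction with
  | mem p h =>
    obtain ⟨φ, rfl⟩ := h
    exact (LinearMap.toContinuousLinearMap φ).contDiff
  | algebraMap c => exact contDiff_const
  | add p q _ _ h h' => exact h.add h'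
  | mul p q _ _ h h' => exact h.mul h'

theorem contDiff_of_mem_polySpan [FiniteDimensional ℝ N] {F : N → W} (hF : F ∈ polySpan N W) :
    ContDiff ℝ ∞ F := by
  induction hF using Submodule.span_induction with
  | mem F h =>
    obtain ⟨q, hq, w, rfl⟩ := h
    exact (contDiff_of_mem_polyAlg hq).smul contDiff_const
  | zero => exact contDiff_const
  | add F F' _ _ h h' => exact h.add h'
  | smul c F _ h => exact h.const_smul c

/-- The derivative in the direction `v`, with junk value zero where `f` is not differentiable. -/
def dirDeriv (v : N) (f : N → W) (X : N) : W := fderiv ℝ f X v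

theorem ContDiffOn.dirDeriv {f : N → W} {U : Set N} (hU : IsOpen U) (hf : ContDiffOn ℝ ∞ f U)
    (v : N) : ContDiffOn ℝ ∞ (dirDeriv v f) U :=
  (hf.fderiv_of_isOpen hU (by simp)).clm_apply contDiffOn_const

theorem ContDiffOn.dirDeriv_iterate {f : N → W} {U : Set N} (hU : IsOpen U)
    (hf : ContDiffOn ℝ ∞ f U) (v : N) (k : ℕ) :
    ContDiffOn ℝ ∞ ((FlatParabolic.dirDeriv v)^[k] f) U := by
  induction k with
  | zero => exact hf
  | succ k ih =>
    rw [Function.iterate_succ_apply']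
    exact ih.dirDeriv hU v

/-- If `f ∘ T = M ∘ f + q` and `v` is an eigenvector of `T`, the derivatives of `f` along `v`
satisfy an equation of the same kind. -/
theorem dirDeriv_covariant {f q : N → W} {U : Set N} (hU : IsOpen U) (hf : ContDiffOn ℝ ∞ f U)
    (hq : ContDiff ℝ ∞ q) {T : N →L[ℝ] N} (hT : ∀ X ∈ U, T X ∈ U) {M : W →L[ℂ] W}
    (h : ∀ X ∈ U, f (T X) = M (f X) + q X) {v : N} {a : ℝ} (hv : T v = Real.exp (-a) • v) :
    ∀ X ∈ U, dirDeriv v f (T X) =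
      Real.exp a • M (dirDeriv v f X) + Real.exp a • dirDeriv v q X := by
  intro X hX
  have hd : ∀ Y ∈ U, DifferentiableAt ℝ f Y := fun Y hY =>
    (hf.contDiffAt (hU.mem_nhds hY)).differentiableAt (by simp)
  have h1 : HasFDerivAt (fun Y => f (T Y)) ((fderiv ℝ f (T X)).comp T) X :=
    (hd _ (hT X hX)).hasFDerivAt.comp X T.hasFDerivAt
  have h2 : HasFDerivAt (fun Y => M (f Y) + q Y)
      ((M.restrictScalars ℝ).comp (fderiv ℝ f X) + fderiv ℝ q X) X :=
    ((M.restrictScalars ℝ).hasFDerivAt.comp X (hd X hX).hasFDerivAt).add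
      (hq.differentiable (by simp) X).hasFDerivAt
  have h3 := h1.unique (h2.congr_of_eventuallyEq
    (Filter.eventuallyEq_of_mem (hU.mem_nhds hX) fun Y hY => h Y hY))
  have h4 := DFunLike.congr_fun h3 v
  simp only [ContinuousLinearMap.comp_apply, hv, map_smul, add_apply,
    ContinuousLinearMap.coe_restrictScalars'] at h4
  unfold dirDeriv
  rw [← smul_add, ← h4, smul_smul, ← Real.exp_add]
  simp

theorem dirDeriv_iterate_covariant {f q : N → W} {U : Set N} (hU : IsOpen U)
    (hf : ContDiffOn ℝ ∞ f U) (hq : ContDiff ℝ ∞ q) {T : N →L[ℝ] N} (hT : ∀ X ∈ U, T X ∈ U)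
    {M : W →L[ℂ] W} (h : ∀ X ∈ U, f (T X) = M (f X) + q X) {v : N} {a : ℝ}
    (hv : T v = Real.exp (-a) • v) (k : ℕ) :
    ∀ X ∈ U, (dirDeriv v)^[k] f (T X) =
      Real.exp (k * a) • M ((dirDeriv v)^[k] f X) + Real.exp (k * a) • (dirDeriv v)^[k] q X := by
  induction k with
  | zero => simpa using h
  | succ k ih =>
    have hq' : ContDiff ℝ ∞ ((dirDeriv v)^[k] q) := by
      rw [← contDiffOn_univ] at hq ⊢
      exact hq.dirDeriv_iterate isOpen_univ v k
    have := dirDeriv_covariant hU (hf.dirDeriv_iterate hU v k)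
      (q := Real.exp (k * a) • (dirDeriv v)^[k] q)
      (hq'.const_smul _) hT (M := ((Real.exp (k * a) : ℝ) : ℂ) • M)
      (fun X hX => by
        rw [smul_apply, Complex.coe_smul]
        exact ih X hX) hv
    intro X hX
    rw [Function.iterate_succ_apply', this X hX, Function.iterate_succ_apply']
    have h1 : dirDeriv v (Real.exp (k * a) • (dirDeriv v)^[k] q) X =
        Real.exp (k * a) • dirDeriv v ((dirDeriv v)^[k] q) X := by
      rw [dirDeriv, fderiv_const_smul (hq'.differentiable (by simp) X)]
      rfl
    rw [h1, smul_apply, Complex.coe_smul, smul_smul, smul_smul, ← Real.exp_add,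
      Nat.cast_succ, add_mul, one_mul, add_comm a]

theorem exists_forall_exp_mul_lt_one (C : ℝ) {a : ℝ} (ha : 0 < a) :
    ∃ L₀ : ℕ, ∀ k ≥ L₀, C * Real.exp (-(k * a)) < 1 := by
  have h : Filter.Tendsto (fun k : ℕ => C * Real.exp (-(k * a))) Filter.atTop (nhds (C * 0)) :=
    (Real.tendsto_exp_neg_atTop_nhds_zero.comp
      (tendsto_natCast_atTop_atTop.atTop_mul_const ha)).const_mul C
  rw [mul_zero] at h
  exact Filter.eventually_atTop.1 (h.eventually (gt_mem_nhds one_pos))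

/-- High derivatives in a contracted direction of a solution of `f ∘ T = M ∘ f + q` vanish at the
points whose orbits converge inside `U`, if the high derivatives of `q` vanish: they satisfy an
equation with an arbitrarily small factor. -/
theorem exists_dirDeriv_iterate_eq_zero {f q : N → W} {U : Set N} (hU : IsOpen U)
    (hf : ContDiffOn ℝ ∞ f U) (hq : ContDiff ℝ ∞ q) {T : N →L[ℝ] N} (hT : ∀ X ∈ U, T X ∈ U)
    {M M' : W →L[ℂ] W} (hM : ∀ w, M' (M w) = w) (h : ∀ X ∈ U, f (T X) = M (f X) + q X) {v : N}
    {a : ℝ} (ha : 0 < a) (hv : T v = Real.exp (-a) • v)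
    (hq0 : ∃ L₀, ∀ k ≥ L₀, ∀ X, (dirDeriv v)^[k] q X = 0) :
    ∃ L₀, ∀ k ≥ L₀, ∀ X ∈ U, (∃ X' ∈ U, Filter.Tendsto (fun k => T^[k] X) Filter.atTop (nhds X')) →
      (dirDeriv v)^[k] f X = 0 := by
  obtain ⟨L₁, hL₁⟩ := hq0
  obtain ⟨L₂, hL₂⟩ := exists_forall_exp_mul_lt_one ‖M'‖ ha
  refine ⟨max L₁ L₂, fun k hk X hX => ?_⟩
  rintro ⟨X', hX', hlim⟩
  have hU' : ∀ j, T^[j] X ∈ U := by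
    intro j
    induction j with
    | zero => exact hX
    | succ j ih => rw [Function.iterate_succ_apply']; exact hT _ ih
  refine eq_zero_of_contraction (by positivity) (hL₂ k (le_of_max_le_right hk)) (fun j => ?_) hlim
    (((hf.dirDeriv_iterate hU v k).contDiffAt (hU.mem_nhds hX')).continuousAt)
  rw [Function.iterate_succ_apply', dirDeriv_iterate_covariant hU hf hq hT h hv k _ (hU' j),
    hL₁ k (le_of_max_le_left hk), smul_zero, add_zero, norm_smul, Real.norm_eq_abs, Real.abs_exp,
    mul_assoc, ← mul_assoc (Real.exp _), ← Real.exp_add]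
  simp only [neg_add_cancel, Real.exp_zero, one_mul]
  conv_lhs => rw [← hM ((dirDeriv v)^[k] f (T^[j] X))]
  exact M'.le_opNorm _

/-- A function along a line is a polynomial if one of its iterated derivatives vanishes. -/
theorem eq_sum_of_hasDerivAt (L : ℕ) (g : ℕ → ℝ → W)
    (hg : ∀ k t, HasDerivAt (g k) (g (k + 1) t) t) (hL : ∀ t, g L t = 0) (t : ℝ) :
    g 0 t = ∑ k ∈ Finset.range L, (t ^ k / k.factorial) • g k 0 := by
  induction L generalizing g t with
  | zero => simpa using hL t
  | succ L ih =>
    have h1 := ih (fun k => g (k + 1)) (fun k t => hg (k + 1) t) hL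
    have h2 : ∀ t, HasDerivAt (fun t => g 0 t - ∑ k ∈ Finset.range (L + 1),
        (t ^ k / k.factorial) • g k 0) 0 t := by
      intro t
      have h3 : HasDerivAt (fun t : ℝ => ∑ k ∈ Finset.range (L + 1), (t ^ k / k.factorial) • g k 0)
          (∑ k ∈ Finset.range (L + 1), ((k : ℝ) * t ^ (k - 1) / k.factorial) • g k 0) t := by
        refine HasDerivAt.fun_sum fun k _ => ?_
        exact ((hasDerivAt_pow k t).div_const _).smul_const _
      refine ((hg 0 t).fun_sub h3).congr_deriv ?_
      rw [h1 t, Finset.sum_range_succ', sub_eq_zero]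
      simp only [Nat.cast_zero, zero_mul, zero_div, zero_smul, add_zero]
      refine Finset.sum_congr rfl fun k _ => ?_
      congr 1
      rw [Nat.factorial_succ]
      push_cast
      have := Nat.factorial_ne_zero k
      field_simp
    have h5 := is_const_of_deriv_eq_zero (fun t => (h2 t).differentiableAt)
      (fun t => (h2 t).deriv) t 0
    simp only [Finset.sum_range_succ'] at h5 ⊢
    simp only [pow_zero, Nat.factorial_zero, Nat.cast_one, div_one, one_smul, ne_eq,
      Nat.add_eq_zero_iff, one_ne_zero, and_false, not_false_eq_true, zero_pow, zero_div, zero_smul,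
      Finset.sum_const_zero, zero_add, sub_self] at h5 ⊢
    exact sub_eq_zero.1 h5

theorem apply_add_smul_eq_sum {f : N → W} {U : Set N} (hU : IsOpen U) (hf : ContDiffOn ℝ ∞ f U)
    {v X : N} (hX : ∀ t : ℝ, X + t • v ∈ U) {L : ℕ}
    (hL : ∀ t : ℝ, (dirDeriv v)^[L] f (X + t • v) = 0) (t : ℝ) :
    f (X + t • v) = ∑ k ∈ Finset.range L, (t ^ k / k.factorial) • (dirDeriv v)^[k] f X := by
  have := eq_sum_of_hasDerivAt L (fun k t => (dirDeriv v)^[k] f (X + t • v)) (fun k t => ?_) hL t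
  · simpa using this
  · have h1 : HasFDerivAt ((dirDeriv v)^[k] f) (fderiv ℝ ((dirDeriv v)^[k] f) (X + t • v))
        (X + t • v) := (((hf.dirDeriv_iterate hU v k).contDiffAt
          (hU.mem_nhds (hX t))).differentiableAt (by simp)).hasFDerivAt
    have h2 : HasDerivAt (fun t : ℝ => X + t • v) v t := by
      simpa using ((hasDerivAt_id t).smul_const v).const_add X
    rw [Function.iterate_succ_apply']
    exact h1.comp_hasDerivAt t h2

/-- Smooth functions which are multiplied by a nonzero constant under composition with `S`. -/
def IsQuasiHomogeneous (S : N →L[ℝ] N) (q : N → W) : Prop :=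
  ContDiff ℝ ∞ q ∧ ∃ c : ℂ, c ≠ 0 ∧ ∀ X, q (S X) = c • q X

/-- Functions which satisfy `f ∘ T = M ∘ f + q` away from the origin, for an operator `M` with a
left inverse and for an inhomogeneity `q` which is smooth on the whole space and multiplied by a
constant under `S`. -/
def IsCovariant (S : N →L[ℝ] N) (T : N ≃L[ℝ] N) (f : N → W) : Prop :=
  ∃ (M M' : W →L[ℂ] W) (q : N → W), (∀ w, M' (M w) = w) ∧ IsQuasiHomogeneous S q ∧
    ∀ X ∈ ({0}ᶜ : Set N), f (T X) = M (f X) + q X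

theorem IsQuasiHomogeneous.dirDeriv {S : N →L[ℝ] N} {q : N → W} (hq : IsQuasiHomogeneous S q)
    {v : N} {a : ℝ} (hv : S v = Real.exp (-a) • v) :
    IsQuasiHomogeneous S (FlatParabolic.dirDeriv v q) := by
  obtain ⟨hq, c, hc, h⟩ := hq
  have h1 : ContDiffOn ℝ ∞ q Set.univ := contDiffOn_univ.2 hq
  refine ⟨contDiffOn_univ.1 (h1.dirDeriv isOpen_univ v), (Real.exp a : ℝ) * c,
    mul_ne_zero (by exact_mod_cast (Real.exp_pos a).ne') hc, fun X => ?_⟩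
  have := dirDeriv_covariant isOpen_univ h1 (q := 0) contDiff_const (T := S)
    (fun _ _ => Set.mem_univ _) (M := c • ContinuousLinearMap.id ℂ W) (fun X _ => by simp [h X]) hv
    X (Set.mem_univ _)
  rw [this, mul_smul, Complex.coe_smul]
  simp [FlatParabolic.dirDeriv]

/-- A smooth function which is homogeneous under the contraction `S` is a polynomial along the
contracted directions. -/
theorem IsQuasiHomogeneous.exists_dirDeriv_iterate_eq_zero {S : N →L[ℝ] N} {q : N → W}
    (hq : IsQuasiHomogeneous S q) {v : N} {a : ℝ} (ha : 0 < a) (hv : S v = Real.exp (-a) • v)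
    (hS : ∀ X, ∃ X', Filter.Tendsto (fun k => S^[k] X) Filter.atTop (nhds X')) :
    ∃ L₀, ∀ k ≥ L₀, ∀ X, (FlatParabolic.dirDeriv v)^[k] q X = 0 := by
  obtain ⟨hq, c, hc, h⟩ := hq
  have h0 : ∀ k : ℕ, ∀ X, (FlatParabolic.dirDeriv v)^[k] (0 : N → W) X = 0 := by
    intro k
    have : (FlatParabolic.dirDeriv v)^[k] (0 : N → W) = 0 :=
      Function.iterate_fixed (by ext X; simp [FlatParabolic.dirDeriv]) k
    simp [this]
  obtain ⟨L₀, hL⟩ := FlatParabolic.exists_dirDeriv_iterate_eq_zero isOpen_univ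
    (contDiffOn_univ.2 hq) (q := 0) contDiff_const (T := S)
    (fun _ _ => Set.mem_univ _) (M := c • ContinuousLinearMap.id ℂ W)
    (M' := c⁻¹ • ContinuousLinearMap.id ℂ W) (fun w => by simp [smul_smul, hc])
    (fun X _ => by simp [h X]) ha hv ⟨0, fun k _ => h0 k⟩
  refine ⟨L₀, fun k hk X => hL k hk X (Set.mem_univ _) ?_⟩
  obtain ⟨X', hX'⟩ := hS X
  exact ⟨X', Set.mem_univ _, hX'⟩

theorem IsCovariant.dirDeriv {S : N →L[ℝ] N} {T : N ≃L[ℝ] N} {f : N → W} (h : IsCovariant S T f)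
    (hf : ContDiffOn ℝ ∞ f {0}ᶜ) {v : N} {a c : ℝ} (hv : T v = Real.exp (-a) • v)
    (hv' : S v = Real.exp (-c) • v) : IsCovariant S T (FlatParabolic.dirDeriv v f) := by
  obtain ⟨M, M', q, hM, hq, h⟩ := h
  obtain ⟨hq', c', hc', h'⟩ := hq.dirDeriv hv'
  refine ⟨((Real.exp a : ℝ) : ℂ) • M, ((Real.exp (-a) : ℝ) : ℂ) • M',
    Real.exp a • FlatParabolic.dirDeriv v q, fun w => ?_, ⟨hq'.const_smul _, c', hc', fun X => ?_⟩,
    fun X hX => ?_⟩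
  · rw [smul_apply, smul_apply, Complex.coe_smul, Complex.coe_smul,
      ContinuousLinearMap.map_smul_of_tower, hM, smul_smul, ← Real.exp_add]
    simp
  · simp only [Pi.smul_apply, h']
    rw [smul_comm]
  · exact dirDeriv_covariant isOpen_compl_singleton hf hq.1 (T := (T : N →L[ℝ] N))
      (fun X hX => by simpa using hX) h hv X hX

/-- The orbits of a diagonal map with eigenvalues `exp (-p s)` converge to the projection onto the
fixed vectors. -/
theorem tendsto_iterate_of_basis {n : ℕ} (b : Basis (Fin n) ℝ N) (T : N →L[ℝ] N) (p : Fin n → ℕ)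
    (hT : ∀ s, T (b s) = Real.exp (-p s) • b s) (X : N) :
    Filter.Tendsto (fun k => T^[k] X) Filter.atTop
      (nhds (∑ s, (if p s = 0 then b.repr X s else 0) • b s)) := by
  have h1 : ∀ k, T^[k] X = ∑ s, (Real.exp (-p s) ^ k * b.repr X s) • b s := by
    intro k
    induction k with
    | zero => simp [b.sum_repr]
    | succ k ih =>
      rw [Function.iterate_succ_apply', ih, map_sum]
      refine Finset.sum_congr rfl fun s _ => ?_
      rw [map_smul, hT, smul_smul]
      ring_nf
  simp only [h1]
  refine tendsto_finsetSum _ fun s _ => Filter.Tendsto.smul_const ?_ _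
  split_ifs with h
  · simp [h]
  · rw [← zero_mul (b.repr X s)]
    refine (tendsto_pow_atTop_nhds_zero_of_lt_one (Real.exp_pos _).le ?_).mul_const _
    rw [Real.exp_lt_one_iff, neg_lt_zero]
    exact_mod_cast Nat.pos_of_ne_zero h

/-- A covariant function is a polynomial along the lines in a contracted direction `b s`, off the
hyperplane of those points whose orbits may converge to the origin. -/
theorem IsCovariant.exists_apply_add_smul {n : ℕ} {b : Basis (Fin n) ℝ N} {S : N →L[ℝ] N}
    {T : N ≃L[ℝ] N} {w p : Fin n → ℕ} (hS : ∀ s, S (b s) = Real.exp (-w s) • b s)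
    (hT : ∀ s, T (b s) = Real.exp (-p s) • b s) (hw : ∀ s, 0 < w s) {f : N → W}
    (hf : ContDiffOn ℝ ∞ f {0}ᶜ) (h : IsCovariant S T f) {s s' : Fin n} (hs : 0 < p s)
    (hs' : p s' = 0) :
    ∃ L, ∀ X, b.repr X s' ≠ 0 → ∀ t : ℝ, f (X + t • b s) =
      ∑ k ∈ Finset.range L, (t ^ k / k.factorial) • (FlatParabolic.dirDeriv (b s))^[k] f X := by
  obtain ⟨M, M', q, hM, hq, h⟩ := h
  obtain ⟨L, hL⟩ := exists_dirDeriv_iterate_eq_zero isOpen_compl_singleton hf hq.1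
    (T := (T : N →L[ℝ] N)) (fun X hX => by simpa using hX) hM h (a := p s) (by exact_mod_cast hs)
    (hT s) (hq.exists_dirDeriv_iterate_eq_zero (a := w s) (by exact_mod_cast hw s) (hS s)
      fun X => ⟨_, tendsto_iterate_of_basis b S w hS X⟩)
  have hne : s' ≠ s := fun h => by rw [h] at hs'; omega
  have h0 : ∀ X, b.repr X s' ≠ 0 → X ∈ ({0}ᶜ : Set N) := fun X hX h0 => hX (by
    rw [Set.mem_singleton_iff.1 h0]; simp)
  have hc : ∀ (X : N) (t : ℝ), b.repr (X + t • b s) s' = b.repr X s' := fun X t => by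
    simp [hne.symm]
  refine ⟨L, fun X hX t => apply_add_smul_eq_sum isOpen_compl_singleton hf
    (fun t => h0 _ (by rwa [hc])) (fun t => hL L le_rfl _ (h0 _ (by rwa [hc])) ?_) t⟩
  refine ⟨_, h0 _ ?_, tendsto_iterate_of_basis b (T : N →L[ℝ] N) p hT _⟩
  rw [b.repr_sum_self, if_pos hs', hc]
  exact hX

/-- A function which is smooth away from the origin and covariant under two maps `T₁`, `T₂` which
are diagonal in the basis `b`, is a polynomial if each direction is contracted by one of the two
maps and each map fixes a direction contracted by the other one. Away from the hyperplanes of points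
with zero coordinate along the directions `b s₁`, `b s₂` fixed by `T₂`, `T₁`, it is a polynomial in
each coordinate, with coefficients of the same kind; the points off these hyperplanes are dense. -/
theorem exists_mem_polySpan_of_isCovariant [FiniteDimensional ℝ N] {n : ℕ} (b : Basis (Fin n) ℝ N)
    {S : N →L[ℝ] N} {T₁ T₂ : N ≃L[ℝ] N} {p q : Fin n → ℕ}
    (hS : ∀ s, S (b s) = Real.exp (-(p s + q s : ℕ)) • b s)
    (hT₁ : ∀ s, T₁ (b s) = Real.exp (-p s) • b s) (hT₂ : ∀ s, T₂ (b s) = Real.exp (-q s) • b s)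
    (hw : ∀ s, 1 ≤ p s + q s) (hp : ∃ s, 0 < p s ∧ q s = 0) (hq : ∃ s, p s = 0 ∧ 0 < q s)
    {f : N → W} (hf : ContDiffOn ℝ ∞ f {0}ᶜ) (h₁ : IsCovariant S T₁ f) (h₂ : IsCovariant S T₂ f) :
    ∃ F ∈ polySpan N W, ∀ X, X ≠ 0 → f X = F X := by
  classical
  obtain ⟨s₁, hps₁, hqs₁⟩ := hp
  obtain ⟨s₂, hps₂, hqs₂⟩ := hq
  have hw' : ∀ s, 0 < p s + q s := hw
  -- the point with the coordinates of `X` in the directions of `A`, all others being `1`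
  let Y : Finset (Fin n) → N → N := fun A X => ∑ s, (if s ∈ A then b.repr X s else 1) • b s
  have hY : ∀ A X s, b.repr (Y A X) s = if s ∈ A then b.repr X s else 1 := by
    intro A X s
    simp only [Y, b.repr_sum_self]
  -- adding one coordinate at a time, the Taylor coefficients being handled by the induction
  have claim : ∀ A : Finset (Fin n), ∀ f : N → W, ContDiffOn ℝ ∞ f {0}ᶜ → IsCovariant S T₁ f →
      IsCovariant S T₂ f → ∃ F ∈ polySpan N W, ∀ X, b.repr X s₁ ≠ 0 → b.repr X s₂ ≠ 0 →
        f (Y A X) = F X := by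
    intro A
    induction A using Finset.induction_on with
    | empty => exact fun f _ _ _ => ⟨_, const_mem_polySpan (f (∑ s, (1 : ℝ) • b s)), fun X _ _ => by
        simp [Y]⟩
    | insert s A hs ih =>
      intro f hf h₁ h₂
      have hstep : ∀ X, Y (insert s A) X = Y A X + (b.repr X s - 1) • b s := by
        intro X
        refine b.repr.injective (Finsupp.ext fun i => ?_)
        rw [map_add, Finsupp.add_apply, hY, hY]
        by_cases hi : i = s
        · subst hi; simp [hs]
        · simp [hi]
      obtain ⟨L, hL⟩ : ∃ L, ∀ X, b.repr X s₁ ≠ 0 → b.repr X s₂ ≠ 0 → ∀ t : ℝ, f (X + t • b s) =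
          ∑ k ∈ Finset.range L, (t ^ k / k.factorial) • (dirDeriv (b s))^[k] f X := by
        rcases Nat.eq_zero_or_pos (p s) with hps | hps
        · have hqs : 0 < q s := by have := hw s; omega
          obtain ⟨L, hL⟩ := h₂.exists_apply_add_smul hS hT₂ hw' hf hqs hqs₁
          exact ⟨L, fun X h _ => hL X h⟩
        · obtain ⟨L, hL⟩ := h₁.exists_apply_add_smul hS hT₁ hw' hf hps hps₂
          exact ⟨L, fun X _ h => hL X h⟩
      have hder : ∀ k : ℕ, ContDiffOn ℝ ∞ ((dirDeriv (b s))^[k] f) {0}ᶜ ∧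
          IsCovariant S T₁ ((dirDeriv (b s))^[k] f) ∧
          IsCovariant S T₂ ((dirDeriv (b s))^[k] f) := by
        intro k
        induction k with
        | zero => exact ⟨hf, h₁, h₂⟩
        | succ k ihk =>
          rw [Function.iterate_succ_apply']
          exact ⟨ihk.1.dirDeriv isOpen_compl_singleton _,
            ihk.2.1.dirDeriv ihk.1 (hT₁ s) (hS s), ihk.2.2.dirDeriv ihk.1 (hT₂ s) (hS s)⟩
      choose F hF hFX using fun k => ih _ (hder k).1 (hder k).2.1 (hder k).2.2
      let φ : N →ₗ[ℝ] ℂ := Complex.ofRealCLM.toLinearMap ∘ₗ b.coord s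
      refine ⟨∑ k ∈ Finset.range L,
          fun X => ((((k.factorial : ℂ)⁻¹) • ((fun X => φ X) - 1) ^ k) X) • F k X,
        Submodule.sum_mem _ fun k _ => smul_mem_polySpan ((polyAlg N).smul_mem
          (pow_mem (sub_mem (linear_mem_polyAlg φ) (one_mem _)) k) _) (hF k), fun X h1 h2 => ?_⟩
      rw [hstep, hL (Y A X) (by rw [hY]; split_ifs; exacts [h1, one_ne_zero])
        (by rw [hY]; split_ifs; exacts [h2, one_ne_zero]), Finset.sum_apply]
      refine Finset.sum_congr rfl fun k _ => ?_
      rw [hFX k X h1 h2, ← Complex.coe_smul]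
      congr 1
      simp [φ, div_eq_inv_mul]
  obtain ⟨F, hF, hFX⟩ := claim Finset.univ f hf h₁ h₂
  refine ⟨F, hF, fun X hX => ?_⟩
  -- the points with nonzero coordinates along `b s₁` and `b s₂` are dense
  have hlim : Filter.Tendsto (fun ε : ℝ => X + ε • (b s₁ + b s₂)) (nhdsWithin 0 {0}ᶜ) (nhds X) := by
    have : Continuous fun ε : ℝ => X + ε • (b s₁ + b s₂) := by fun_prop
    simpa using (this.tendsto 0).mono_left nhdsWithin_le_nhds
  have hev : ∀ a : ℝ, ∀ᶠ ε in nhdsWithin (0 : ℝ) {0}ᶜ, a + ε ≠ 0 := by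
    intro a
    by_cases ha : a = 0
    · filter_upwards [self_mem_nhdsWithin] with ε hε
      simpa [ha] using hε
    · refine Filter.Eventually.filter_mono nhdsWithin_le_nhds ?_
      have : Filter.Tendsto (fun ε : ℝ => a + ε) (nhds 0) (nhds (a + 0)) :=
        (continuous_const.add continuous_id).tendsto 0
      rw [add_zero] at this
      exact this.eventually_ne ha
  have hne : s₁ ≠ s₂ := fun h => by rw [h] at hps₁; omega
  refine tendsto_nhds_unique_of_eventuallyEq
    ((hf.contDiffAt (isOpen_compl_singleton.mem_nhds hX)).continuousAt.tendsto.comp hlim)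
    (((contDiff_of_mem_polySpan hF).continuous.tendsto X).comp hlim) ?_
  filter_upwards [hev (b.repr X s₁), hev (b.repr X s₂)] with ε h1 h2
  have hYu : ∀ X, Y Finset.univ X = X := fun X => by simp [Y, b.sum_repr]
  have := hFX (X + ε • (b s₁ + b s₂)) (by simpa [hne, hne.symm] using h1)
    (by simpa [hne, hne.symm] using h2)
  rwa [hYu] at this

end

section

/-! ### Densities of distributions on `𝔫̄` -/

variable {E : Type*} [NormedAddCommGroup E] [NormedSpace ℝ E]
  {G : Type*} [TopologicalSpace G] [ChartedSpace E G] [Group G]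
  [FiniteDimensional ℝ E] [LieGroup 𝓘(ℝ, E) ∞ G]

namespace StandardParabolic

variable {D : StandardParabolic E G} {W : Type*} [NormedAddCommGroup W] [NormedSpace ℂ W]
  {W' : Type*} [NormedAddCommGroup W'] [NormedSpace ℂ W']

/-- The test function given by a smooth function with compact support. -/
def testOf (g : D.Nbar → ℝ) (hg : ContDiff ℝ ∞ g) (hc : HasCompactSupport g) : Test D.Nbar :=
  ⟨g, hg, hc, fun _ _ => trivial⟩

theorem IsDensityOff.mono {S S' : Set D.Nbar} (hS : S ⊆ S') {k : Dist D.Nbar W} {h : D.Nbar → W}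
    (hk : IsDensityOff S k h) : IsDensityOff S' k h :=
  fun f hf => hk f (hf.mono_right hS)

theorem IsDensityOff.add {S : Set D.Nbar} {k k' : Dist D.Nbar W} {h h' : D.Nbar → W}
    (hk : IsDensityOff S k h) (hk' : IsDensityOff S k' h') : IsDensityOff S (k + k') (h + h') := by
  intro f hf
  simp only [Pi.add_apply, smul_add]
  refine ⟨(hk f hf).1.add (hk' f hf).1, ?_⟩
  rw [integral_add (hk f hf).1 (hk' f hf).1, ← (hk f hf).2, ← (hk' f hf).2]
  rfl

theorem IsDensityOff.smul {S : Set D.Nbar} {k : Dist D.Nbar W} {h : D.Nbar → W}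
    (c : ℂ) (hk : IsDensityOff S k h) : IsDensityOff S (c • k) (c • h) := by
  intro f hf
  simp only [Pi.smul_apply, smul_comm _ c]
  refine ⟨(hk f hf).1.smul c, ?_⟩
  rw [integral_smul, ← (hk f hf).2]
  rfl

theorem IsDensityOff.sub {S : Set D.Nbar} {k k' : Dist D.Nbar W} {h h' : D.Nbar → W}
    (hk : IsDensityOff S k h) (hk' : IsDensityOff S k' h') : IsDensityOff S (k - k') (h - h') := by
  have := hk.add (hk'.smul (-1))
  rwa [neg_one_smul, neg_one_smul, ← sub_eq_add_neg, ← sub_eq_add_neg] at this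

theorem IsDensityOff.zero {S : Set D.Nbar} : IsDensityOff S (0 : Dist D.Nbar W) 0 :=
  fun f _ => by simp

theorem IsDensityOff.mapTarget [CompleteSpace W] [CompleteSpace W'] {S : Set D.Nbar}
    {k : Dist D.Nbar W} {h : D.Nbar → W}
    (L : W →L[ℂ] W') (hk : IsDensityOff S k h) :
    IsDensityOff S (FlatParabolic.mapTarget L k) (fun X => L (h X)) := by
  intro f hf
  have h1 : ∀ X, f X • L (h X) = L.restrictScalars ℝ (f X • h X) := fun X => by simp
  simp only [h1]
  refine ⟨(L.restrictScalars ℝ).integrable_comp (hk f hf).1, ?_⟩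
  rw [ContinuousLinearMap.integral_comp_comm _ (hk f hf).1, ← (hk f hf).2]
  rfl

theorem IsDensityOff.tmul [CompleteSpace W] {S : Set D.Nbar} {k : Dist D.Nbar ℂ} {h : D.Nbar → ℂ}
    (w : W) (hk : IsDensityOff S k h) :
    IsDensityOff S (FlatParabolic.tmul k w) (fun X => h X • w) :=
  hk.mapTarget (ContinuousLinearMap.toSpanSingleton ℂ w)

/-- A distribution determines its continuous density off the origin. -/
theorem IsDensityOff.eqOn [CompleteSpace W] {k : Dist D.Nbar W} {h h' : D.Nbar → W}
    (hk : IsDensityOff {0} k h) (hk' : IsDensityOff {0} k h') (hc : ContinuousOn h {0}ᶜ)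
    (hc' : ContinuousOn h' {0}ᶜ) : Set.EqOn h h' {0}ᶜ := by
  have h0 := hk.sub hk'
  rw [sub_self] at h0
  have hcs : ContinuousOn (h - h') {0}ᶜ := hc.sub hc'
  have h1 : ∀ᵐ X ∂(Measure.addHaar : Measure D.Nbar), X ∈ ({0}ᶜ : Set D.Nbar) → (h - h') X = 0 := by
    refine IsOpen.ae_eq_zero_of_integral_contDiff_smul_eq_zero isOpen_compl_singleton
      (hcs.locallyIntegrableOn isOpen_compl_singleton.measurableSet) fun g hg hgc hgs => ?_
    exact ((h0 (testOf g hg hgc) (Set.disjoint_left.2 fun X hX hX' => hgs hX hX')).2).symm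
  have h2 := Measure.eqOn_open_of_ae_eq (μ := (Measure.addHaar : Measure D.Nbar))
    (f := h - h') (g := fun _ => 0)
    ((ae_restrict_iff' isOpen_compl_singleton.measurableSet).2 h1) isOpen_compl_singleton hcs
    continuousOn_const
  exact fun X hX => sub_eq_zero.1 (h2 hX)

theorem IsDensityOff.unique {k k' : Dist D.Nbar W} {h : D.Nbar → W}
    (hk : IsDensityOff ∅ k h) (hk' : IsDensityOff ∅ k' h) : k = k' := by
  ext f
  rw [(hk f (Set.disjoint_empty _)).2, (hk' f (Set.disjoint_empty _)).2]

theorem IsDensityOff.congr {S : Set D.Nbar} {k : Dist D.Nbar W} {h h' : D.Nbar → W}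
    (hk : IsDensityOff S k h) (hh : ∀ X ∉ S, h X = h' X) : IsDensityOff S k h' := by
  intro f hf
  have h1 : (fun X => f X • h' X) = fun X => f X • h X := by
    ext X
    by_cases hX : X ∈ S
    · have : f X = 0 := image_eq_zero_of_notMem_tsupport fun h => (Set.disjoint_left.1 hf h) hX
      simp [this]
    · rw [hh X hX]
  rw [h1]
  exact hk f hf

/-- A continuous function is the density of a distribution. -/
theorem exists_isDensityOff_empty {h : D.Nbar → ℂ} (hh : Continuous h) :
    ∃ k : Dist D.Nbar ℂ, IsDensityOff ∅ k h := by
  have hl : LocallyIntegrableOn h ((⊤ : TopologicalSpace.Opens D.Nbar) : Set D.Nbar)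
      Measure.addHaar := hh.locallyIntegrable.locallyIntegrableOn _
  let k : Test D.Nbar →L[ℝ] ℂ := TestFunction.integralAgainstBilinCLM
    (ContinuousLinearMap.lsmul ℝ ℝ) Measure.addHaar h
  refine ⟨k, fun f _ => ⟨?_, ?_⟩⟩
  · exact (f.continuous.smul hh).integrable_of_hasCompactSupport f.hasCompactSupport.smul_right
  · exact TestFunction.integralAgainstBilinCLM_eq_integral hl

/-- The density of a push-forward, by the change of variables formula. -/
theorem IsDensityOff.pushforward {S S' : Set D.Nbar} {k : Dist D.Nbar W} {h : D.Nbar → W}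
    (hk : IsDensityOff S k h) (T : D.Nbar ≃L[ℝ] D.Nbar) (hS : ∀ X ∈ S, T X ∈ S') :
    IsDensityOff S' (FlatParabolic.pushforward T k)
      (fun X => |(LinearMap.det (T : D.Nbar →ₗ[ℝ] D.Nbar))⁻¹| • h (T.symm X)) := by
  intro f hf
  have hf' : Disjoint (tsupport (pullback T f)) S := by
    refine Set.disjoint_left.2 fun X hX hXS => Set.disjoint_left.1 hf ?_ (hS X hXS)
    exact tsupport_comp_subset_preimage f T.continuous hX
  obtain ⟨h1, h2⟩ := hk _ hf'
  set d := |(LinearMap.det (T : D.Nbar →ₗ[ℝ] D.Nbar))⁻¹| with hd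
  have hdet : LinearMap.det (T : D.Nbar →ₗ[ℝ] D.Nbar) ≠ 0 := T.toLinearEquiv.isUnit_det'.ne_zero
  let e := T.toHomeomorph.toMeasurableEquiv
  have hmap : Measure.map e (Measure.addHaar : Measure D.Nbar) =
      ENNReal.ofReal d • Measure.addHaar :=
    Measure.map_linearMap_addHaar_eq_smul_addHaar (Measure.addHaar : Measure D.Nbar) hdet
  have h3 : (fun X => pullback T f X • h X) = (fun Y => f Y • h (T.symm Y)) ∘ e := by
    ext X
    simp only [pullback_apply, Function.comp]
    have : e X = T X := rfl
    rw [this, T.symm_apply_apply]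
  have hd0 : 0 < d := abs_pos.2 (inv_ne_zero hdet)
  rw [h3] at h1 h2
  have h4 : Integrable (fun Y => f Y • h (T.symm Y)) Measure.addHaar := by
    have := (integrable_map_equiv e (fun Y => f Y • h (T.symm Y))).2 h1
    rw [hmap] at this
    exact (integrable_smul_measure (by simpa using hd0) ENNReal.ofReal_ne_top).1 this
  have h5 : (fun X => f X • d • h (T.symm X)) = fun X => d • f X • h (T.symm X) := by
    ext X; rw [smul_comm]
  simp only [h5]
  refine ⟨h4.smul d, ?_⟩
  have h6 : k (pullback T f) = ∫ X, ((fun Y => f Y • h (T.symm Y)) ∘ e) X ∂Measure.addHaar := h2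
  rw [pushforward_apply, h6, integral_smul]
  have h7 := integral_map_equiv (μ := (Measure.addHaar : Measure D.Nbar)) e
    (fun Y => f Y • h (T.symm Y))
  rw [hmap, integral_smul_measure, ENNReal.toReal_ofReal hd0.le] at h7
  exact h7.symm

variable (D)

/-- A basis of `𝔫̄` adapted to the grading. -/
def nbarBasis : Basis (Σ j : Fin D.depth, Fin (finrank ℝ (D.negPart j))) ℝ D.Nbar :=
  Pi.basis fun j => finBasis ℝ (D.negPart j)

theorem nbarBasis_apply (s : Σ j : Fin D.depth, Fin (finrank ℝ (D.negPart j))) :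
    D.nbarBasis s = Pi.single s.1 (finBasis ℝ (D.negPart s.1) s.2) := by
  rw [nbarBasis, Pi.basis_apply]

/-- The Jacobian of a dilation is governed by the homogeneous dimension. -/
theorem det_dilation (r : ℝˣ) :
    LinearMap.det (D.dilation r : D.Nbar →ₗ[ℝ] D.Nbar) = (r : ℝ) ^ D.hdim := by
  classical
  rw [← LinearMap.det_toMatrix D.nbarBasis]
  have : LinearMap.toMatrix D.nbarBasis D.nbarBasis (D.dilation r : D.Nbar →ₗ[ℝ] D.Nbar) =
      Matrix.diagonal fun s => (r : ℝ) ^ ((s.1 : ℕ) + 1) := by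
    ext s t
    rw [LinearMap.toMatrix_apply]
    have h1 : (D.dilation r : D.Nbar →ₗ[ℝ] D.Nbar) (D.nbarBasis t) =
        (r : ℝ) ^ ((t.1 : ℕ) + 1) • D.nbarBasis t := by
      rw [nbarBasis_apply]; exact D.dilation_single r t.1 _
    rw [h1, map_smul, Basis.repr_self, Finsupp.smul_apply, Finsupp.single_apply,
      Matrix.diagonal_apply]
    by_cases hst : t = s
    · subst hst; simp
    · simp [hst, Ne.symm hst]
  rw [this, Matrix.det_diagonal, Fintype.prod_sigma, hdim, ← Finset.prod_pow_eq_pow_sum]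
  refine Finset.prod_congr rfl fun j _ => ?_
  simp [pow_mul]

theorem dilation_mul (r s : ℝˣ) (X : D.Nbar) :
    D.dilation (r * s) X = D.dilation r (D.dilation s X) := by
  ext j
  simp only [dilation_apply, Units.val_mul, mul_pow, mul_smul]

theorem dilation_one (X : D.Nbar) : D.dilation 1 X = X := by
  ext j
  simp [dilation_apply]

theorem dilation_symm_apply (r : ℝˣ) (X : D.Nbar) :
    (D.dilation r).symm X = D.dilation r⁻¹ X := by
  rw [ContinuousLinearEquiv.symm_apply_eq, ← dilation_mul, mul_inv_cancel, dilation_one]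

variable {D}

theorem mem_polyFun {m : ℂ} {p : D.Nbar → ℂ} : p ∈ D.polyFun m ↔ p ∈ polyAlg D.Nbar ∧
    ∀ r : ℝˣ, 0 < (r : ℝ) → ∀ X, p (D.dilation r X) = ((r : ℝ) : ℂ) ^ (-m - D.hdim) * p X :=
  Iff.rfl

theorem contDiff_of_mem_polyFun {m : ℂ} {p : D.Nbar → ℂ} (hp : p ∈ D.polyFun m) : ContDiff ℝ ∞ p :=
  contDiff_of_mem_polyAlg hp.1

theorem comp_mem_polyAlg {N N' : Type*} [AddCommGroup N] [Module ℝ N] [AddCommGroup N']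
    [Module ℝ N'] {p : N' → ℂ} (hp : p ∈ polyAlg N') (T : N →ₗ[ℝ] N') :
    (fun X => p (T X)) ∈ polyAlg N := by
  induction hp using Algebra.adjoin_induction with
  | mem p h =>
    obtain ⟨φ, rfl⟩ := h
    exact linear_mem_polyAlg (φ ∘ₗ T)
  | algebraMap c => exact (polyAlg N).algebraMap_mem c
  | add p q _ _ h h' => exact add_mem h h'
  | mul p q _ _ h h' => exact mul_mem h h'

/-- Linear maps which commute with the dilations preserve the homogeneous polynomial densities. -/
theorem pushforward_mem_polyDist {m : ℂ} {k : D.ScalarDist} (hk : k ∈ D.polyDist m)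
    {T : D.Nbar ≃L[ℝ] D.Nbar} (hT : ∀ r X, T (D.dilation r X) = D.dilation r (T X)) :
    pushforward T k ∈ D.polyDist m := by
  obtain ⟨p, hp, hk⟩ := hk
  refine ⟨_, ?_, hk.pushforward T (S' := ∅) (by simp)⟩
  set d := |(LinearMap.det (T : D.Nbar →ₗ[ℝ] D.Nbar))⁻¹|
  have h1 : (fun X => p (T.symm X)) ∈ D.polyFun m := by
    refine mem_polyFun.2 ⟨comp_mem_polyAlg hp.1 (T.symm : D.Nbar →ₗ[ℝ] D.Nbar), fun r hr X => ?_⟩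
    have h2 : T.symm (D.dilation r X) = D.dilation r (T.symm X) := by
      rw [ContinuousLinearEquiv.symm_apply_eq, hT, T.apply_symm_apply]
    simp only [h2, hp.2 r hr]
  convert Submodule.smul_mem _ (d : ℂ) h1 using 1
  ext X
  simp

theorem IsDensityOff.pushforward_dilation {S : Set D.Nbar} {k : Dist D.Nbar W} {h : D.Nbar → W}
    (hk : IsDensityOff S k h) {r : ℝˣ} (hr : 0 < (r : ℝ)) (hS : ∀ X ∈ S, D.dilation r X ∈ S) :
    IsDensityOff S (FlatParabolic.pushforward (D.dilation r) k)
      (fun X => ((r : ℝ) : ℂ) ^ (-(D.hdim : ℂ)) • h (D.dilation r⁻¹ X)) := by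
  have h1 := hk.pushforward (D.dilation r) hS
  simp only [det_dilation, dilation_symm_apply] at h1
  have h2 : ((r : ℝ) : ℂ) ^ (-(D.hdim : ℂ)) = ((|((r : ℝ) ^ D.hdim)⁻¹| : ℝ) : ℂ) := by
    rw [abs_of_pos (by positivity), Complex.cpow_neg, Complex.cpow_natCast]
    push_cast
    rfl
  simp only [h2, Complex.coe_smul]
  exact h1

/-- A function in `𝒫^m` is homogeneous of degree `m` as a density: the Jacobian shifts the degree by
the homogeneous dimension. -/
theorem polyFun_apply_dilation_inv {m : ℂ} {p : D.Nbar → ℂ} (hp : p ∈ D.polyFun m) {r : ℝˣ}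
    (hr : 0 < (r : ℝ)) (X : D.Nbar) :
    ((r : ℝ) : ℂ) ^ (-(D.hdim : ℂ)) * p (D.dilation r⁻¹ X) = ((r : ℝ) : ℂ) ^ m * p X := by
  have hr0 : ((r : ℝ) : ℂ) ≠ 0 := by exact_mod_cast hr.ne'
  have := hp.2 r hr (D.dilation r⁻¹ X)
  rw [← dilation_mul, mul_inv_cancel, dilation_one] at this
  rw [this, ← mul_assoc, ← Complex.cpow_add _ _ hr0]
  ring_nf

theorem IsDensityOff.congr_ae {S : Set D.Nbar} {k : Dist D.Nbar W} {h h' : D.Nbar → W}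
    (hk : IsDensityOff S k h) (hh : h =ᵐ[Measure.addHaar] h') : IsDensityOff S k h' := by
  intro f hf
  have h1 : (fun X => f X • h X) =ᵐ[Measure.addHaar] fun X => f X • h' X := by
    filter_upwards [hh] with X hX
    rw [hX]
  exact ⟨(hk f hf).1.congr h1, (hk f hf).2.trans (integral_congr_ae h1)⟩

/-- The distribution `p log|·|` is homogeneous modulo `𝒫^m`, since the logarithm of a gauge changes
by a constant under a dilation. -/
theorem pushforward_dilation_sub_mem_of_log [Nontrivial D.Nbar] {m : ℂ} {ν : D.Nbar → ℝ}
    (hν : D.IsGauge ν) {p : D.Nbar → ℂ} (hp : p ∈ D.polyFun m) {k : D.ScalarDist}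
    (hk : IsDensityOff ∅ k (fun X => p X * Real.log (ν X))) {r : ℝˣ} (hr : 0 < (r : ℝ)) :
    pushforward (D.dilation r) k - ((r : ℝ) : ℂ) ^ m • k ∈ D.polyDist m := by
  refine ⟨_, Submodule.smul_mem _ (-((r : ℝ) : ℂ) ^ m * Real.log r) hp, ?_⟩
  refine ((hk.pushforward_dilation hr (by simp)).sub (hk.smul (((r : ℝ) : ℂ) ^ m))).congr_ae ?_
  have : (nhdsWithin (0 : D.Nbar) {0}ᶜ).NeBot := Module.punctured_nhds_neBot ℝ D.Nbar 0
  have h0 : (Measure.addHaar : Measure D.Nbar) {0} = 0 := measure_singleton 0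
  filter_upwards [compl_mem_ae_iff.2 h0] with X hX
  have hri : 0 < ((r⁻¹ : ℝˣ) : ℝ) := by simpa using hr
  have h1 := polyFun_apply_dilation_inv hp hr X
  simp only [Pi.sub_apply, Pi.smul_apply, smul_eq_mul]
  rw [← mul_assoc, h1, hν.homogeneous _ hri, Real.log_mul hri.ne' (hν.pos X hX).ne',
    Units.val_inv_eq_inv_val, Real.log_inv]
  push_cast
  ring

/-- The logarithmic terms in `Σ^m_H` are homogeneous modulo `𝒫^m` themselves, so that they do not
enlarge the space. -/
theorem symDist_eq_homogDist [Nontrivial D.Nbar] (m : ℂ) : D.symDist m = D.homogDist m := by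
  refine sup_eq_left.2 (Submodule.span_le.2 ?_)
  rintro k ⟨ν, hν, p, hp, hk⟩
  refine ⟨fun r hr => pushforward_dilation_sub_mem_of_log hν hp hk hr, _, ?_,
    hk.mono (Set.empty_subset _)⟩
  refine (contDiff_of_mem_polyFun hp).contDiffOn.mul ?_
  exact Complex.ofRealCLM.contDiff.comp_contDiffOn
    (hν.smooth.log fun X hX => (hν.pos X hX).ne')

end StandardParabolic

end

section

/-! ### Homogeneous distributions with polynomial density off the origin -/

section Eigenspaces

variable {K V : Type*} [Field K] [AddCommGroup V] [Module K V]

/-- An eigenvector in a sum of subspaces of eigenspaces lies in the sum of those subspaces which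
belong to its eigenvalue. -/
theorem mem_iSup_of_apply_eq_smul {ι : Type*} {A : End K V} {p : ι → Submodule K V} {μ : ι → K}
    (hp : ∀ i, p i ≤ End.eigenspace A (μ i)) {z : K} {u : V} (hu : u ∈ ⨆ i, p i)
    (hz : A u = z • u) : u ∈ ⨆ (i) (_ : μ i = z), p i := by
  have h1 : ⨆ i, p i ≤ (⨆ (i) (_ : μ i = z), p i) ⊔ ⨆ (ν) (_ : ν ≠ z), End.eigenspace A ν := by
    refine iSup_le fun i => ?_
    by_cases hi : μ i = z
    · exact le_sup_of_le_left (le_iSup₂_of_le i hi le_rfl)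
    · exact le_sup_of_le_right (le_iSup₂_of_le (μ i) hi (hp i))
  obtain ⟨a, ha, b, hb, rfl⟩ := Submodule.mem_sup.1 (h1 hu)
  have ha' : a ∈ End.eigenspace A z :=
    (iSup₂_le fun i hi => hi ▸ hp i : ⨆ (i) (_ : μ i = z), p i ≤ End.eigenspace A z) ha
  have hb' : b ∈ End.eigenspace A z := by
    have := sub_mem (End.mem_eigenspace_iff.2 hz) ha'
    rwa [add_sub_cancel_left] at this
  have h0 : b = 0 := Submodule.disjoint_def.1 (End.eigenspaces_iSupIndep A z) b hb' hb
  rwa [h0, add_zero]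

/-- A generalized eigenvector of rank two in a sum of eigenspaces is an eigenvector. -/
theorem apply_eq_smul_of_apply_sub {A : End K V} {z : K} {u : V}
    (hu : u ∈ ⨆ μ, End.eigenspace A μ) (hz : A (A u - z • u) = z • (A u - z • u)) :
    A u = z • u := by
  have h1 : ⨆ μ, End.eigenspace A μ ≤
      End.eigenspace A z ⊔ ⨆ (ν) (_ : ν ≠ z), End.eigenspace A ν := by
    refine iSup_le fun μ => ?_
    by_cases hi : μ = z
    · exact hi ▸ le_sup_left
    · exact le_sup_of_le_right (le_iSup₂_of_le μ hi le_rfl)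
  obtain ⟨a, ha, b, hb, rfl⟩ := Submodule.mem_sup.1 (h1 hu)
  rw [End.mem_eigenspace_iff] at ha
  have h2 : A (a + b) - z • (a + b) = A b - z • b := by rw [map_add, ha, smul_add]; abel
  have h3 : A b ∈ ⨆ (ν) (_ : ν ≠ z), End.eigenspace A ν := by
    have : ⨆ (ν) (_ : ν ≠ z), End.eigenspace A ν ≤
        (⨆ (ν) (_ : ν ≠ z), End.eigenspace A ν).comap A := by
      refine iSup₂_le fun ν hν x hx => ?_
      rw [Submodule.mem_comap, End.mem_eigenspace_iff.1 hx]
      exact Submodule.smul_mem _ _ ((le_iSup₂_of_le ν hν le_rfl :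
        End.eigenspace A ν ≤ ⨆ (ν) (_ : ν ≠ z), End.eigenspace A ν) hx)
    exact this hb
  rw [h2] at hz
  have h4 := Submodule.disjoint_def.1 (End.eigenspaces_iSupIndep A z) (A b - z • b)
    (End.mem_eigenspace_iff.2 hz) (sub_mem h3 (Submodule.smul_mem _ _ hb))
  rw [← sub_eq_zero, h2, h4]

end Eigenspaces

/-- A complex exponent is determined by the power functions on the positive reals. -/
theorem eq_of_forall_cpow_eq {a b : ℂ} (h : ∀ r : ℝ, 0 < r → (r : ℂ) ^ a = (r : ℂ) ^ b) :
    a = b := by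
  have hd : ∀ c : ℂ, HasDerivAt (fun t : ℝ => Complex.exp (t * c)) c 0 := by
    intro c
    have h1 : HasDerivAt (fun t : ℝ => (t : ℂ) * c) (1 * c) 0 :=
      (Complex.ofRealCLM.hasDerivAt (x := (0 : ℝ))).mul_const c
    simpa using h1.cexp
  have h1 : (fun t : ℝ => Complex.exp (t * a)) = fun t : ℝ => Complex.exp (t * b) := by
    ext t
    rw [← ofReal_exp_cpow, ← ofReal_exp_cpow, h _ (Real.exp_pos t)]
  have h2 := hd a
  rw [h1] at h2
  exact h2.unique (hd b)

theorem natCast_lt_infty (i : ℕ) : (i : WithTop ℕ∞) < ∞ := by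
  exact_mod_cast ENat.natCast_lt_top i

section Jets

variable {N : Type*} [NormedAddCommGroup N] [NormedSpace ℝ N]

/-- The iterated directional derivative of test functions. -/
def iterLineDeriv : (l : ℕ) → (Fin l → N) → Test N →L[ℝ] Test N
  | 0, _ => ContinuousLinearMap.id ℝ _
  | l + 1, v => (TestFunction.lineDerivCLM ℝ (v 0)).comp (iterLineDeriv l (Fin.tail v))

theorem iterLineDeriv_apply (l : ℕ) (v : Fin l → N) (f : Test N) (X : N) :
    iterLineDeriv l v f X = iteratedFDeriv ℝ l f X v := by
  induction l generalizing X with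
  | zero => rfl
  | succ l ih =>
    have h1 : (iterLineDeriv l (Fin.tail v) f : N → ℝ) =
        fun X => iteratedFDeriv ℝ l f X (Fin.tail v) := funext (ih (Fin.tail v))
    have h2 : DifferentiableAt ℝ (iteratedFDeriv ℝ l f) X :=
      (f.contDiff.differentiable_iteratedFDeriv (natCast_lt_infty _)) X
    rw [h2.iteratedFDeriv_succ_apply_left', ← h1]
    have h3 := TestFunction.lineDerivCLM_apply_of_le (𝕜 := ℝ) (n := ⊤) (k := ⊤)
      (f := iterLineDeriv l (Fin.tail v) f) (v := v 0) (x := X) le_top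
    exact h3.trans (((iterLineDeriv l (Fin.tail v) f).contDiff.differentiable
      (by simp)) X).lineDeriv_eq_fderiv

/-- The distribution `f ↦ (∂_{v₁} ⋯ ∂_{v_l} f)(0)`. -/
def evalDeriv (l : ℕ) (v : Fin l → N) : Dist N ℂ :=
  (Complex.ofRealCLM.comp (Distribution.delta (0 : N) : Test N →L[ℝ] ℝ)).comp (iterLineDeriv l v)

theorem evalDeriv_apply (l : ℕ) (v : Fin l → N) (f : Test N) :
    evalDeriv l v f = (iteratedFDeriv ℝ l f 0 v : ℝ) :=
  congrArg Complex.ofReal (iterLineDeriv_apply l v f 0)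

/-- A distribution has finite order on each compact set. -/
theorem exists_order_bound (u : Dist N ℂ) (K : TopologicalSpace.Compacts N) :
    ∃ (P : ℕ) (C : ℝ), ∀ f : Test N, tsupport f ⊆ K → ∀ B : ℝ, 0 ≤ B →
      (∀ i < P, ∀ X ∈ K, ‖iteratedFDeriv ℝ i f X‖ ≤ B) → ‖u f‖ ≤ C * B := by
  let ι : 𝓓_{K}(N, ℝ) →L[ℝ] Test N :=
    TestFunction.ofSupportedInCLM ℝ (Ω := (⊤ : TopologicalSpace.Opens N)) (fun _ _ => trivial)
  let u' : Test N →L[ℝ] ℂ := u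
  let q : Seminorm ℝ 𝓓_{K}(N, ℝ) := (normSeminorm ℝ ℂ).comp (u'.comp ι).toLinearMap
  have hq : Continuous q := continuous_norm.comp (u'.comp ι).continuous
  obtain ⟨s, C, -, h⟩ := Seminorm.bound_of_continuous
    (ContDiffMapSupportedIn.withSeminorms ℝ N ℝ ⊤ K) q hq
  refine ⟨s.sup id + 1, C, fun f hf B hB hfB => ?_⟩
  let f' : 𝓓_{K}(N, ℝ) := ContDiffMapSupportedIn.of_support_subset f.contDiff
    ((subset_tsupport f).trans hf)
  have h1 : ι f' = f := rfl
  have h2 : ‖u f‖ ≤ C * (s.sup (ContDiffMapSupportedIn.seminorm ℝ N ℝ ⊤ K)) f' := h f'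
  refine h2.trans (mul_le_mul_of_nonneg_left ?_ C.2)
  refine Seminorm.finset_sup_apply_le hB fun i hi => ?_
  refine (ContDiffMapSupportedIn.seminorm_top_le_iff ℝ hB i f').2 fun X hX => ?_
  exact hfB i (Nat.lt_succ_of_le (Finset.le_sup (f := id) hi)) X hX

theorem exists_norm_iteratedFDeriv_le (f : Test N) (i : ℕ) :
    ∃ C, ∀ X, ‖iteratedFDeriv ℝ i f X‖ ≤ C :=
  (f.contDiff.continuous_iteratedFDeriv (by exact_mod_cast le_top)).bounded_above_of_compact_support
    (f.hasCompactSupport.iteratedFDeriv i)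

/-- Taylor's estimate for a function whose jet of order `P - 1` at the origin vanishes. -/
theorem exists_norm_iteratedFDeriv_le_pow (f : Test N) (P : ℕ)
    (hf : ∀ i < P, iteratedFDeriv ℝ i f 0 = 0) :
    ∃ C, 0 ≤ C ∧ ∀ d ≤ P, ∀ X, ‖iteratedFDeriv ℝ (P - d) f X‖ ≤ C * ‖X‖ ^ d := by
  obtain ⟨C, hC⟩ := exists_norm_iteratedFDeriv_le f P
  have hC0 : 0 ≤ C := (norm_nonneg _).trans (hC 0)
  refine ⟨C, hC0, fun d => ?_⟩
  induction d with
  | zero => simpa using hC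
  | succ d ih =>
    intro hd X
    have hi : P - d = P - (d + 1) + 1 := by omega
    have h1 : ∀ Y ∈ Metric.closedBall (0 : N) ‖X‖,
        ‖fderiv ℝ (iteratedFDeriv ℝ (P - (d + 1)) f) Y‖ ≤ C * ‖X‖ ^ d := by
      intro Y hY
      rw [norm_fderiv_iteratedFDeriv, ← hi]
      refine (ih (by omega) Y).trans ?_
      gcongr
      simpa using hY
    have h2 := (convex_closedBall (0 : N) ‖X‖).norm_image_sub_le_of_norm_fderiv_le (𝕜 := ℝ)
      (fun Y _ => (f.contDiff.differentiable_iteratedFDeriv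
        (natCast_lt_infty _)) Y) h1
      (Metric.mem_closedBall_self (norm_nonneg X)) (y := X) (by simp)
    rw [hf _ (by omega), sub_zero, sub_zero] at h2
    rwa [pow_succ, ← mul_assoc]

end Jets

variable {E : Type*} [NormedAddCommGroup E] [NormedSpace ℝ E]
  {G : Type*} [TopologicalSpace G] [ChartedSpace E G] [Group G]
  [FiniteDimensional ℝ E] [LieGroup 𝓘(ℝ, E) ∞ G]

namespace StandardParabolic

variable {D : StandardParabolic E G}

theorem norm_dilation_le {r : ℝˣ} (hr : 0 < (r : ℝ)) (hr1 : (r : ℝ) ≤ 1) :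
    ‖(D.dilation r : D.Nbar →L[ℝ] D.Nbar)‖ ≤ r := by
  refine ContinuousLinearMap.opNorm_le_bound _ hr.le fun X => ?_
  refine (pi_norm_le_iff_of_nonneg (by positivity)).2 fun j => ?_
  change ‖D.dilation r X j‖ ≤ _
  rw [dilation_apply, norm_smul, Real.norm_eq_abs, abs_of_pos (by positivity)]
  exact mul_le_mul (pow_le_of_le_one hr.le hr1 (Nat.succ_ne_zero _)) (norm_le_pi_norm X j)
    (norm_nonneg _) hr.le

/-- A distribution supported at the origin only sees the germ of the test function. -/
theorem eq_of_eventuallyEq_zero {u : D.ScalarDist} (hu : IsDensityOff {0} u 0) {f g : Test D.Nbar}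
    (h : (f : D.Nbar → ℝ) =ᶠ[nhds 0] g) : u f = u g := by
  have h1 : u (f - g) = 0 := by
    have := (hu (f - g) (Set.disjoint_singleton_right.2 ?_)).2
    · simpa using this
    · rw [notMem_tsupport_iff_eventuallyEq]
      filter_upwards [h] with X hX
      rw [sub_apply, hX, sub_self]; rfl
  exact sub_eq_zero.1 ((map_sub u f g).symm.trans h1)

/-- A homogeneous distribution supported at the origin only depends on a finite jet of the test
function: the dilates of a test function with vanishing jet are small near the origin. -/
theorem exists_forall_jet_eq_zero {m : ℂ} {u : D.ScalarDist} (hu : IsDensityOff {0} u 0)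
    (hom : ∀ r : ℝˣ, 0 < (r : ℝ) → pushforward (D.dilation r) u = ((r : ℝ) : ℂ) ^ m • u) :
    ∃ P : ℕ, ∀ f : Test D.Nbar, (∀ i < P, iteratedFDeriv ℝ i f 0 = 0) → u f = 0 := by
  let K : TopologicalSpace.Compacts D.Nbar := ⟨Metric.closedBall 0 2, isCompact_closedBall 0 2⟩
  obtain ⟨P₀, C, hC⟩ := exists_order_bound u K
  obtain ⟨P, hP₀, hPm⟩ : ∃ P : ℕ, P₀ ≤ P ∧ m.re < P := by
    obtain ⟨n, hn⟩ := exists_nat_gt m.re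
    exact ⟨max P₀ n, le_max_left _ _, hn.trans_le (by exact_mod_cast le_max_right _ _)⟩
  refine ⟨P, fun f hf => ?_⟩
  let χ₀ : ContDiffBump (0 : D.Nbar) := ⟨1, 2, one_pos, one_lt_two⟩
  let χ : Test D.Nbar := testOf χ₀ χ₀.contDiff χ₀.hasCompactSupport
  obtain ⟨A, hA0, hA⟩ := exists_norm_iteratedFDeriv_le_pow f P hf
  obtain ⟨B, hB0, hB⟩ : ∃ B, 0 ≤ B ∧ ∀ i ≤ P, ∀ X, ‖iteratedFDeriv ℝ i χ X‖ ≤ B := by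
    choose B hB using exists_norm_iteratedFDeriv_le χ
    have hB' : ∀ i, 0 ≤ B i := fun i => (norm_nonneg _).trans (hB i 0)
    refine ⟨∑ i ∈ Finset.range (P + 1), B i, Finset.sum_nonneg fun i _ => hB' i, fun i hi X => ?_⟩
    exact (hB i X).trans (Finset.single_le_sum (fun i _ => hB' i)
      (Finset.mem_range.2 (Nat.lt_succ_of_le hi)))
  -- the estimate for the cut-off of the dilated test function
  have key : ∀ r : ℝˣ, 0 < (r : ℝ) → (r : ℝ) ≤ 1 →
      ‖u f‖ ≤ (C * (2 ^ P * (B * (A * 2 ^ P)))) * (r : ℝ) ^ ((P : ℝ) - m.re) := by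
    intro r hr hr1
    have hcd : ContDiff ℝ ∞ (f ∘ (D.dilation r : D.Nbar →L[ℝ] D.Nbar)) :=
      f.contDiff.comp (D.dilation r : D.Nbar →L[ℝ] D.Nbar).contDiff
    let g : Test D.Nbar := testOf (fun X => χ X * (f ∘ (D.dilation r : D.Nbar →L[ℝ] D.Nbar)) X)
      (χ.contDiff.mul hcd) (χ.hasCompactSupport.mul_right)
    have hg : u (pullback (D.dilation r) f) = u g := by
      refine eq_of_eventuallyEq_zero hu ?_
      filter_upwards [χ₀.eventuallyEq_one] with X hX
      change f (D.dilation r X) = χ₀ X * f (D.dilation r X)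
      rw [hX, Pi.one_apply, one_mul]
    have hgK : tsupport g ⊆ K := by
      refine (tsupport_mul_subset_left (f := χ)).trans ?_
      exact χ₀.tsupport_eq.le
    have h1 : ∀ j ≤ P, ∀ X ∈ K,
        ‖iteratedFDeriv ℝ j (f ∘ (D.dilation r : D.Nbar →L[ℝ] D.Nbar)) X‖ ≤
          A * 2 ^ P * (r : ℝ) ^ P := by
      intro j hj X hX
      have hX2 : ‖X‖ ≤ 2 := mem_closedBall_zero_iff.1 hX
      rw [(D.dilation r : D.Nbar →L[ℝ] D.Nbar).iteratedFDeriv_comp_right f.contDiff X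
        (by exact_mod_cast le_top)]
      refine (ContinuousMultilinearMap.norm_compContinuousLinearMap_le _ _).trans ?_
      have h2 := hA (P - j) (Nat.sub_le _ _) ((D.dilation r : D.Nbar →L[ℝ] D.Nbar) X)
      rw [Nat.sub_sub_self hj] at h2
      have h3 : ‖(D.dilation r : D.Nbar →L[ℝ] D.Nbar) X‖ ≤ r * 2 :=
        (ContinuousLinearMap.le_opNorm _ _).trans
          (mul_le_mul (norm_dilation_le hr hr1) hX2 (norm_nonneg _) hr.le)
      rw [Finset.prod_const, Finset.card_univ, Fintype.card_fin]
      calc _ ≤ (A * (r * 2) ^ (P - j)) * (r : ℝ) ^ j := by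
            refine mul_le_mul (h2.trans ?_) ?_ (by positivity) (by positivity)
            · gcongr
            · exact pow_le_pow_left₀ (norm_nonneg _) (norm_dilation_le hr hr1) _
        _ = A * 2 ^ (P - j) * (r : ℝ) ^ P := by
            rw [mul_pow, ← pow_sub_mul_pow (r : ℝ) hj]; ring
        _ ≤ _ := by
            gcongr
            · exact one_le_two
            · exact Nat.sub_le _ _
    have h2 : ∀ i < P₀, ∀ X ∈ K, ‖iteratedFDeriv ℝ i g X‖ ≤
        2 ^ P * (B * (A * 2 ^ P)) * (r : ℝ) ^ P := by
      intro i hi X hX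
      refine (norm_iteratedFDeriv_mul_le χ.contDiff hcd X (n := i)
        (by exact_mod_cast le_top)).trans ?_
      calc _ ≤ ∑ j ∈ Finset.range (i + 1), (i.choose j : ℝ) * (B * (A * 2 ^ P * (r : ℝ) ^ P)) := by
            refine Finset.sum_le_sum fun j hj => ?_
            have hj' : j ≤ i := Nat.lt_succ_iff.1 (Finset.mem_range.1 hj)
            rw [mul_assoc]
            refine mul_le_mul_of_nonneg_left ?_ (Nat.cast_nonneg _)
            exact mul_le_mul (hB j (by omega) X) (h1 _ (by omega) X hX) (norm_nonneg _) hB0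
        _ = 2 ^ i * (B * (A * 2 ^ P * (r : ℝ) ^ P)) := by
            rw [← Finset.sum_mul]
            congr 1
            exact_mod_cast Nat.sum_range_choose i
        _ ≤ 2 ^ P * (B * (A * 2 ^ P * (r : ℝ) ^ P)) := by
            gcongr
            · exact one_le_two
            · omega
        _ = _ := by ring
    have h3 := hC g hgK _ (by positivity) h2
    have h4 : u (pullback (D.dilation r) f) = ((r : ℝ) : ℂ) ^ m * u f := by
      rw [← pushforward_apply, hom r hr]; rfl
    rw [← hg, h4, norm_mul, Complex.norm_cpow_eq_rpow_re_of_pos hr] at h3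
    have h5 : 0 < (r : ℝ) ^ m.re := Real.rpow_pos_of_pos hr _
    rw [Real.rpow_sub hr, Real.rpow_natCast, ← mul_div_assoc, le_div_iff₀ h5, mul_comm]
    refine h3.trans (le_of_eq (by ring))
  have hpos : 0 < (P : ℝ) - m.re := sub_pos.2 hPm
  have hlim : Filter.Tendsto (fun r : ℝ => (C * (2 ^ P * (B * (A * 2 ^ P)))) * r ^ ((P : ℝ) - m.re))
      (nhdsWithin 0 (Set.Ioi 0)) (nhds 0) := by
    have := ((Real.continuousAt_rpow_const 0 ((P : ℝ) - m.re) (Or.inr hpos.le)).tendsto.mono_left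
      nhdsWithin_le_nhds).const_mul (C * (2 ^ P * (B * (A * 2 ^ P))))
        (x := nhdsWithin 0 (Set.Ioi 0))
    rwa [Real.zero_rpow hpos.ne', mul_zero] at this
  refine norm_le_zero_iff.1 (ge_of_tendsto hlim ?_)
  filter_upwards [Ioc_mem_nhdsGT one_pos] with r hr
  exact key (Units.mk0 r hr.1.ne') hr.1 hr.2

theorem evalDeriv_single_mem_envDist (l : ℕ) (d : Fin l → Fin D.depth)
    (X : (i : Fin l) → D.negPart (d i)) :
    evalDeriv l (fun i => Pi.single (d i) (X i)) ∈
      D.envDist ((∑ i, ((d i : ℕ) + 1) : ℕ) : ℂ) :=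
  Submodule.subset_span ⟨l, d, X, rfl, fun f => evalDeriv_apply l _ f⟩

/-- A distribution which factors through the jets of finite order at the origin is a combination of
derivatives of the delta distribution. -/
theorem mem_iSup_envDist_of_jet {u : D.ScalarDist} {P : ℕ}
    (hP : ∀ f : Test D.Nbar, (∀ i < P, iteratedFDeriv ℝ i f 0 = 0) → u f = 0) :
    u ∈ ⨆ w : ℕ, D.envDist (w : ℂ) := by
  let ι := Σ i : Fin P, (Fin i → Σ j : Fin D.depth, Fin (finrank ℝ (D.negPart j)))
  let J : Test D.Nbar →ₗ[ℝ] (ι → ℝ) :=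
    { toFun := fun f a => iterLineDeriv a.1 (fun i => D.nbarBasis (a.2 i)) f 0
      map_add' := fun f g => by ext a; simp
      map_smul' := fun c f => by ext a; simp }
  have hJ : ∀ f, J f = 0 → u f = 0 := by
    intro f hf
    refine hP f fun i hi => ?_
    refine ContinuousMultilinearMap.toMultilinearMap_injective ?_
    refine Basis.ext_multilinear (fun _ => D.nbarBasis) fun v => ?_
    have := congrFun hf (⟨⟨i, hi⟩, v⟩ : ι)
    exact (iterLineDeriv_apply i _ f 0).symm.trans this
  obtain ⟨s, hs⟩ := J.rangeRestrict.exists_rightInverse_of_surjective J.range_rangeRestrict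
  let u' : Test D.Nbar →ₗ[ℝ] ℂ := (u : Test D.Nbar →L[ℝ] ℂ).toLinearMap
  obtain ⟨g, hg⟩ := (u' ∘ₗ s).exists_extend
  have hgJ : ∀ f, u f = g (J f) := by
    intro f
    have h1 : J (f - s (J.rangeRestrict f)) = 0 := by
      have h2 := congrArg Subtype.val (LinearMap.congr_fun hs (J.rangeRestrict f))
      rw [map_sub, sub_eq_zero]
      exact h2.symm
    have h3 : u' (f - s (J.rangeRestrict f)) = 0 := hJ _ h1
    rw [map_sub, sub_eq_zero] at h3
    exact h3.trans (LinearMap.congr_fun hg (J.rangeRestrict f)).symm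
  have hu : u = ∑ a : ι, g (Pi.single a 1) • evalDeriv a.1 (fun i => D.nbarBasis (a.2 i)) := by
    ext f
    rw [hgJ f]
    conv_lhs => rw [← Finset.univ_sum_single (J f), map_sum]
    rw [sum_apply]
    refine Finset.sum_congr rfl fun a _ => ?_
    have h1 : (Pi.single a (J f a) : ι → ℝ) = J f a • Pi.single a 1 := by
      rw [← Pi.single_smul, smul_eq_mul, mul_one]
    rw [h1, map_smul, smul_apply, evalDeriv_apply, ← iterLineDeriv_apply, smul_eq_mul, mul_comm]
    exact (Complex.real_smul).symm
  rw [hu]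
  refine Submodule.sum_mem _ fun a _ => Submodule.smul_mem _ _ ?_
  simp only [nbarBasis_apply]
  exact Submodule.mem_iSup_of_mem _ (evalDeriv_single_mem_envDist _ (fun i => (a.2 i).1) _)

theorem pushforward_dilation_of_mem_envDist {m : ℂ} {u : D.ScalarDist} (hu : u ∈ D.envDist m)
    (r : ℝˣ) : pushforward (D.dilation r) u = ((r : ℝ) : ℂ) ^ m • u := by
  induction hu using Submodule.span_induction with
  | mem k h =>
    obtain ⟨l, d, X, rfl, hk⟩ := h
    ext f
    rw [pushforward_apply, hk, smul_apply, hk]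
    have h1 : (pullback (D.dilation r) f : D.Nbar → ℝ) =
      f ∘ (D.dilation r : D.Nbar →L[ℝ] D.Nbar) := rfl
    rw [h1, (D.dilation r : D.Nbar →L[ℝ] D.Nbar).iteratedFDeriv_comp_right f.contDiff 0
      (by exact_mod_cast le_top), ContinuousMultilinearMap.compContinuousLinearMap_apply, map_zero]
    have h2 : (fun i => (D.dilation r : D.Nbar →L[ℝ] D.Nbar) (Pi.single (d i) (X i))) =
        fun i => (r : ℝ) ^ ((d i : ℕ) + 1) • (Pi.single (d i) (X i) : D.Nbar) :=
      funext fun i => D.dilation_single r (d i) (X i)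
    rw [h2, ContinuousMultilinearMap.map_smul_univ, Complex.cpow_natCast,
      Finset.prod_pow_eq_pow_sum]
    simp
  | zero => simp
  | add k k' _ _ h h' => rw [map_add, h, h', smul_add]
  | smul c k _ h => rw [map_smul, h, smul_comm]

/-- A distribution supported at the origin which is homogeneous of degree `m` belongs to `𝒰_m`.
Hence it vanishes unless `m` is a natural number. -/
theorem mem_envDist_of_homogeneous {m : ℂ} {u : D.ScalarDist} (hu : IsDensityOff {0} u 0)
    (hom : ∀ r : ℝˣ, 0 < (r : ℝ) → pushforward (D.dilation r) u = ((r : ℝ) : ℂ) ^ m • u) :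
    u ∈ D.envDist m := by
  by_cases hu0 : u = 0
  · rw [hu0]; exact zero_mem _
  obtain ⟨P, hP⟩ := exists_forall_jet_eq_zero hu hom
  have h1 := mem_iSup_envDist_of_jet hP
  have h2 : u ∈ ⨆ (w : ℕ) (_ : ((2 : ℝ) : ℂ) ^ (w : ℂ) = ((2 : ℝ) : ℂ) ^ m), D.envDist (w : ℂ) :=
    mem_iSup_of_apply_eq_smul (A := pushforward (D.dilation (Units.mk0 2 two_ne_zero)))
      (fun w k hk => End.mem_eigenspace_iff.2 (pushforward_dilation_of_mem_envDist hk _)) h1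
      (hom _ two_pos)
  obtain ⟨w₀, hw₀⟩ : ∃ w : ℕ, ((2 : ℝ) : ℂ) ^ (w : ℂ) = ((2 : ℝ) : ℂ) ^ m := by
    by_contra! hc
    exact hu0 ((Submodule.mem_bot ℂ).1
      ((iSup₂_le fun w hw => absurd hw (hc w) : _ ≤ (⊥ : Submodule ℂ D.ScalarDist)) h2))
  have h3 : u ∈ D.envDist (w₀ : ℂ) := by
    refine (iSup₂_le fun w hw => ?_ : _ ≤ D.envDist (w₀ : ℂ)) h2
    have h4 : w = w₀ := by
      rw [← hw₀, Complex.cpow_natCast, Complex.cpow_natCast] at hw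
      norm_cast at hw
      exact Nat.pow_right_injective le_rfl hw
    rw [h4]
  have h5 : (w₀ : ℂ) = m := by
    refine eq_of_forall_cpow_eq fun r hr => ?_
    have h6 := hom (Units.mk0 r hr.ne') hr
    rw [pushforward_dilation_of_mem_envDist h3] at h6
    exact smul_left_injective ℂ hu0 h6
  rwa [h5] at h3

/-- Composition of functions with the dilation `δ_r`. -/
def compDilation (r : ℝˣ) : End ℂ (D.Nbar → ℂ) where
  toFun p X := p (D.dilation r X)
  map_add' _ _ := rfl
  map_smul' _ _ := rfl

theorem compDilation_apply (r : ℝˣ) (p : D.Nbar → ℂ) (X : D.Nbar) :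
    compDilation r p X = p (D.dilation r X) := rfl

/-- Dilations act semisimply on polynomials: the products of eigenfunctions are eigenfunctions, and
linear functions are sums of eigenfunctions. -/
theorem mem_iSup_eigenspace_of_mem_polyAlg (r : ℝˣ) {p : D.Nbar → ℂ} (hp : p ∈ polyAlg D.Nbar) :
    p ∈ ⨆ μ, End.eigenspace (compDilation (D := D) r) μ := by
  have hmem : ∀ (μ : ℂ) (q : D.Nbar → ℂ), (∀ X, q (D.dilation r X) = μ * q X) →
      q ∈ ⨆ μ, End.eigenspace (compDilation (D := D) r) μ := fun μ q hq =>
    Submodule.mem_iSup_of_mem μ (End.mem_eigenspace_iff.2 (funext hq))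
  induction hp using Algebra.adjoin_induction with
  | mem p h =>
    obtain ⟨φ, rfl⟩ := h
    have h1 : (fun X => φ X) = ∑ j, fun X : D.Nbar => φ (Pi.single j (X j)) := by
      ext X
      rw [Finset.sum_apply, ← map_sum, Finset.univ_sum_single]
    rw [h1]
    refine Submodule.sum_mem _ fun j _ => hmem ((r : ℝ) ^ ((j : ℕ) + 1) : ℝ) _ fun X => ?_
    have h2 : (Pi.single j (D.dilation r X j) : D.Nbar) =
        (r : ℝ) ^ ((j : ℕ) + 1) • (Pi.single j (X j) : D.Nbar) := by
      rw [dilation_apply, Pi.single_smul]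
    rw [h2, map_smul, Complex.real_smul]
  | algebraMap c => exact hmem 1 _ fun X => by simp
  | add p q _ _ h h' => exact add_mem h h'
  | mul p q hp hq h h' =>
    clear hp hq
    induction h using Submodule.iSup_induction' with
    | mem μ p hp =>
      rw [End.mem_eigenspace_iff] at hp
      induction h' using Submodule.iSup_induction' with
      | mem ν q hq =>
        rw [End.mem_eigenspace_iff] at hq
        refine hmem (μ * ν) _ fun X => ?_
        have h1 := congrFun hp X
        have h2 := congrFun hq X
        simp only [compDilation_apply, Pi.smul_apply, smul_eq_mul] at h1 h2
        rw [Pi.mul_apply, h1, h2, Pi.mul_apply]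
        ring
      | zero => rw [mul_zero]; exact zero_mem _
      | add q q' _ _ h h' => rw [mul_add]; exact add_mem h h'
    | zero => rw [zero_mul]; exact zero_mem _
    | add q q' _ _ h h' => rw [add_mul]; exact add_mem h h'

/-- A polynomial density which is homogeneous of degree `m` modulo `𝒫^m` lies in `𝒫^m`, because
the dilations act semisimply on polynomials. -/
theorem mem_polyFun_of_sub_mem {m : ℂ} {p : D.Nbar → ℂ} (hp : p ∈ polyAlg D.Nbar)
    (h : ∀ r : ℝˣ, 0 < (r : ℝ) → (fun X => ((r : ℝ) : ℂ) ^ (-(D.hdim : ℂ)) * p (D.dilation r⁻¹ X) -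
      ((r : ℝ) : ℂ) ^ m * p X) ∈ D.polyFun m) : p ∈ D.polyFun m := by
  refine mem_polyFun.2 ⟨hp, fun r hr => ?_⟩
  have hr0 : ((r : ℝ) : ℂ) ≠ 0 := by exact_mod_cast hr.ne'
  have h1 := h r⁻¹ (by simpa using hr)
  rw [inv_inv, Units.val_inv_eq_inv_val] at h1
  rw [ofReal_inv_cpow hr, ofReal_inv_cpow hr, Complex.cpow_neg, inv_inv] at h1
  set z := ((r : ℝ) : ℂ) ^ (-m - D.hdim) with hz
  have h2 : compDilation r p - z • p ∈ D.polyFun m := by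
    have h3 := Submodule.smul_mem _ (((r : ℝ) : ℂ) ^ (-(D.hdim : ℂ))) h1
    convert h3 using 1
    ext X
    simp only [Pi.sub_apply, compDilation_apply, Pi.smul_apply, smul_eq_mul, mul_sub, ← mul_assoc]
    rw [← Complex.cpow_add _ _ hr0, ← Complex.cpow_neg, ← Complex.cpow_add _ _ hr0, hz]
    simp only [neg_add_cancel, Complex.cpow_zero, one_mul]
    ring_nf
  have h4 := apply_eq_smul_of_apply_sub (mem_iSup_eigenspace_of_mem_polyAlg r hp)
    (funext (h2.2 r hr))
  exact fun X => congrFun h4 X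

/-- A symbol whose density off the origin is a polynomial is the symbol of a differential
operator. -/
theorem mem_polyDist_sup_envDist [Nontrivial D.Nbar] {m : ℂ} {k : D.ScalarDist}
    (hk : k ∈ D.homogDist m) {p : D.Nbar → ℂ} (hp : p ∈ polyAlg D.Nbar)
    (hkp : IsDensityOff {0} k p) : k ∈ D.polyDist m ⊔ D.envDist m := by
  have hpc := (contDiff_of_mem_polyAlg hp).continuous
  -- a continuous function is determined by its restriction to the complement of the origin
  have hden : ∀ f g : D.Nbar → ℂ, Continuous f → Continuous g → Set.EqOn f g {0}ᶜ → f = g := by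
    intro f g hf hg hfg
    have : (nhdsWithin (0 : D.Nbar) {0}ᶜ).NeBot := Module.punctured_nhds_neBot ℝ D.Nbar 0
    exact Continuous.ext_on (dense_compl_singleton 0) hf hg hfg
  have hcov : ∀ r : ℝˣ, 0 < (r : ℝ) → (fun X => ((r : ℝ) : ℂ) ^ (-(D.hdim : ℂ)) *
      p (D.dilation r⁻¹ X) - ((r : ℝ) : ℂ) ^ m * p X) ∈ D.polyFun m ∧
      IsDensityOff ∅ (pushforward (D.dilation r) k - ((r : ℝ) : ℂ) ^ m • k)
        (fun X => ((r : ℝ) : ℂ) ^ (-(D.hdim : ℂ)) *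
          p (D.dilation r⁻¹ X) - ((r : ℝ) : ℂ) ^ m * p X) := by
    intro r hr
    obtain ⟨q, hq, hqk⟩ := hk.1 r hr
    have h1 : IsDensityOff {0} (pushforward (D.dilation r) k - ((r : ℝ) : ℂ) ^ m • k)
        (fun X => ((r : ℝ) : ℂ) ^ (-(D.hdim : ℂ)) * p (D.dilation r⁻¹ X) -
          ((r : ℝ) : ℂ) ^ m * p X) :=
      (hkp.pushforward_dilation hr (by simp)).sub (hkp.smul _)
    have hc1 : Continuous (fun X => ((r : ℝ) : ℂ) ^ (-(D.hdim : ℂ)) * p (D.dilation r⁻¹ X) -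
          ((r : ℝ) : ℂ) ^ m * p X) :=
      (continuous_const.mul (hpc.comp (D.dilation r⁻¹).continuous)).sub (continuous_const.mul hpc)
    have hc2 := (contDiff_of_mem_polyFun hq).continuous
    have h2 := hden _ _ hc1 hc2 (h1.eqOn (hqk.mono (Set.empty_subset _)) hc1.continuousOn
      hc2.continuousOn)
    rw [h2]
    exact ⟨hq, hqk⟩
  have hp' := mem_polyFun_of_sub_mem hp fun r hr => (hcov r hr).1
  obtain ⟨k', hk'⟩ := exists_isDensityOff_empty hpc
  refine Submodule.mem_sup.2 ⟨k', ⟨p, hp', hk'⟩, k - k', ?_, add_sub_cancel _ _⟩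
  have h0 : IsDensityOff {0} (k - k') 0 := by
    have := hkp.sub (hk'.mono (Set.empty_subset {0}))
    rwa [sub_self] at this
  refine mem_envDist_of_homogeneous h0 fun r hr => ?_
  have h1 := ((hcov r hr).2).unique ((hk'.pushforward_dilation hr (S := ∅) (by simp)).sub
    (hk'.smul (((r : ℝ) : ℂ) ^ m)))
  rw [map_sub, smul_sub, ← sub_eq_zero, sub_sub_sub_comm, h1, sub_self]

end StandardParabolic

end

section

/-! ### Vector-valued distributions and the action of `M_P A_P` -/

section Tensor

variable {N : Type*} [NormedAddCommGroup N] [NormedSpace ℝ N]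
  {W : Type*} [NormedAddCommGroup W] [NormedSpace ℂ W]
  {W' : Type*} [NormedAddCommGroup W'] [NormedSpace ℂ W']

theorem tmul_apply (k : Dist N ℂ) (w : W) (f : Test N) : tmul k w f = k f • w := rfl

theorem mapTarget_tmul (L : W →L[ℂ] W') (k : Dist N ℂ) (w : W) :
    mapTarget L (tmul k w) = tmul k (L w) := by
  ext f
  simp [tmul_apply]

theorem pushforward_tmul (T : N ≃L[ℝ] N) (k : Dist N ℂ) (w : W) :
    pushforward T (tmul k w) = tmul (pushforward T k) w := rfl

theorem mapTarget_pushforward (L : W →L[ℂ] W') (T : N ≃L[ℝ] N) (k : Dist N W) :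
    mapTarget L (pushforward T k) = pushforward T (mapTarget L k) := rfl

theorem tmul_mem_tensor {S : Submodule ℂ (Dist N ℂ)} {H : Submodule ℂ W} {k : Dist N ℂ}
    (hk : k ∈ S) {w : W} (hw : w ∈ H) : tmul k w ∈ tensor S H :=
  Submodule.subset_span ⟨k, hk, w, hw, rfl⟩

theorem mapTarget_mem_tensor {S : Submodule ℂ (Dist N ℂ)} {H : Submodule ℂ W}
    {H' : Submodule ℂ W'} {L : W →L[ℂ] W'} (hL : ∀ w ∈ H, L w ∈ H') {u : Dist N W}
    (hu : u ∈ tensor S H) : mapTarget L u ∈ tensor S H' := by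
  refine (Submodule.span_le.2 ?_ : tensor S H ≤ (tensor S H').comap (mapTarget L)) hu
  rintro _ ⟨k, hk, w, hw, rfl⟩
  change mapTarget L (tmul k w) ∈ tensor S H'
  rw [mapTarget_tmul]
  exact tmul_mem_tensor hk (hL w hw)

theorem mapTarget_mem_of_mem_tensor {S : Submodule ℂ (Dist N ℂ)} {H : Submodule ℂ W}
    (ℓ : W →L[ℂ] ℂ) {u : Dist N W} (hu : u ∈ tensor S H) : mapTarget ℓ u ∈ S := by
  refine (Submodule.span_le.2 ?_ : tensor S H ≤ S.comap (mapTarget ℓ)) hu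
  rintro _ ⟨k, hk, w, hw, rfl⟩
  have : mapTarget ℓ (tmul k w) = ℓ w • k := by
    ext f
    simp [tmul_apply, mul_comm]
  change mapTarget ℓ (tmul k w) ∈ S
  rw [this]
  exact S.smul_mem _ hk

/-- The decomposition of a vector-valued distribution along a basis of the target. -/
theorem eq_sum_tmul [FiniteDimensional ℂ W] (u : Dist N W) :
    u = ∑ i, tmul (mapTarget (LinearMap.toContinuousLinearMap ((finBasis ℂ W).coord i)) u)
      (finBasis ℂ W i) := by
  ext f
  rw [sum_apply]
  exact ((finBasis ℂ W).sum_repr (u f)).symm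

/-- Membership in `S ⊗ W` can be tested on the functionals of `W`. -/
theorem mem_tensor_top_iff [FiniteDimensional ℂ W] {S : Submodule ℂ (Dist N ℂ)} {u : Dist N W} :
    u ∈ tensor S ⊤ ↔ ∀ ℓ : W →L[ℂ] ℂ, mapTarget ℓ u ∈ S := by
  refine ⟨fun h ℓ => mapTarget_mem_of_mem_tensor ℓ h, fun h => ?_⟩
  rw [eq_sum_tmul u]
  exact Submodule.sum_mem _ fun i _ => tmul_mem_tensor (h _) Submodule.mem_top

theorem mem_tensor_sup [FiniteDimensional ℂ W] {S S' : Submodule ℂ (Dist N ℂ)} {u : Dist N W}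
    (h : ∀ ℓ : W →L[ℂ] ℂ, mapTarget ℓ u ∈ S ⊔ S') : u ∈ tensor S ⊤ ⊔ tensor S' ⊤ := by
  rw [eq_sum_tmul u]
  refine Submodule.sum_mem _ fun i _ => ?_
  obtain ⟨a, ha, b, hb, hab⟩ := Submodule.mem_sup.1
    (h (LinearMap.toContinuousLinearMap ((finBasis ℂ W).coord i)))
  have : tmul (a + b) (finBasis ℂ W i) = tmul a (finBasis ℂ W i) + tmul b (finBasis ℂ W i) := by
    ext f
    simp [tmul_apply, add_smul]
  rw [← hab, this]
  exact add_mem (Submodule.mem_sup_left (tmul_mem_tensor ha Submodule.mem_top))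
    (Submodule.mem_sup_right (tmul_mem_tensor hb Submodule.mem_top))

/-- If the classes of `u` modulo `S' ⊗ W` are fixed by all members of a family of operators on `W`,
then `u` is congruent to an element of `S ⊗ H`, where `H` is the space of common fixed vectors. -/
theorem exists_mem_tensor_of_forall_sub_mem [FiniteDimensional ℂ W] {ι : Type*} {L : ι → W →L[ℂ] W}
    {H : Submodule ℂ W} (hH : ∀ w, (∀ i, L i w = w) → w ∈ H) {S S' : Submodule ℂ (Dist N ℂ)}
    {u : Dist N W} (hu : u ∈ tensor S ⊤) (h : ∀ i, mapTarget (L i) u - u ∈ tensor S' ⊤) :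
    ∃ u' ∈ tensor S H, u - u' ∈ tensor S' ⊤ := by
  -- the functionals `ℓ` with `ℓ(u) ∈ S'` contain the annihilator of `H`, as
  -- `W` is finite-dimensional
  let Q : Submodule ℂ (Dual ℂ W) :=
    { carrier := {ℓ | mapTarget (LinearMap.toContinuousLinearMap ℓ) u ∈ S'}
      add_mem' := fun {ℓ ℓ'} hℓ hℓ' => by
        have : mapTarget (LinearMap.toContinuousLinearMap (ℓ + ℓ')) u =
          mapTarget (LinearMap.toContinuousLinearMap ℓ) u +
            mapTarget (LinearMap.toContinuousLinearMap ℓ') u := rfl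
        change mapTarget (LinearMap.toContinuousLinearMap (ℓ + ℓ')) u ∈ S'
        rw [this]
        exact add_mem hℓ hℓ'
      zero_mem' := S'.zero_mem
      smul_mem' := fun c ℓ hℓ => by
        have : mapTarget (LinearMap.toContinuousLinearMap (c • ℓ)) u =
          c • mapTarget (LinearMap.toContinuousLinearMap ℓ) u := rfl
        change mapTarget (LinearMap.toContinuousLinearMap (c • ℓ)) u ∈ S'
        rw [this]
        exact S'.smul_mem c hℓ }
  have hQ : Q.dualCoannihilator ≤ H := by
    intro w hw
    refine hH w fun i => ?_
    rw [← sub_eq_zero, ← Module.forall_dual_apply_eq_zero_iff ℂ]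
    intro ℓ
    have h1 : ℓ ∘ₗ ((L i : W →ₗ[ℂ] W) - LinearMap.id) ∈ Q := by
      have h2 := mapTarget_mem_of_mem_tensor (LinearMap.toContinuousLinearMap ℓ) (h i)
      have h3 : mapTarget (LinearMap.toContinuousLinearMap
          (ℓ ∘ₗ ((L i : W →ₗ[ℂ] W) - LinearMap.id))) u =
          mapTarget (LinearMap.toContinuousLinearMap ℓ) (mapTarget (L i) u - u) := rfl
      change mapTarget _ u ∈ S'
      rw [h3]
      exact h2
    exact (Submodule.mem_dualCoannihilator w).1 hw _ h1
  have hQ' : H.dualAnnihilator ≤ Q := by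
    rw [← Subspace.dualCoannihilator_dualAnnihilator_eq (W := Q)]
    exact Submodule.dualAnnihilator_anti hQ
  obtain ⟨π, hπ⟩ := H.exists_isCompl
  let p : W →ₗ[ℂ] W := H.subtype ∘ₗ H.projectionOnto π hπ
  refine ⟨mapTarget (LinearMap.toContinuousLinearMap p) u,
    mapTarget_mem_tensor (fun w _ => (H.projectionOnto π hπ w).2) hu, ?_⟩
  refine mem_tensor_top_iff.2 fun ℓ => ?_
  have h1 : (ℓ : W →ₗ[ℂ] ℂ) ∘ₗ (LinearMap.id - p) ∈ Q := by
    refine hQ' ((Submodule.mem_dualAnnihilator _).2 fun w hw => ?_)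
    simp [p, Submodule.projectionOnto_apply_left hπ ⟨w, hw⟩]
  exact h1

end Tensor

variable {E : Type*} [NormedAddCommGroup E] [NormedSpace ℝ E]
  {G : Type*} [TopologicalSpace G] [ChartedSpace E G] [Group G]
  [FiniteDimensional ℝ E] [LieGroup 𝓘(ℝ, E) ∞ G]

namespace StandardParabolic

variable {D : StandardParabolic E G} {V₁ V₂ : Type*} [NormedAddCommGroup V₁] [NormedSpace ℂ V₁]
  [NormedAddCommGroup V₂] [NormedSpace ℂ V₂]

/-- If there is a simple root outside the Levi factor, then `𝔫̄` contains its negative root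
space. -/
theorem nontrivial_nbar {i : Fin (finrank ℝ D.𝔞)} (hi : i ∉ D.Levi) : Nontrivial D.Nbar := by
  obtain ⟨X, hX, hX0⟩ := D.exists_mem_rootSpace_neg_simple i
  have hht : D.ht (-D.simple i) = (-1 : ℤ) := by rw [map_neg, ht_simple D hi]; simp
  let j : Fin D.depth := ⟨0, D.one_le_depth hi⟩
  have hXj : (X : E) ∈ D.negPart j := D.rootSpace_le_gr (by simpa [j] using hht) hX
  refine ⟨⟨Pi.single j ⟨X, hXj⟩, 0, fun h0 => hX0 ?_⟩⟩
  have := congrFun h0 j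
  rw [Pi.single_eq_same] at this
  exact congrArg Subtype.val this

/-- The action `w ↦ ρ₂(l) ∘ w ∘ ρ₁(l)⁻¹` on `Hom(V₁, V₂)`. -/
def conjHom (ρ₁ : D.MA →* (V₁ →L[ℂ] V₁)) (ρ₂ : D.MA →* (V₂ →L[ℂ] V₂)) (l : D.MA) :
    (V₁ →L[ℂ] V₂) →L[ℂ] (V₁ →L[ℂ] V₂) :=
  (ContinuousLinearMap.compL ℂ V₁ V₂ V₂ (ρ₂ l)).comp
    ((ContinuousLinearMap.compL ℂ V₁ V₁ V₂).flip (ρ₁ l⁻¹))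

variable (ρ₁ : D.MA →* (V₁ →L[ℂ] V₁)) (ρ₂ : D.MA →* (V₂ →L[ℂ] V₂))

theorem conjHom_apply (l : D.MA) (w : V₁ →L[ℂ] V₂) (v : V₁) :
    conjHom ρ₁ ρ₂ l w v = ρ₂ l (w (ρ₁ l⁻¹ v)) := rfl

theorem rep_apply_inv {V : Type*} [NormedAddCommGroup V] [NormedSpace ℂ V]
    (ρ : D.MA →* (V →L[ℂ] V)) (l : D.MA) (v : V) : ρ l (ρ l⁻¹ v) = v := by
  have := DFunLike.congr_fun (map_mul ρ l l⁻¹) v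
  rw [mul_inv_cancel, map_one] at this
  exact this.symm

theorem rep_inv_apply {V : Type*} [NormedAddCommGroup V] [NormedSpace ℂ V]
    (ρ : D.MA →* (V →L[ℂ] V)) (l : D.MA) (v : V) : ρ l⁻¹ (ρ l v) = v := by
  simpa using rep_apply_inv ρ l⁻¹ v

theorem conjHom_inv_apply (l : D.MA) (w : V₁ →L[ℂ] V₂) :
    conjHom ρ₁ ρ₂ l⁻¹ (conjHom ρ₁ ρ₂ l w) = w := by
  ext v
  rw [conjHom_apply, conjHom_apply, rep_inv_apply, inv_inv, rep_inv_apply]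

theorem act_eq (l : D.MA) (k : Dist D.Nbar (V₁ →L[ℂ] V₂)) :
    act ρ₁ ρ₂ l k = mapTarget (conjHom ρ₁ ρ₂ l) (pushforward (D.adNbar (l : G)) k) := rfl

theorem act_tmul (l : D.MA) (k : D.ScalarDist) (w : V₁ →L[ℂ] V₂) :
    act ρ₁ ρ₂ l (tmul k w) = tmul (pushforward (D.adNbar (l : G)) k) (conjHom ρ₁ ρ₂ l w) := by
  rw [act_eq, pushforward_tmul, mapTarget_tmul]

theorem act_mul (l l' : D.MA) (k : Dist D.Nbar (V₁ →L[ℂ] V₂)) :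
    act ρ₁ ρ₂ (l * l') k = act ρ₁ ρ₂ l (act ρ₁ ρ₂ l' k) := by
  ext f v
  rw [act_apply, act_apply, act_apply]
  have h1 : pullback (D.adNbar ((l * l' : D.MA) : G)) f =
      pullback (D.adNbar (l' : G)) (pullback (D.adNbar (l : G)) f) := by
    ext X
    simp only [pullback_apply, Subgroup.coe_mul]
    rw [adNbar_mul D l.2 l'.2]
  rw [h1, map_mul, mul_inv_rev, map_mul]
  rfl

theorem act_one (k : Dist D.Nbar (V₁ →L[ℂ] V₂)) : act ρ₁ ρ₂ 1 k = k := by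
  ext f v
  rw [act_apply]
  have h1 : pullback (D.adNbar ((1 : D.MA) : G)) f = f := by
    ext X
    simp only [pullback_apply, Subgroup.coe_one]
    rw [adNbar_one]
  rw [h1, inv_one, map_one, map_one]
  rfl

/-- The action of `M_P A_P` descends to the fibre. -/
theorem act_mem_tensor_polyDist {m : ℂ} (l : D.MA) {k : Dist D.Nbar (V₁ →L[ℂ] V₂)}
    (hk : k ∈ tensor (D.polyDist m) ⊤) : act ρ₁ ρ₂ l k ∈ tensor (D.polyDist m) ⊤ := by
  refine (Submodule.span_le.2 ?_ : tensor (D.polyDist m) ⊤ ≤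
    (tensor (D.polyDist m) ⊤).comap (act ρ₁ ρ₂ l)) hk
  rintro _ ⟨k, hk, w, hw, rfl⟩
  change act ρ₁ ρ₂ l (tmul k w) ∈ tensor (D.polyDist m) ⊤
  rw [act_tmul]
  exact tmul_mem_tensor (pushforward_mem_polyDist hk fun r X => D.adNbar_dilation l.2 r X)
    Submodule.mem_top

theorem toFibre_eq_iff {m : ℂ} {k k' : Dist D.Nbar (V₁ →L[ℂ] V₂)} :
    (toFibre m k : D.Fibre V₁ V₂ m) = toFibre m k' ↔ k - k' ∈ tensor (D.polyDist m) ⊤ :=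
  Submodule.Quotient.eq _

variable {ρ₁ ρ₂}

theorem actsTo_toFibre_iff {m : ℂ} {l : D.MA} {k : Dist D.Nbar (V₁ →L[ℂ] V₂)} :
    ActsTo ρ₁ ρ₂ m l (toFibre m k) (toFibre m k) ↔
      act ρ₁ ρ₂ l k - k ∈ tensor (D.polyDist m) ⊤ := by
  refine ⟨?_, fun h => ⟨k, rfl, toFibre_eq_iff.2 h⟩⟩
  rintro ⟨k', h1, h2⟩
  rw [toFibre_eq_iff] at h1 h2
  have h3 := sub_mem h2 (act_mem_tensor_polyDist ρ₁ ρ₂ l h1)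
  rw [map_sub] at h3
  convert h3 using 1
  abel

variable (ρ₁ ρ₂) in
/-- The stabilizer in `M_P A_P` of the class of `k` in the fibre. -/
def stabilizer (m : ℂ) (k : Dist D.Nbar (V₁ →L[ℂ] V₂)) : Subgroup D.MA where
  carrier := {l | act ρ₁ ρ₂ l k - k ∈ tensor (D.polyDist m) ⊤}
  one_mem' := by simp [act_one]
  mul_mem' := fun {l l'} hl hl' => by
    have h1 := add_mem (act_mem_tensor_polyDist ρ₁ ρ₂ l hl') hl
    rw [map_sub, ← act_mul, sub_add_sub_cancel] at h1
    exact h1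
  inv_mem' := fun {l} hl => by
    have h1 := neg_mem (act_mem_tensor_polyDist ρ₁ ρ₂ l⁻¹ hl)
    rw [map_sub, ← act_mul, inv_mul_cancel, act_one, neg_sub] at h1
    exact h1

theorem mem_stabilizer {m : ℂ} {k : Dist D.Nbar (V₁ →L[ℂ] V₂)} {l : D.MA} :
    l ∈ stabilizer ρ₁ ρ₂ m k ↔ act ρ₁ ρ₂ l k - k ∈ tensor (D.polyDist m) ⊤ := Iff.rfl

/-- A subgroup of `M_P A_P` which contains `M_P` and `A_P` is everything. -/
theorem eq_top_of_M_A {S : Subgroup D.MA} (hM : ∀ l : D.MA, (l : G) ∈ D.M → l ∈ S)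
    (hA : ∀ a : D.A, D.ofA a ∈ S) (l : D.MA) : l ∈ S := by
  have h1 : D.MA ≤ S.map D.MA.subtype := by
    refine sup_le (fun g hg => ?_) fun g hg => ?_
    · exact ⟨⟨g, (le_sup_left : D.M ≤ D.MA) hg⟩, hM _ hg, rfl⟩
    · exact ⟨D.ofA ⟨g, hg⟩, hA _, rfl⟩
  obtain ⟨l', hl', h⟩ := h1 l.2
  rwa [← (Subtype.ext h : l' = l)]

/-- Symbols are smooth off the origin. -/
theorem exists_density_of_mem_tensor {W : Type*} [NormedAddCommGroup W] [NormedSpace ℂ W]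
    [CompleteSpace W] {m : ℂ} {k : Dist D.Nbar W} (hk : k ∈ tensor (D.homogDist m) ⊤) :
    ∃ h : D.Nbar → W, ContDiffOn ℝ ∞ h {0}ᶜ ∧ IsDensityOff {0} k h := by
  induction hk using Submodule.span_induction with
  | mem k h =>
    obtain ⟨k, ⟨-, h, hh, hkh⟩, w, -, rfl⟩ := h
    exact ⟨_, hh.smul contDiffOn_const, hkh.tmul w⟩
  | zero => exact ⟨0, contDiffOn_const, .zero⟩
  | add k k' _ _ h h' =>
    obtain ⟨h, hh, hk⟩ := h
    obtain ⟨h', hh', hk'⟩ := h'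
    exact ⟨_, hh.add hh', hk.add hk'⟩
  | smul c k _ h =>
    obtain ⟨h, hh, hk⟩ := h
    exact ⟨_, hh.const_smul c, hk.smul c⟩

theorem isSmoothFamily_const {W : Type*} [NormedAddCommGroup W] [NormedSpace ℂ W]
    {k : Dist D.Nbar W} {h : D.Nbar → W} (hh : ContDiffOn ℝ ∞ h {0}ᶜ) (hk : IsDensityOff {0} k h) :
    IsSmoothFamily (fun _ : G => k) := by
  refine ⟨fun f => contMDiff_const, fun x => h x.2, ?_, fun g => hk⟩
  exact hh.contMDiffOn.comp contMDiff_snd.contMDiffOn fun x hx => hx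

/-- An invariant symbol is a constant function on `G`, whose value is an invariant element of the
fibre. -/
theorem mem_invariantSymbols_iff [FiniteDimensional ℂ V₁] [FiniteDimensional ℂ V₂]
    [Nontrivial D.Nbar] {m : ℂ} {a : G → D.Fibre V₁ V₂ m} :
    a ∈ invariantSymbols ρ₁ ρ₂ m ↔ ∃ k ∈ tensor (D.homogDist m) (⊤ : Submodule ℂ (V₁ →L[ℂ] V₂)),
      (∀ l, l ∈ stabilizer ρ₁ ρ₂ m k) ∧ a = fun _ => toFibre m k := by
  constructor
  · rintro ⟨⟨h1, h2, -⟩, h3⟩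
    have hconst : ∀ g, a g = a 1 := fun g => by
      have := h3 g g
      rwa [inv_mul_cancel, eq_comm] at this
    obtain ⟨k, hk, hka⟩ := h1 1
    rw [symDist_eq_homogDist] at hk
    refine ⟨k, hk, fun l => actsTo_toFibre_iff.1 ?_, funext fun g => (hconst g).trans hka.symm⟩
    have := h2 1 l 1
    rw [hconst, ← hka] at this
    exact this
  · rintro ⟨k, hk, hl, rfl⟩
    obtain ⟨h, hh, hkh⟩ := exists_density_of_mem_tensor hk
    refine ⟨⟨fun g => ⟨k, by rwa [symDist_eq_homogDist], rfl⟩,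
      fun g l n => actsTo_toFibre_iff.2 (hl l), fun _ => k, isSmoothFamily_const hh hkh,
      fun g => rfl⟩, fun _ _ => rfl⟩

end StandardParabolic

end

section

/-! ### Invariant symbols in rank greater than one and in rank one -/

/-- Linear isomorphisms between the entries of two spaces of matrices. -/
theorem exists_linearEquiv_pi_pi {R ι κ : Type*} [Semiring R] {M M' : ι → κ → Type*}
    [∀ i j, AddCommMonoid (M i j)] [∀ i j, Module R (M i j)]
    [∀ i j, AddCommMonoid (M' i j)] [∀ i j, Module R (M' i j)]
    {S : ∀ i j, Submodule R (M i j)} {S' : ∀ i j, Submodule R (M' i j)}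
    (e : ∀ i j, S i j ≃ₗ[R] S' i j) :
    ∃ f : Submodule.pi Set.univ (fun i => Submodule.pi Set.univ (S i)) ≃ₗ[R]
        Submodule.pi Set.univ (fun i => Submodule.pi Set.univ (S' i)),
      ∀ a i j, (f a).1 i j = e i j ⟨a.1 i j, a.2 i trivial j trivial⟩ :=
  ⟨{ toFun := fun a => ⟨fun i j => e i j ⟨a.1 i j, a.2 i trivial j trivial⟩,
      fun i _ j _ => (e i j _).2⟩
     map_add' := fun a b => Subtype.ext (funext₂ fun i j => congrArg Subtype.val
      ((e i j).map_add ⟨a.1 i j, a.2 i trivial j trivial⟩ ⟨b.1 i j, b.2 i trivial j trivial⟩))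
     map_smul' := fun c a => Subtype.ext (funext₂ fun i j => congrArg Subtype.val
      ((e i j).map_smul c ⟨a.1 i j, a.2 i trivial j trivial⟩))
     invFun := fun c => ⟨fun i j => (e i j).symm ⟨c.1 i j, c.2 i trivial j trivial⟩,
      fun i _ j _ => ((e i j).symm _).2⟩
     left_inv := fun a => Subtype.ext (funext₂ fun i j => congrArg Subtype.val
      ((e i j).symm_apply_apply ⟨a.1 i j, a.2 i trivial j trivial⟩))
     right_inv := fun c => Subtype.ext (funext₂ fun i j => congrArg Subtype.val
      ((e i j).apply_symm_apply ⟨c.1 i j, c.2 i trivial j trivial⟩)) },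
    fun _ _ _ => rfl⟩

variable {E : Type*} [NormedAddCommGroup E] [NormedSpace ℝ E]
  {G : Type*} [TopologicalSpace G] [ChartedSpace E G] [Group G]
  [FiniteDimensional ℝ E] [LieGroup 𝓘(ℝ, E) ∞ G]

namespace StandardParabolic

variable {D : StandardParabolic E G}

/-- Vector-valued homogeneous polynomial densities have a smooth density which is homogeneous. -/
theorem exists_density_of_mem_tensor_polyDist {W : Type*} [NormedAddCommGroup W] [NormedSpace ℂ W]
    [CompleteSpace W] {m : ℂ} {u : Dist D.Nbar W} (hu : u ∈ tensor (D.polyDist m) ⊤) :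
    ∃ F : D.Nbar → W, ContDiff ℝ ∞ F ∧ (∀ r : ℝˣ, 0 < (r : ℝ) → ∀ X,
      F (D.dilation r X) = ((r : ℝ) : ℂ) ^ (-m - D.hdim) • F X) ∧ IsDensityOff ∅ u F := by
  induction hu using Submodule.span_induction with
  | mem k h =>
    obtain ⟨k, ⟨p, hp, hk⟩, w, -, rfl⟩ := h
    exact ⟨_, (contDiff_of_mem_polyFun hp).smul contDiff_const,
      fun r hr X => by
        change p _ • w = _ • p X • w
        rw [hp.2 r hr X, mul_smul], hk.tmul w⟩
  | zero => exact ⟨0, contDiff_const, fun r hr X => by simp, .zero⟩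
  | add k k' _ _ h h' =>
    obtain ⟨F, hF, h, hk⟩ := h
    obtain ⟨F', hF', h', hk'⟩ := h'
    exact ⟨_, hF.add hF', fun r hr X => by simp [h r hr, h' r hr], hk.add hk'⟩
  | smul c k _ h =>
    obtain ⟨F, hF, h, hk⟩ := h
    exact ⟨_, hF.const_smul c, fun r hr X => by simp [h r hr, smul_comm c], hk.smul c⟩

/-- The elements of `𝒰_m` are supported at the origin. -/
theorem isDensityOff_zero_of_mem_envDist {m : ℂ} {k : D.ScalarDist} (hk : k ∈ D.envDist m) :
    IsDensityOff {0} k 0 := by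
  induction hk using Submodule.span_induction with
  | mem k h =>
    obtain ⟨l, d, X, -, hk⟩ := h
    intro f hf
    have h0 : iteratedFDeriv ℝ l f 0 = 0 := by
      by_contra h
      exact Set.disjoint_singleton_right.1 hf (support_iteratedFDeriv_subset l h)
    simp [hk, h0]
  | zero => exact .zero
  | add k k' _ _ h h' => simpa using h.add h'
  | smul c k _ h => simpa using h.smul c

theorem isDensityOff_zero_of_mem_tensor_envDist {W : Type*} [NormedAddCommGroup W]
    [NormedSpace ℂ W] [CompleteSpace W] {m : ℂ} {u : Dist D.Nbar W}
    (hu : u ∈ tensor (D.envDist m) ⊤) : IsDensityOff {0} u 0 := by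
  induction hu using Submodule.span_induction with
  | mem k h =>
    obtain ⟨k, hk, w, -, rfl⟩ := h
    exact ((isDensityOff_zero_of_mem_envDist hk).tmul w).congr fun X _ => by simp
  | zero => exact .zero
  | add k k' _ _ h h' => simpa using h.add h'
  | smul c k _ h => simpa using h.smul c

theorem mem_twistedHom_iff {V₁ V₂ : Type*} [NormedAddCommGroup V₁] [NormedSpace ℂ V₁]
    [NormedAddCommGroup V₂] [NormedSpace ℂ V₂] {ρ₁ : D.MA →* (V₁ →L[ℂ] V₁)}
    {ρ₂ : D.MA →* (V₂ →L[ℂ] V₂)} {χ : D.A →* ℂˣ} {w : V₁ →L[ℂ] V₂} :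
    w ∈ twistedHom ρ₁ ρ₂ χ ↔ ∀ a : D.A, conjHom ρ₁ ρ₂ (D.ofA a) w = (χ a : ℂ) • w := by
  constructor
  · intro hw a
    ext v
    rw [conjHom_apply, ← hw a, rep_apply_inv, map_smul, smul_apply]
  · intro hw a v
    have := DFunLike.congr_fun (hw a) (ρ₁ (D.ofA a) v)
    rw [conjHom_apply, rep_inv_apply, smul_apply] at this
    rw [map_smul, this]

variable {V₁ V₂ : Type*} [NormedAddCommGroup V₁] [NormedSpace ℂ V₁] [FiniteDimensional ℂ V₁]
  [NormedAddCommGroup V₂] [NormedSpace ℂ V₂] [FiniteDimensional ℂ V₂]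
  {ρ₁ : D.MA →* (V₁ →L[ℂ] V₁)} {ρ₂ : D.MA →* (V₂ →L[ℂ] V₂)} {m : ℂ}

/-- The density of an invariant symbol is covariant under the elements of `M_P A_P`. -/
theorem isCovariant_density {l : D.MA} {k : Dist D.Nbar (V₁ →L[ℂ] V₂)}
    (hl : l ∈ stabilizer ρ₁ ρ₂ m k) {h : D.Nbar → (V₁ →L[ℂ] V₂)} (hh : ContDiffOn ℝ ∞ h {0}ᶜ)
    (hk : IsDensityOff {0} k h) {r : ℝˣ} (hr : 0 < (r : ℝ)) :
    IsCovariant (D.dilation r : D.Nbar →L[ℝ] D.Nbar) (D.adNbar (l : G)) h := by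
  have : CompleteSpace (V₁ →L[ℂ] V₂) := FiniteDimensional.complete ℂ _
  obtain ⟨F, hF, hFr, hFu⟩ := exists_density_of_mem_tensor_polyDist (mem_stabilizer.1 hl)
  let T := D.adNbar (l : G)
  set d : ℝ := |(LinearMap.det (T : D.Nbar →ₗ[ℝ] D.Nbar))⁻¹| with hd
  have hd0 : 0 < d := abs_pos.2 (inv_ne_zero T.toLinearEquiv.isUnit_det'.ne_zero)
  have h1 : IsDensityOff {0} (act ρ₁ ρ₂ l k) (fun X => conjHom ρ₁ ρ₂ l (d • h (T.symm X))) :=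
    (hk.pushforward T (by simp)).mapTarget (conjHom ρ₁ ρ₂ l)
  have h2 : IsDensityOff {0} (act ρ₁ ρ₂ l k) (h + F) := by
    have := hk.add (hFu.mono (Set.empty_subset _))
    rwa [add_sub_cancel] at this
  have hmaps : Set.MapsTo T.symm ({0}ᶜ : Set D.Nbar) {0}ᶜ := fun X hX => by simpa using hX
  have h3 := h1.eqOn h2
    ((conjHom ρ₁ ρ₂ l).continuous.comp_continuousOn
      ((hh.continuousOn.comp T.symm.continuous.continuousOn hmaps).const_smul d))
    (hh.continuousOn.add hF.continuous.continuousOn)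
  refine ⟨(d : ℂ) • conjHom ρ₁ ρ₂ l, ((d⁻¹ : ℝ) : ℂ) • conjHom ρ₁ ρ₂ l⁻¹, fun X => -F (T X),
    fun w => ?_, ⟨(hF.comp T.contDiff).neg,
      ((r : ℝ) : ℂ) ^ (-m - D.hdim), ?_, fun X => ?_⟩, fun X hX => ?_⟩
  · rw [smul_apply, smul_apply, map_smul, conjHom_inv_apply, smul_smul, ← Complex.ofReal_mul,
      inv_mul_cancel₀ hd0.ne', Complex.ofReal_one, one_smul]
  · exact fun h0 => hr.ne' (by exact_mod_cast ((Complex.cpow_eq_zero_iff _ _).1 h0).1)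
  · change -F (T (D.dilation r X)) = _
    rw [D.adNbar_dilation l.2, hFr r hr, smul_neg]
  · have h4 := h3 (show T X ∈ ({0}ᶜ : Set D.Nbar) by simpa using hX)
    simp only [T.symm_apply_apply, Pi.add_apply] at h4
    rw [smul_apply, ← sub_eq_add_neg, eq_sub_iff_add_eq, ← h4,
      ContinuousLinearMap.map_smul_of_tower, Complex.coe_smul]

/-- If the rank of `A_P` exceeds one, invariant symbols are symbols of differential operators. -/
theorem isDifferentialSymbol_of_one_lt_rank (hrank : 1 < D.rank) {a : G → D.Fibre V₁ V₂ m}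
    (ha : a ∈ invariantSymbols ρ₁ ρ₂ m) : IsDifferentialSymbol m a := by
  have : CompleteSpace (V₁ →L[ℂ] V₂) := FiniteDimensional.complete ℂ _
  obtain ⟨i, hi⟩ := Finset.card_pos.1 ((zero_lt_one.trans hrank).trans_le D.rank_le)
  have := nontrivial_nbar (Finset.mem_compl.1 hi)
  obtain ⟨k, hk, hl, rfl⟩ := mem_invariantSymbols_iff.1 ha
  obtain ⟨h, hh, hkh⟩ := exists_density_of_mem_tensor hk
  obtain ⟨a₁, a₂, n, b, p, q, h₁, h₂, hδ, hpq, hp, hq⟩ := D.exists_coweight_pair hrank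
  let r : ℝˣ := Units.mk0 (Real.exp (-1)) (Real.exp_pos _).ne'
  have hr : 0 < (r : ℝ) := Real.exp_pos _
  obtain ⟨F, hF, hhF⟩ := exists_mem_polySpan_of_isCovariant b
    (S := (D.dilation r : D.Nbar →L[ℝ] D.Nbar)) (fun s => by
      refine (hδ s r).trans ?_
      rw [Units.val_mk0, ← Real.exp_nat_mul, mul_neg_one]) h₁ h₂ hpq hp hq hh
    (isCovariant_density (hl (D.ofA a₁)) hh hkh hr) (isCovariant_density (hl (D.ofA a₂)) hh hkh hr)
  have hkF : IsDensityOff {0} k F := hkh.congr hhF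
  obtain ⟨x, hx, u, hu, rfl⟩ := Submodule.mem_sup.1 (mem_tensor_sup (S := D.polyDist m)
    (S' := D.envDist m) (u := k) fun ℓ => mem_polyDist_sup_envDist
      (mapTarget_mem_of_mem_tensor ℓ hk) (apply_mem_polyAlg (ℓ : (V₁ →L[ℂ] V₂) →ₗ[ℂ] ℂ) hF)
      (hkF.mapTarget ℓ))
  refine ⟨fun _ => u, isSmoothFamily_const (h := 0) contDiffOn_const
    (isDensityOff_zero_of_mem_tensor_envDist hu), fun g => ⟨hu, toFibre_eq_iff.2 ?_⟩⟩
  rwa [add_sub_cancel_right]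

/-- In rank one, `A_P` acts through the dilations, so that invariance under `A_P` is a condition on
the coefficients in `Hom(V₁, V₂)` alone. -/
theorem mem_invariantSymbols_iff_of_rank_eq_one (hrank : D.rank = 1) {χ : D.A →* ℂˣ}
    (hχ : D.HasHeight χ m) {a : G → D.Fibre V₁ V₂ m} :
    a ∈ invariantSymbols ρ₁ ρ₂ m ↔ ∃ c ∈ invariantFibre ρ₁ ρ₂ m χ, a = fun _ => c := by
  obtain ⟨i, hi⟩ := D.exists_notMem_Levi hrank
  have := nontrivial_nbar hi
  -- modulo `𝒫^m`, the action of `A_P` on symbols is the action on the coefficients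
  have hact : ∀ (b : D.A) {k : Dist D.Nbar (V₁ →L[ℂ] V₂)}, k ∈ tensor (D.homogDist m) ⊤ →
      act ρ₁ ρ₂ (D.ofA b) k - mapTarget ((χ b : ℂ)⁻¹ • conjHom ρ₁ ρ₂ (D.ofA b)) k ∈
        tensor (D.polyDist m) ⊤ := by
    intro b k hk
    obtain ⟨r, hr, hrb, hrχ⟩ := D.exists_adNbar_eq_dilation hrank b
    have hT : D.adNbar (b : G) = D.dilation r := ContinuousLinearEquiv.ext (funext hrb)
    have h1 : pushforward (D.dilation r) k - ((r : ℝ) : ℂ) ^ m • k ∈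
        tensor (D.polyDist m) (⊤ : Submodule ℂ (V₁ →L[ℂ] V₂)) :=
      mem_tensor_top_iff.2 fun ℓ => by
        rw [map_sub, map_smul, mapTarget_pushforward]
        exact (mapTarget_mem_of_mem_tensor ℓ hk).1 r hr
    have h2 := mapTarget_mem_tensor (H' := (⊤ : Submodule ℂ (V₁ →L[ℂ] V₂)))
      (L := conjHom ρ₁ ρ₂ (D.ofA b)) (fun _ _ => Submodule.mem_top) h1
    rw [map_sub, map_smul] at h2
    rw [hrχ χ m hχ, inv_inv]
    have h3 : act ρ₁ ρ₂ (D.ofA b) k =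
        mapTarget (conjHom ρ₁ ρ₂ (D.ofA b)) (pushforward (D.dilation r) k) :=
      congrArg (fun T => mapTarget (conjHom ρ₁ ρ₂ (D.ofA b)) (pushforward T k)) hT
    rw [h3]
    exact h2
  rw [mem_invariantSymbols_iff]
  constructor
  · rintro ⟨k, hk, hl, rfl⟩
    obtain ⟨k', hk', hkk'⟩ := exists_mem_tensor_of_forall_sub_mem
      (L := fun b : D.A => (χ b : ℂ)⁻¹ • conjHom ρ₁ ρ₂ (D.ofA b)) (H := twistedHom ρ₁ ρ₂ χ)
      (fun w hw => mem_twistedHom_iff.2 fun b => by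
        have := hw b
        rw [smul_apply, inv_smul_eq_iff₀ (χ b).ne_zero] at this
        exact this) hk (S' := D.polyDist m) (fun b => by
        have := sub_mem (mem_stabilizer.1 (hl (D.ofA b))) (hact b hk)
        rwa [sub_sub_sub_cancel_left] at this)
    refine ⟨toFibre m k, ⟨⟨k', ?_, (toFibre_eq_iff.2 hkk').symm⟩,
      fun l _ => actsTo_toFibre_iff.2 (hl l)⟩, rfl⟩
    rwa [symDist_eq_homogDist]
  · rintro ⟨c, ⟨⟨k, hk, rfl⟩, hM⟩, rfl⟩
    rw [symDist_eq_homogDist] at hk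
    have hk' : k ∈ tensor (D.homogDist m) (⊤ : Submodule ℂ (V₁ →L[ℂ] V₂)) :=
      Submodule.span_mono (by
        rintro _ ⟨κ, hκ, w, -, rfl⟩
        exact ⟨κ, hκ, w, Submodule.mem_top, rfl⟩) hk
    refine ⟨k, hk', eq_top_of_M_A (fun l hl => actsTo_toFibre_iff.1 (hM l hl)) fun b => ?_, rfl⟩
    have h1 := hact b hk'
    have h2 : mapTarget ((χ b : ℂ)⁻¹ • conjHom ρ₁ ρ₂ (D.ofA b)) k = k := by
      refine (Submodule.span_le.2 ?_ : tensor (D.homogDist m) (twistedHom ρ₁ ρ₂ χ) ≤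
        LinearMap.eqLocus (mapTarget ((χ b : ℂ)⁻¹ • conjHom ρ₁ ρ₂ (D.ofA b))) LinearMap.id) hk
      rintro _ ⟨κ, hκ, w, hw, rfl⟩
      change mapTarget _ _ = tmul κ w
      rw [mapTarget_tmul, smul_apply, mem_twistedHom_iff.1 hw b, smul_smul,
        inv_mul_cancel₀ (χ b).ne_zero, one_smul]
    rwa [h2] at h1

/-- Evaluation at the base point, as a linear isomorphism of invariant symbols in rank one. -/
theorem exists_evalEquiv (hrank : D.rank = 1) {χ : D.A →* ℂˣ} (hχ : D.HasHeight χ m) :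
    ∃ e : invariantSymbols ρ₁ ρ₂ m ≃ₗ[ℂ] invariantFibre ρ₁ ρ₂ m χ,
      ∀ a, (e a : D.Fibre V₁ V₂ m) = (a : G → D.Fibre V₁ V₂ m) 1 := by
  have hiff := fun a : G → D.Fibre V₁ V₂ m =>
    mem_invariantSymbols_iff_of_rank_eq_one (ρ₁ := ρ₁) (ρ₂ := ρ₂) hrank hχ (a := a)
  refine ⟨{ toFun := fun a => ⟨(a : G → D.Fibre V₁ V₂ m) 1, ?_⟩
            map_add' := fun _ _ => rfl
            map_smul' := fun _ _ => rfl
            invFun := fun c => ⟨fun _ => c, (hiff _).2 ⟨c, c.2, rfl⟩⟩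
            left_inv := fun a => ?_
            right_inv := fun _ => rfl }, fun _ => rfl⟩
  · obtain ⟨c, hc, hac⟩ := (hiff _).1 a.2
    rw [hac]
    exact hc
  · obtain ⟨c, hc, hac⟩ := (hiff _).1 a.2
    refine Subtype.ext ?_
    change (fun _ => (a : G → D.Fibre V₁ V₂ m) 1) = (a : G → D.Fibre V₁ V₂ m)
    rw [hac]

set_option maxHeartbeats 1000000 in
/-- Evaluation of graded invariant symbols at the base point, as a linear isomorphism in rank one. -/
theorem exists_graded_evalEquiv (hrank : D.rank = 1) {χ : ℂ → D.A →* ℂˣ}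
    (hχ : ∀ z, D.HasHeight (χ z) z) (R₁ : D.GradedRep V₁) (R₂ : D.GradedRep V₂) (m : ℂ) :
    ∃ e : gradedInvariantSymbols R₁ R₂ m ≃ₗ[ℂ] gradedInvariantFibre R₁ R₂ m χ,
      ∀ a (μ ν : ℝ), (e a).1 μ ν = a.1 μ ν 1 := by
  choose e he using fun μ ν : ℝ => exists_evalEquiv (ρ₁ := R₁.pieceRep ν) (ρ₂ := R₂.pieceRep μ)
    hrank (hχ (m + μ - ν))
  obtain ⟨e', he'⟩ := exists_linearEquiv_pi_pi e
  exact ⟨e', fun a μ ν => (he' a μ ν).trans (he μ ν _)⟩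

end StandardParabolic

end

end FlatParabolic
end

theorem mainTheorem9 {E : Type*} [NormedAddCommGroup E] [NormedSpace ℝ E] [FiniteDimensional ℝ E]
    {G : Type*} [TopologicalSpace G] [ChartedSpace E G] [Group G] [LieGroup 𝓘(ℝ, E) ∞ G]
    [ConnectedSpace G] [LieAlgebra.IsSemisimple ℝ (LieAlg E G)]
    (D : StandardParabolic E G)
    {V₁ V₂ : Type*} [NormedAddCommGroup V₁] [NormedSpace ℂ V₁] [FiniteDimensional ℂ V₁]
    [NormedAddCommGroup V₂] [NormedSpace ℂ V₂] [FiniteDimensional ℂ V₂]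
    (R₁ : D.GradedRep V₁) (R₂ : D.GradedRep V₂) (m : ℂ) :
    (1 < D.rank →
      (∀ a ∈ invariantSymbols R₁.ρ R₂.ρ m, IsDifferentialSymbol m a) ∧
      ∀ a ∈ gradedInvariantSymbols R₁ R₂ m, ∀ μ ν : ℝ, IsDifferentialSymbol (m + μ - ν) (a μ ν)) ∧
    (D.rank = 1 →
      (∀ z : ℂ, ∃! χ : D.A →* ℂˣ, D.HasHeight χ z) ∧
      (∀ χ : D.A →* ℂˣ, D.HasHeight χ m →
        ∃ e : invariantSymbols R₁.ρ R₂.ρ m ≃ₗ[ℂ] invariantFibre R₁.ρ R₂.ρ m χ,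
          ∀ a, (e a : D.Fibre V₁ V₂ m) = (a : G → D.Fibre V₁ V₂ m) 1) ∧
      (∀ χ : ℂ → D.A →* ℂˣ, (∀ z, D.HasHeight (χ z) z) →
        ∃ e : gradedInvariantSymbols R₁ R₂ m ≃ₗ[ℂ] gradedInvariantFibre R₁ R₂ m χ,
          ∀ a (μ ν : ℝ), (e a).1 μ ν = a.1 μ ν 1)) := by
  refine ⟨fun hrank => ⟨fun a ha => isDifferentialSymbol_of_one_lt_rank hrank ha,
    fun a ha μ ν => isDifferentialSymbol_of_one_lt_rank hrank (ha μ trivial ν trivial)⟩,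
    fun hrank => ⟨D.existsUnique_hasHeight hrank, fun χ hχ => exists_evalEquiv hrank hχ,
      fun χ hχ => exists_graded_evalEquiv hrank hχ R₁ R₂ m⟩⟩
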